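/- Fix parameters $\gamma\in[0,2]$ and $\kappa\in\mathbb R$. For $x=(\Sigma_+,\tilde\Sigma,\Delta,\tilde A,N_+)\in\mathbb R^5$ put $$\tilde N=\tfrac13(N_+^2-\kappa\tilde A),\quad q=\tfrac32(2-\gamma)(\Sigma_+^2+\tilde\Sigma)+\tfrac12(3\gamma-2)(1-\tilde A-\tilde N),\quad \Omega=1-\Sigma_+^2-\tilde\Sigma-\tilde A-\tilde N .$$ Let $\Gamma=(\Sigma_+,\tilde\Sigma,\Delta,\tilde A,N_+):\mathbb R\to\mathbb R^5$ be a solution, for all $\tau\in\mathbb R$, of the Hewitt–Wainwright system $$\begin{aligned}\Sigma_+'&=(q-2)\Sigma_+-2\tilde N,\\ \tilde\Sigma'&=2(q-2)\tilde\Sigma-4\Sigma_+\tilde A-4\Delta N_+,\\ \Delta'&=2(q+\Sigma_+-1)\Delta+2(\tilde\Sigma-\tilde N)N_+,\\ \tilde A'&=2(q+2\Sigma_+)\tilde A,\\ N_+'&=(q+2\Sigma_+)N_++6\Delta\end{aligned}$$ which satisfies the constraints $\tilde\Sigma\tilde N-\Delta^2-\Sigma_+^2\tilde A=0$, $\tilde\Sigma\ge0$,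 $\tilde A\ge0$, $\tilde N\ge0$, $\Sigma_+^2+\tilde\Sigma+\tilde A+\tilde N\le1$ and is vacuum, $\Omega\equiv0$. Assume that $\Gamma$ is not * the constant solution in the point Taub 1, $(-1,0,0,0,0)$; * a locally rotationally symmetric solution (of Bianchi type I, II or VI$_{-1}$), i.e. one with $3\Sigma_+^2=\tilde\Sigma$, $\Sigma_+N_+=\Delta$, $(\kappa+1)\tilde A=0$ for all $\tau$; * a constant solution in a plane wave equilibrium point, i.e. a point with $\Sigma_+>-1$, $\tilde\Sigma=-\Sigma_+(1+\Sigma_+)$, $\Delta=0$, $\tilde A=(1+\Sigma_+)^2$, $N_+^2=(1+\Sigma_+)(\kappa(1+\Sigma_+)-3\Sigma_+)$. Consider the spacetimes that $\Gamma$ describes. Such a spacetime is $\mathbb R\times G$, where $G$ is the simply connected Lie group whose Lie algebra has a basis $E_1,E_2,E_3$ with $[E_2,E_3]=0$ and $[E_1,E_A]=\sum_B M_A{}^BE_B$ ($A,B\in\{2,3\}$, $M$ a real matrix), with a Lorentzian metric of class $C^2$ that has an orthonormal frame $e_0=\frac{\theta}{3}\partial_\tau$ (timelike), $e_1=f(\tau)E_1$,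 $e_A=\sum_BF_A{}^B(\tau)E_B$; it solves the vacuum Einstein equations $\mathrm{Ric}=0$; and it has $\Gamma$ as its expansion-normalised variables: with $[e_\alpha,e_\beta]=\gamma_{\alpha\beta}^\delta e_\delta$ and $$\begin{gathered}\theta=-\gamma_{01}^1-\gamma_{02}^2-\gamma_{03}^3>0,\quad \sigma_{AB}=-\tfrac12(\gamma_{0A}^B+\gamma_{0B}^A)-\tfrac\theta3\delta_{AB},\quad a_1=\tfrac12(\gamma_{12}^2+\gamma_{13}^3),\\ n_{22}=-\gamma_{13}^2,\quad n_{23}=n_{32}=\tfrac12(\gamma_{12}^2-\gamma_{13}^3),\quad n_{33}=\gamma_{12}^3,\\ \sigma_+=\tfrac32(\sigma_{22}+\sigma_{33}),\quad n_+=\tfrac32(n_{22}+n_{33}),\quad \tilde\sigma_{AB}=\sigma_{AB}-\tfrac13\sigma_+\delta_{AB},\quad \tilde n_{AB}=n_{AB}-\tfrac13n_+\delta_{AB}\end{gathered}$$ one has $$\Sigma_+=\frac{\sigma_+}{\theta},\quad \tilde\Sigma=\frac{3\tilde\sigma^{AB}\tilde\sigma_{AB}}{2\theta^2},\quad \Delta=\frac{3\tilde\sigma^{AB}\tilde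 n_{AB}}{2\theta^2},\quad \tilde A=\frac{9a_1^2}{\theta^2},\quad N_+=\frac{n_+}{\theta},\quad \tilde N=\frac{3\tilde n^{AB}\tilde n_{AB}}{2\theta^2}.$$ Then for every $\theta_0>0$ there is such a spacetime with $\theta(0)=\theta_0$, and for every such spacetime the Kretschmann scalar $R_{\alpha\beta\gamma\delta}R^{\alpha\beta\gamma\delta}$, which is a function of $\tau$ alone, is unbounded as $\tau\to-\infty$: for all $C,T\in\mathbb R$ there is a $\tau\le T$ with $|R_{\alpha\beta\gamma\delta}R^{\alpha\beta\gamma\delta}(\tau)|>C$. -/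

import Mathlib

/-! ### The Hewitt–Wainwright system -/

/-- A point `(Σ₊, Σ̃, Δ, Ã, N₊)` of the extended state space `ℝ⁵`. -/
@[ext]
structure HWState where
  /-- `Σ₊` -/
  sigmaPlus : ℝ
  /-- `Σ̃` -/
  sigmaTilde : ℝ
  /-- `Δ` -/
  delta : ℝ
  /-- `Ã` -/
  aTilde : ℝ
  /-- `N₊` -/
  nPlus : ℝ

namespace HWState

/-- `Ñ = (N₊² - κ Ã) / 3`. -/
noncomputable def nTilde (κ : ℝ) (x : HWState) : ℝ :=
  (x.nPlus ^ 2 - κ * x.aTilde) / 3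

/-- The deceleration parameter `q`. -/
noncomputable def decel (γ κ : ℝ) (x : HWState) : ℝ :=
  3 / 2 * (2 - γ) * (x.sigmaPlus ^ 2 + x.sigmaTilde)
    + 1 / 2 * (3 * γ - 2) * (1 - x.aTilde - x.nTilde κ)

/-- The density parameter `Ω = 1 - Σ₊² - Σ̃ - Ã - Ñ`. -/
noncomputable def density (κ : ℝ) (x : HWState) : ℝ :=
  1 - x.sigmaPlus ^ 2 - x.sigmaTilde - x.aTilde - x.nTilde κ

/-- The constraints which cut out the physical state space. -/
structure Constraints (κ : ℝ) (x : HWState) : Prop where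
  momentum : x.sigmaTilde * x.nTilde κ - x.delta ^ 2 - x.sigmaPlus ^ 2 * x.aTilde = 0
  sigmaTilde_nonneg : 0 ≤ x.sigmaTilde
  aTilde_nonneg : 0 ≤ x.aTilde
  nTilde_nonneg : 0 ≤ x.nTilde κ
  sum_le_one : x.sigmaPlus ^ 2 + x.sigmaTilde + x.aTilde + x.nTilde κ ≤ 1

/-- The Kasner point Taub 1. -/
def taubOne : HWState := ⟨-1, 0, 0, 0, 0⟩

/-- The set of plane wave equilibrium points. -/
def planeWave (κ : ℝ) : Set HWState :=
  {x | -1 < x.sigmaPlus ∧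
    x.sigmaTilde = -x.sigmaPlus * (1 + x.sigmaPlus) ∧
    x.delta = 0 ∧
    x.aTilde = (1 + x.sigmaPlus) ^ 2 ∧
    x.nPlus ^ 2 = (1 + x.sigmaPlus) * (κ * (1 + x.sigmaPlus) - 3 * x.sigmaPlus)}

/-- Local rotational symmetry of a point of the state space. The points with `Ã = 0` are those of
Bianchi type I (`N₊ = 0`) and II (`N₊ ≠ 0`), those with `Ã > 0` are of type VI₋₁ (`κ = -1`). -/
def IsLRS (κ : ℝ) (x : HWState) : Prop :=
  3 * x.sigmaPlus ^ 2 = x.sigmaTilde ∧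
    x.sigmaPlus * x.nPlus = x.delta ∧
    (κ + 1) * x.aTilde = 0

end HWState

/-- `Γ` solves the evolution equations with parameters `γ`, `κ` for all times `τ ∈ ℝ`, and is
contained in the physical state space. -/
structure IsHWSolution (γ κ : ℝ) (Γ : ℝ → HWState) : Prop where
  sigmaPlus : ∀ τ, HasDerivAt (fun s => (Γ s).sigmaPlus)
    (((Γ τ).decel γ κ - 2) * (Γ τ).sigmaPlus - 2 * (Γ τ).nTilde κ) τ
  sigmaTilde : ∀ τ, HasDerivAt (fun s => (Γ s).sigmaTilde)
    (2 * ((Γ τ).decel γ κ - 2) * (Γ τ).sigmaTilde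
      - 4 * (Γ τ).sigmaPlus * (Γ τ).aTilde - 4 * (Γ τ).delta * (Γ τ).nPlus) τ
  delta : ∀ τ, HasDerivAt (fun s => (Γ s).delta)
    (2 * ((Γ τ).decel γ κ + (Γ τ).sigmaPlus - 1) * (Γ τ).delta
      + 2 * ((Γ τ).sigmaTilde - (Γ τ).nTilde κ) * (Γ τ).nPlus) τ
  aTilde : ∀ τ, HasDerivAt (fun s => (Γ s).aTilde)
    (2 * ((Γ τ).decel γ κ + 2 * (Γ τ).sigmaPlus) * (Γ τ).aTilde) τ
  nPlus : ∀ τ, HasDerivAt (fun s => (Γ s).nPlus)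
    (((Γ τ).decel γ κ + 2 * (Γ τ).sigmaPlus) * (Γ τ).nPlus + 6 * (Γ τ).delta) τ
  constraints : ∀ τ, (Γ τ).Constraints κ

/-! ### Curvature in an orthonormal frame

Let `e₀, e₁, e₂, e₃` be an orthonormal frame (`e₀` timelike) of a Lorentzian manifold with
`[e_α, e_β] = ∑ δ, c_{αβ}^δ e_δ`, where the `c_{αβ}^δ` depend only on a time function `τ` with
`e₀(τ) = 1 / N(τ)` and `e₁(τ) = e₂(τ) = e₃(τ) = 0`. -/

/-- The signature: `η α = g(e_α, e_α)`. -/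
def minkowskiSign (α : Fin 4) : ℝ := if α = 0 then -1 else 1

/-- `e_α(h)` for a function `h` of `τ`, where `e₀ = N⁻¹ ∂_τ`. -/
noncomputable def frameDeriv (N : ℝ → ℝ) (α : Fin 4) (h : ℝ → ℝ) (τ : ℝ) : ℝ :=
  if α = 0 then (N τ)⁻¹ * deriv h τ else 0

/-- The connection coefficients `Γ_{αβ}^δ` of the Levi-Civita connection,
`∇_{e_α} e_β = ∑ δ, Γ_{αβ}^δ e_δ`, by Koszul's formula. -/
noncomputable def frameConn (c : ℝ → Fin 4 → Fin 4 → Fin 4 → ℝ) (τ : ℝ) (α β δ : Fin 4) : ℝ :=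
  minkowskiSign δ / 2 *
    (minkowskiSign δ * c τ α β δ - minkowskiSign α * c τ β δ α + minkowskiSign β * c τ δ α β)

/-- The components `R_{αβμ}^δ` of the curvature tensor, `R(e_α, e_β) e_μ = ∑ δ, R_{αβμ}^δ e_δ`, with
`R(X, Y) Z = ∇_X ∇_Y Z - ∇_Y ∇_X Z - ∇_{[X, Y]} Z`. -/
noncomputable def frameRiemann (N : ℝ → ℝ) (c : ℝ → Fin 4 → Fin 4 → Fin 4 → ℝ) (τ : ℝ)
    (α β μ δ : Fin 4) : ℝ :=
  frameDeriv N α (fun s => frameConn c s β μ δ) τ - frameDeriv N β (fun s => frameConn c s α μ δ) τ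
    + ∑ ν : Fin 4, (frameConn c τ β μ ν * frameConn c τ α ν δ
        - frameConn c τ α μ ν * frameConn c τ β ν δ
        - c τ α β ν * frameConn c τ ν μ δ)

/-- The Ricci tensor `Ric(e_β, e_μ)`, the trace of `X ↦ R(X, e_β) e_μ`. -/
noncomputable def frameRicci (N : ℝ → ℝ) (c : ℝ → Fin 4 → Fin 4 → Fin 4 → ℝ) (τ : ℝ)
    (β μ : Fin 4) : ℝ :=
  ∑ α : Fin 4, frameRiemann N c τ α β μ α

/-- The Kretschmann scalar, the full contraction of the curvature tensor with itself. -/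
noncomputable def frameKretschmann (N : ℝ → ℝ) (c : ℝ → Fin 4 → Fin 4 → Fin 4 → ℝ) (τ : ℝ) : ℝ :=
  ∑ α : Fin 4, ∑ β : Fin 4, ∑ μ : Fin 4, ∑ δ : Fin 4,
    minkowskiSign α * minkowskiSign β * minkowskiSign μ * minkowskiSign δ *
      frameRiemann N c τ α β μ δ ^ 2

/-! ### Spatially homogeneous spacetimes -/

/-- A non-exceptional Bianchi spacetime `ℝ × G` whose group has a two-dimensional Abelian ideal.
`G` is the simply connected Lie group whose Lie algebra has a basis `E₁, E₂, E₃` with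
`[E₂, E₃] = 0` and `[E₁, E_A] = ∑ B, M_A^B E_B` (`A, B ∈ {2, 3}`). The Lorentzian metric is the one
for which the following frame is orthonormal, with `e₀` timelike:
`e₀ = N(τ)⁻¹ ∂_τ`, `e₁ = f(τ) E₁`, `e_A = ∑ B, F(τ)_A^B E_B`.
The matrix indices `0, 1 : Fin 2` stand for `A = 2, 3`. -/
structure BianchiSpacetime where
  /-- the structure constants of the Lie algebra -/
  M : Matrix (Fin 2) (Fin 2) ℝ
  /-- the lapse function `N`; proper time `t` satisfies `dt = N dτ` -/
  lapse : ℝ → ℝ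
  /-- the coefficient of `e₁` -/
  f : ℝ → ℝ
  /-- the coefficients of `e₂`, `e₃` -/
  F : ℝ → Matrix (Fin 2) (Fin 2) ℝ
  lapse_pos : ∀ τ, 0 < lapse τ
  f_ne_zero : ∀ τ, f τ ≠ 0
  det_F_ne_zero : ∀ τ, (F τ).det ≠ 0
  contDiff_lapse : ContDiff ℝ 2 lapse
  contDiff_f : ContDiff ℝ 2 f
  contDiff_F : ∀ A B, ContDiff ℝ 2 (fun τ => F τ A B)

namespace BianchiSpacetime

variable (S : BianchiSpacetime)

/-- `γ₀₁¹`: `[e₀, e₁] = N⁻¹ f' E₁ = (N⁻¹ f' / f) e₁`. -/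
noncomputable def timeCoeffOne (τ : ℝ) : ℝ := (S.lapse τ)⁻¹ * (deriv S.f τ / S.f τ)

/-- `γ_{0A}^B`: `[e₀, e_A] = N⁻¹ ∑ C, (F')_A^C E_C = ∑ B, (N⁻¹ F' F⁻¹)_A^B e_B`. -/
noncomputable def timeCoeff (τ : ℝ) : Matrix (Fin 2) (Fin 2) ℝ :=
  (S.lapse τ)⁻¹ • (Matrix.of (fun A B => deriv (fun s => S.F s A B) τ) * (S.F τ)⁻¹)

/-- `γ_{1A}^B`: `[e₁, e_A] = ∑ B, (f F M F⁻¹)_A^B e_B`. -/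
noncomputable def spaceCoeff (τ : ℝ) : Matrix (Fin 2) (Fin 2) ℝ :=
  S.f τ • (S.F τ * S.M * (S.F τ)⁻¹)

/-- The structure functions of the orthonormal frame, `[e_α, e_β] = ∑ δ, γ_{αβ}^δ e_δ`. -/
noncomputable def structureFun (τ : ℝ) : Fin 4 → Fin 4 → Fin 4 → ℝ
  | 0, 1, 1 => S.timeCoeffOne τ
  | 1, 0, 1 => -S.timeCoeffOne τ
  | 0, 2, 2 => S.timeCoeff τ 0 0
  | 0, 2, 3 => S.timeCoeff τ 0 1
  | 0, 3, 2 => S.timeCoeff τ 1 0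
  | 0, 3, 3 => S.timeCoeff τ 1 1
  | 2, 0, 2 => -S.timeCoeff τ 0 0
  | 2, 0, 3 => -S.timeCoeff τ 0 1
  | 3, 0, 2 => -S.timeCoeff τ 1 0
  | 3, 0, 3 => -S.timeCoeff τ 1 1
  | 1, 2, 2 => S.spaceCoeff τ 0 0
  | 1, 2, 3 => S.spaceCoeff τ 0 1
  | 1, 3, 2 => S.spaceCoeff τ 1 0
  | 1, 3, 3 => S.spaceCoeff τ 1 1
  | 2, 1, 2 => -S.spaceCoeff τ 0 0
  | 2, 1, 3 => -S.spaceCoeff τ 0 1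
  | 3, 1, 2 => -S.spaceCoeff τ 1 0
  | 3, 1, 3 => -S.spaceCoeff τ 1 1
  | _, _, _ => 0

/-- The Ricci curvature `Ric(e_α, e_β)` of the spacetime. -/
noncomputable def ricci (τ : ℝ) (α β : Fin 4) : ℝ := frameRicci S.lapse S.structureFun τ α β

/-- The Kretschmann scalar of the spacetime, a function of `τ`. -/
noncomputable def kretschmann (τ : ℝ) : ℝ := frameKretschmann S.lapse S.structureFun τ

/-- The mean curvature `θ` of the slice `{τ} × G`. -/
noncomputable def theta (τ : ℝ) : ℝ :=
  -S.timeCoeffOne τ - S.timeCoeff τ 0 0 - S.timeCoeff τ 1 1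

/-- The components `σ_{AB}` of the shear, `A, B ∈ {2, 3}`. -/
noncomputable def shear (τ : ℝ) : Matrix (Fin 2) (Fin 2) ℝ :=
  Matrix.of fun A B =>
    -(S.timeCoeff τ A B + S.timeCoeff τ B A) / 2 - (if A = B then S.theta τ / 3 else 0)

/-- `a₁ = (γ₁₂² + γ₁₃³) / 2`. -/
noncomputable def aOne (τ : ℝ) : ℝ := (S.spaceCoeff τ 0 0 + S.spaceCoeff τ 1 1) / 2

/-- The symmetric matrix `n_{AB}`: `n₂₂ = -γ₁₃²`, `n₂₃ = (γ₁₂² - γ₁₃³) / 2`, `n₃₃ = γ₁₂³`. -/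
noncomputable def nMat (τ : ℝ) : Matrix (Fin 2) (Fin 2) ℝ :=
  !![-S.spaceCoeff τ 1 0, (S.spaceCoeff τ 0 0 - S.spaceCoeff τ 1 1) / 2;
    (S.spaceCoeff τ 0 0 - S.spaceCoeff τ 1 1) / 2, S.spaceCoeff τ 0 1]

/-- `σ₊ = (3/2) σ_A^A`. -/
noncomputable def sigmaPlus (τ : ℝ) : ℝ := 3 / 2 * (S.shear τ).trace

/-- `n₊ = (3/2) n_A^A`. -/
noncomputable def nPlus (τ : ℝ) : ℝ := 3 / 2 * (S.nMat τ).trace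

/-- The trace-free part `σ̃_{AB} = σ_{AB} - (σ₊ / 3) δ_{AB}`. -/
noncomputable def shearFree (τ : ℝ) : Matrix (Fin 2) (Fin 2) ℝ :=
  S.shear τ - (S.sigmaPlus τ / 3) • (1 : Matrix (Fin 2) (Fin 2) ℝ)

/-- The trace-free part `ñ_{AB} = n_{AB} - (n₊ / 3) δ_{AB}`. -/
noncomputable def nFree (τ : ℝ) : Matrix (Fin 2) (Fin 2) ℝ :=
  S.nMat τ - (S.nPlus τ / 3) • (1 : Matrix (Fin 2) (Fin 2) ℝ)

/-- `σ̃ = (3/2) σ̃^{AB} σ̃_{AB}`. -/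
noncomputable def sigmaTilde (τ : ℝ) : ℝ :=
  3 / 2 * ∑ A, ∑ B, S.shearFree τ A B * S.shearFree τ A B

/-- `ñ = (3/2) ñ^{AB} ñ_{AB}`. -/
noncomputable def nTilde (τ : ℝ) : ℝ := 3 / 2 * ∑ A, ∑ B, S.nFree τ A B * S.nFree τ A B

/-- `δ = (3/2) σ̃^{AB} ñ_{AB}`. -/
noncomputable def delta (τ : ℝ) : ℝ := 3 / 2 * ∑ A, ∑ B, S.shearFree τ A B * S.nFree τ A B

/-- `ã = 9 a₁²`. -/
noncomputable def aTilde (τ : ℝ) : ℝ := 9 * S.aOne τ ^ 2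

/-- `S` is a vacuum spacetime whose expansion-normalised variables, with group parameter `κ` and
dimensionless time `τ` (`dt / dτ = 3 / θ`, `θ > 0`), are given by the curve `Γ`. -/
structure Realises (κ : ℝ) (Γ : ℝ → HWState) : Prop where
  vacuum : ∀ τ α β, S.ricci τ α β = 0
  theta_pos : ∀ τ, 0 < S.theta τ
  lapse_eq : ∀ τ, S.lapse τ = 3 / S.theta τ
  sigmaPlus_eq : ∀ τ, (Γ τ).sigmaPlus = S.sigmaPlus τ / S.theta τ
  sigmaTilde_eq : ∀ τ, (Γ τ).sigmaTilde = S.sigmaTilde τ / S.theta τ ^ 2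
  delta_eq : ∀ τ, (Γ τ).delta = S.delta τ / S.theta τ ^ 2
  aTilde_eq : ∀ τ, (Γ τ).aTilde = S.aTilde τ / S.theta τ ^ 2
  nPlus_eq : ∀ τ, (Γ τ).nPlus = S.nPlus τ / S.theta τ
  nTilde_eq : ∀ τ, (Γ τ).nTilde κ = S.nTilde τ / S.theta τ ^ 2

end BianchiSpacetime

/-! ### Linear differential equations on the line -/

section LinearODE

variable {E : Type*} [NormedAddCommGroup E] [NormedSpace ℝ E]

/-- A linear differential equation with uniformly bounded continuous coefficients has solutions on
an interval whose length does not depend on the initial data. -/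
theorem exists_hasDerivWithinAt_linear [CompleteSpace E] {A : ℝ → E →L[ℝ] E} (hA : Continuous A)
    {K : ℝ} (hK : ∀ t, ‖A t‖ ≤ K) (t₀ : ℝ) (x₀ : E) :
    ∃ y : ℝ → E, y 0 = x₀ ∧ ∀ t ∈ Set.Icc (-(1 / (2 * K + 1))) (1 / (2 * K + 1)),
      HasDerivWithinAt y (A (t₀ + t) (y t)) (Set.Icc (-(1 / (2 * K + 1))) (1 / (2 * K + 1))) t := by
  have hK0 : 0 ≤ K := (norm_nonneg _).trans (hK 0)
  have hε : 0 < 1 / (2 * K + 1) := by positivity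
  have hf : IsPicardLindelof (fun t x => A (t₀ + t) x)
      (⟨0, by constructor <;> linarith⟩ :
        Set.Icc (-(1 / (2 * K + 1))) (1 / (2 * K + 1))) x₀
      (⟨‖x₀‖ + 1, by positivity⟩) 0 ⟨K * (2 * ‖x₀‖ + 1), by positivity⟩ ⟨K, hK0⟩ := by
    refine ⟨fun t _ => ?_, fun x _ => ?_, fun t _ x hx => ?_, ?_⟩
    · exact ((A (t₀ + t)).lipschitz.weaken (by exact_mod_cast hK _)).lipschitzOnWith
    · exact Continuous.continuousOn (by fun_prop)
    · have h1 : ‖x‖ ≤ 2 * ‖x₀‖ + 1 := by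
        have h2 : dist x x₀ ≤ ‖x₀‖ + 1 := hx
        rw [dist_eq_norm] at h2
        calc ‖x‖ = ‖(x - x₀) + x₀‖ := by simp
          _ ≤ ‖x - x₀‖ + ‖x₀‖ := norm_add_le _ _
          _ ≤ _ := by linarith
      exact ((A (t₀ + t)).le_opNorm x).trans (mul_le_mul (hK _) h1 (norm_nonneg _) hK0)
    · simp only [sub_zero, zero_sub, neg_neg, max_self, NNReal.coe_zero]
      rw [mul_one_div, div_le_iff₀ (by positivity)]
      change K * (2 * ‖x₀‖ + 1) ≤ (‖x₀‖ + 1) * (2 * K + 1)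
      nlinarith [norm_nonneg x₀]
  obtain ⟨y, hy0, hy⟩ := hf.exists_eq_forall_mem_Icc_hasDerivWithinAt₀
  exact ⟨y, hy0, hy⟩

open scoped Manifold in
/-- A linear differential equation with bounded continuously differentiable coefficients has global
solutions. -/
theorem exists_hasDerivAt_linear [CompleteSpace E] {A : ℝ → E →L[ℝ] E} (hA : ContDiff ℝ 1 A)
    {K : ℝ} (hK : ∀ t, ‖A t‖ ≤ K) (x₀ : E) :
    ∃ y : ℝ → E, y 0 = x₀ ∧ ∀ t, HasDerivAt y (A t (y t)) t := by
  have hK0 : 0 ≤ K := (norm_nonneg _).trans (hK 0)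
  have hε : 0 < 1 / (2 * K + 1) := by positivity
  let v : (p : ℝ × E) → TangentSpace 𝓘(ℝ, ℝ × E) p := fun p => ((1 : ℝ), A p.1 p.2)
  have hv : ContMDiff 𝓘(ℝ, ℝ × E) 𝓘(ℝ, ℝ × E).tangent 1
      (fun p => (⟨p, v p⟩ : TangentBundle 𝓘(ℝ, ℝ × E) (ℝ × E))) := by
    rw [contMDiff_vectorSpace_iff_contDiff]
    exact contDiff_const.prodMk ((hA.comp contDiff_fst).clm_apply contDiff_snd)
  obtain ⟨γ, hγ0, hγ⟩ := exists_isMIntegralCurve_of_isMIntegralCurveOn hv hε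
    (fun p => by
      obtain ⟨y, hy0, hy⟩ := exists_hasDerivWithinAt_linear hA.continuous hK p.1 p.2
      refine ⟨fun t => (p.1 + t, y t), by simp [hy0], fun t ht => ?_⟩
      have h1 : HasDerivAt y (A (p.1 + t) (y t)) t :=
        (hy t (Set.Ioo_subset_Icc_self ht)).hasDerivAt (Icc_mem_nhds ht.1 ht.2)
      have h2 : HasDerivAt (fun s => p.1 + s) 1 t := (hasDerivAt_id t).const_add _
      exact ((h2.prodMk h1).hasFDerivAt.hasMFDerivAt).hasMFDerivWithinAt) (0, x₀)
  have hd : ∀ t, HasDerivAt γ ((1 : ℝ), A (γ t).1 (γ t).2) t := fun t => by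
    have h : HasFDerivAt γ ((1 : ℝ →L[ℝ] ℝ).smulRight ((1 : ℝ), A (γ t).1 (γ t).2)) t :=
      (hγ t).hasFDerivAt
    exact h.hasDerivAt.congr_deriv (by simp)
  have hfst : ∀ t, (γ t).1 = t := by
    have h1 : ∀ t, HasDerivAt (fun s => (γ s).1 - s) 0 t := fun t =>
      (HasDerivAt.sub (f := fun s => (γ s).1) (hd t).fst (hasDerivAt_id t)).congr_deriv (by simp)
    intro t
    have := is_const_of_deriv_eq_zero (fun t => (h1 t).differentiableAt) (fun t => (h1 t).deriv) t 0
    simp only [hγ0] at this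
    linarith
  refine ⟨fun t => (γ t).2, by simp [hγ0], fun t => ?_⟩
  have := (hd t).snd
  rwa [hfst t] at this

/-- Solutions of a linear differential equation with bounded coefficients are determined by their
value at one time. -/
theorem eq_zero_of_hasDerivAt_linear {A : ℝ → E →L[ℝ] E} {K : ℝ} (hK : ∀ t, ‖A t‖ ≤ K)
    {y : ℝ → E} (hy : ∀ t, HasDerivAt y (A t (y t)) t) (h0 : y 0 = 0) (t : ℝ) : y t = 0 := by
  have hK0 : 0 ≤ K := (norm_nonneg _).trans (hK 0)
  have h := ODE_solution_unique_univ (v := fun t x => A t x) (s := fun _ => Set.univ)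
    (K := ⟨K, hK0⟩) (f := y) (g := fun _ => 0) (t₀ := 0)
    (fun t => ((A t).lipschitz.weaken (by exact_mod_cast hK t)).lipschitzOnWith)
    (fun t => ⟨hy t, trivial⟩) (fun t => ⟨by simpa using hasDerivAt_const t (0 : E), trivial⟩) h0
  exact congrFun h t

end LinearODE

section MatrixODE

variable {n : ℕ}

/-- The operator norm of a matrix with bounded entries. -/
theorem norm_toLin'_toContinuousLinearMap_le {B : Matrix (Fin n) (Fin n) ℝ} {K : ℝ}
    (hK : ∀ i j, |B i j| ≤ K) (hK0 : 0 ≤ K) :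
    ‖LinearMap.toContinuousLinearMap (Matrix.toLin' B)‖ ≤ n * K := by
  refine ContinuousLinearMap.opNorm_le_bound _ (by positivity) fun x => ?_
  rw [pi_norm_le_iff_of_nonneg (by positivity)]
  intro i
  simp only [LinearMap.coe_toContinuousLinearMap', Matrix.toLin'_apply, Matrix.mulVec, dotProduct,
    Real.norm_eq_abs]
  calc |∑ j, B i j * x j| ≤ ∑ j, |B i j * x j| := Finset.abs_sum_le_sum_abs _ _
    _ ≤ ∑ _j : Fin n, K * ‖x‖ := Finset.sum_le_sum fun j _ => by
        rw [abs_mul]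
        exact mul_le_mul (hK i j) (norm_le_pi_norm x j) (abs_nonneg _) hK0
    _ = n * K * ‖x‖ := by simp [mul_assoc]

/-- Global solutions of a linear system with bounded continuously differentiable coefficients. -/
theorem exists_hasDerivAt_matrix {B : ℝ → Matrix (Fin n) (Fin n) ℝ}
    (hB : ∀ i j, ContDiff ℝ 1 fun t => B t i j) {K : ℝ} (hK0 : 0 ≤ K)
    (hK : ∀ t i j, |B t i j| ≤ K) (x₀ : Fin n → ℝ) :
    ∃ y : ℝ → Fin n → ℝ, y 0 = x₀ ∧
      ∀ t i, HasDerivAt (fun s => y s i) (∑ j, B t i j * y t j) t := by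
  have hA : ContDiff ℝ 1 fun t => LinearMap.toContinuousLinearMap (Matrix.toLin' (B t)) := by
    refine contDiff_clm_apply_iff.2 fun x => contDiff_pi.2 fun i => ?_
    simp only [LinearMap.coe_toContinuousLinearMap', Matrix.toLin'_apply, Matrix.mulVec, dotProduct]
    exact ContDiff.sum fun j _ => (hB i j).mul contDiff_const
  obtain ⟨y, hy0, hy⟩ := exists_hasDerivAt_linear hA
    (fun t => norm_toLin'_toContinuousLinearMap_le (hK t) hK0) x₀
  exact ⟨y, hy0, fun t i => (hasDerivAt_pi.1 (hy t) i).congr_deriv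
    (by simp [Matrix.toLin'_apply, Matrix.mulVec, dotProduct])⟩

/-- Uniqueness for linear systems with bounded coefficients. -/
theorem eq_zero_of_hasDerivAt_matrix {B : ℝ → Matrix (Fin n) (Fin n) ℝ} {K : ℝ} (hK0 : 0 ≤ K)
    (hK : ∀ t i j, |B t i j| ≤ K) {y : ℝ → Fin n → ℝ} (h0 : y 0 = 0)
    (hy : ∀ t i, HasDerivAt (fun s => y s i) (∑ j, B t i j * y t j) t) (t : ℝ) : y t = 0 :=
  eq_zero_of_hasDerivAt_linear
    (A := fun t => LinearMap.toContinuousLinearMap (Matrix.toLin' (B t)))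
    (fun t => norm_toLin'_toContinuousLinearMap_le (hK t) hK0)
    (fun t => hasDerivAt_pi.2 fun i => (hy t i).congr_deriv
      (by simp [Matrix.toLin'_apply, Matrix.mulVec, dotProduct])) h0 t

end MatrixODE

/-! ### Curvature of the orthonormal frame -/

/-- The kinematic quantities `(θ, σ₊, σ̃₂₂, σ̃₂₃, (γ₀₂³ - γ₀₃²) / 2, ñ₂₂, ñ₂₃, n₊, a₁)` of an orthonormal
frame of a non-exceptional Bianchi spacetime. -/
structure FrameVars where
  /-- `θ` -/
  th : ℝ
  /-- `σ₊` -/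
  sp : ℝ
  /-- `σ̃₂₂` -/
  s1 : ℝ
  /-- `σ̃₂₃` -/
  s2 : ℝ
  /-- the rotation rate of the frame -/
  r : ℝ
  /-- `ñ₂₂` -/
  n1 : ℝ
  /-- `ñ₂₃` -/
  n2 : ℝ
  /-- `n₊` -/
  np : ℝ
  /-- `a₁` -/
  a1 : ℝ

namespace FrameVars

/-- `γ₀₁¹`. -/
noncomputable def timeOne (k : FrameVars) : ℝ := -(k.th / 3) + 2 * k.sp / 3

/-- `γ_{0A}^B`. -/
noncomputable def time (k : FrameVars) : Matrix (Fin 2) (Fin 2) ℝ :=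
  !![-((k.th + k.sp) / 3) - k.s1, -k.s2 + k.r; -k.s2 - k.r, -((k.th + k.sp) / 3) + k.s1]

/-- `γ_{1A}^B`. -/
noncomputable def space (k : FrameVars) : Matrix (Fin 2) (Fin 2) ℝ :=
  !![k.a1 + k.n2, -k.n1 + k.np / 3; -k.n1 - k.np / 3, k.a1 - k.n2]

/-- The structure functions of the frame. -/
noncomputable def coeff (k : FrameVars) : Fin 4 → Fin 4 → Fin 4 → ℝ
  | 0, 1, 1 => k.timeOne
  | 1, 0, 1 => -k.timeOne
  | 0, 2, 2 => k.time 0 0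
  | 0, 2, 3 => k.time 0 1
  | 0, 3, 2 => k.time 1 0
  | 0, 3, 3 => k.time 1 1
  | 2, 0, 2 => -k.time 0 0
  | 2, 0, 3 => -k.time 0 1
  | 3, 0, 2 => -k.time 1 0
  | 3, 0, 3 => -k.time 1 1
  | 1, 2, 2 => k.space 0 0
  | 1, 2, 3 => k.space 0 1
  | 1, 3, 2 => k.space 1 0
  | 1, 3, 3 => k.space 1 1
  | 2, 1, 2 => -k.space 0 0
  | 2, 1, 3 => -k.space 0 1
  | 3, 1, 2 => -k.space 1 0
  | 3, 1, 3 => -k.space 1 1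
  | _, _, _ => 0

/-- The connection coefficients of the frame. -/
noncomputable def conn (k : FrameVars) (α β δ : Fin 4) : ℝ :=
  minkowskiSign δ / 2 *
    (minkowskiSign δ * k.coeff α β δ - minkowskiSign α * k.coeff β δ α
      + minkowskiSign β * k.coeff δ α β)

/-- The curvature of the frame, where `k'` are the derivatives of `k` in the direction of `e₀`. -/
noncomputable def riemann (k k' : FrameVars) (α β μ δ : Fin 4) : ℝ :=
  (if α = 0 then k'.conn β μ δ else 0) - (if β = 0 then k'.conn α μ δ else 0)
    + ∑ ν : Fin 4, (k.conn β μ ν * k.conn α ν δ - k.conn α μ ν * k.conn β ν δ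
        - k.coeff α β ν * k.conn ν μ δ)

set_option maxHeartbeats 1000000 in
/-- The nonzero connection coefficients. -/
theorem conn_eq (k : FrameVars) (α β δ : Fin 4) : k.conn α β δ =
    match α, β, δ with
    | 0, 2, 3 => k.r
    | 0, 3, 2 => -k.r
    | 1, 0, 1 => -k.timeOne
    | 1, 1, 0 => -k.timeOne
    | 1, 2, 3 => k.np / 3
    | 1, 3, 2 => -(k.np / 3)
    | 2, 0, 2 => (k.th + k.sp) / 3 + k.s1
    | 2, 2, 0 => (k.th + k.sp) / 3 + k.s1
    | 2, 0, 3 => k.s2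
    | 2, 3, 0 => k.s2
    | 3, 0, 2 => k.s2
    | 3, 2, 0 => k.s2
    | 3, 0, 3 => (k.th + k.sp) / 3 - k.s1
    | 3, 3, 0 => (k.th + k.sp) / 3 - k.s1
    | 2, 1, 2 => -k.a1 - k.n2
    | 2, 2, 1 => k.a1 + k.n2
    | 2, 1, 3 => k.n1
    | 2, 3, 1 => -k.n1
    | 3, 1, 2 => k.n1
    | 3, 2, 1 => -k.n1
    | 3, 1, 3 => -k.a1 + k.n2
    | 3, 3, 1 => k.a1 - k.n2
    | _, _, _ => 0 := by
  fin_cases α <;> fin_cases β <;> fin_cases δ <;>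
    simp [conn, coeff, minkowskiSign, time, space] <;> ring

end FrameVars

namespace FrameVars

theorem minkowskiSign_mul_self (α : Fin 4) : minkowskiSign α * minkowskiSign α = 1 := by
  unfold minkowskiSign; split_ifs <;> norm_num

theorem coeff_swap (k : FrameVars) (α β δ : Fin 4) : k.coeff β α δ = -k.coeff α β δ := by
  fin_cases α <;> fin_cases β <;> fin_cases δ <;> simp [coeff]

theorem conn_swap (k : FrameVars) (α β δ : Fin 4) :
    k.conn α δ β = -(minkowskiSign β * minkowskiSign δ * k.conn α β δ) := by
  have h1 := minkowskiSign_mul_self β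
  have h2 := minkowskiSign_mul_self δ
  unfold conn
  linear_combination -(minkowskiSign β * minkowskiSign α) / 2 * coeff_swap k β δ α
    + minkowskiSign β * minkowskiSign δ / 2 * coeff_swap k α β δ
    + minkowskiSign β ^ 2 / 2 * coeff_swap k α δ β
    + (minkowskiSign β * minkowskiSign δ * k.coeff α β δ
      - minkowskiSign β * minkowskiSign α * k.coeff β δ α
      + minkowskiSign β ^ 2 * k.coeff δ α β) / 2 * h2

theorem riemann_swap_left (k k' : FrameVars) (α β μ δ : Fin 4) :
    k.riemann k' β α μ δ = -k.riemann k' α β μ δ := by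
  unfold riemann
  simp only [coeff_swap k α β, Fin.sum_univ_four]
  ring

theorem riemann_swap_right (k k' : FrameVars) (α β μ δ : Fin 4) :
    k.riemann k' α β δ μ = -(minkowskiSign μ * minkowskiSign δ * k.riemann k' α β μ δ) := by
  have key : ∀ ν, k.conn β δ ν * k.conn α ν μ - k.conn α δ ν * k.conn β ν μ
      - k.coeff α β ν * k.conn ν δ μ = -(minkowskiSign μ * minkowskiSign δ *
        (k.conn β μ ν * k.conn α ν δ - k.conn α μ ν * k.conn β ν δ
          - k.coeff α β ν * k.conn ν μ δ)) := by
    intro ν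
    have h := minkowskiSign_mul_self ν
    rw [conn_swap k β ν δ, conn_swap k α μ ν, conn_swap k α ν δ, conn_swap k β μ ν,
      conn_swap k ν μ δ]
    linear_combination minkowskiSign δ * minkowskiSign μ *
      (k.conn β ν δ * k.conn α μ ν - k.conn α ν δ * k.conn β μ ν) * h
  unfold riemann
  simp only [key, conn_swap k' β μ δ, conn_swap k' α μ δ]
  rw [Finset.sum_neg_distrib, ← Finset.mul_sum]
  split_ifs <;> ring

/-- The sign of an index under the reflection `e₂ ↦ -e₂`, `e₃ ↦ -e₃`. -/
def reflectSign (α : Fin 4) : ℝ := if 2 ≤ α then -1 else 1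

theorem reflectSign_mul_self (α : Fin 4) : reflectSign α * reflectSign α = 1 := by
  unfold reflectSign; split_ifs <;> norm_num

theorem coeff_reflect (k : FrameVars) (α β δ : Fin 4) :
    k.coeff α β δ = reflectSign α * reflectSign β * reflectSign δ * k.coeff α β δ := by
  fin_cases α <;> fin_cases β <;> fin_cases δ <;> simp [coeff, reflectSign]

theorem conn_reflect (k : FrameVars) (α β δ : Fin 4) :
    k.conn α β δ = reflectSign α * reflectSign β * reflectSign δ * k.conn α β δ := by
  unfold conn
  linear_combination minkowskiSign δ / 2 * (minkowskiSign δ * coeff_reflect k α β δ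
    - minkowskiSign α * coeff_reflect k β δ α + minkowskiSign β * coeff_reflect k δ α β)

theorem riemann_reflect (k k' : FrameVars) (α β μ δ : Fin 4) : k.riemann k' α β μ δ =
    reflectSign α * reflectSign β * reflectSign μ * reflectSign δ * k.riemann k' α β μ δ := by
  have key : ∀ ν, k.conn β μ ν * k.conn α ν δ - k.conn α μ ν * k.conn β ν δ
      - k.coeff α β ν * k.conn ν μ δ = reflectSign α * reflectSign β * reflectSign μ *
        reflectSign δ * (k.conn β μ ν * k.conn α ν δ - k.conn α μ ν * k.conn β ν δ
          - k.coeff α β ν * k.conn ν μ δ) := by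
    intro ν
    have h := reflectSign_mul_self ν
    have h1 := conn_reflect k β μ ν
    have h2 := conn_reflect k α ν δ
    have h3 := conn_reflect k α μ ν
    have h4 := conn_reflect k β ν δ
    have h5 := coeff_reflect k α β ν
    have h6 := conn_reflect k ν μ δ
    calc _ = (reflectSign β * reflectSign μ * reflectSign ν * k.conn β μ ν) *
          (reflectSign α * reflectSign ν * reflectSign δ * k.conn α ν δ)
        - (reflectSign α * reflectSign μ * reflectSign ν * k.conn α μ ν) *
          (reflectSign β * reflectSign ν * reflectSign δ * k.conn β ν δ)
        - (reflectSign α * reflectSign β * reflectSign ν * k.coeff α β ν) *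
          (reflectSign ν * reflectSign μ * reflectSign δ * k.conn ν μ δ) := by
          rw [← h1, ← h2, ← h3, ← h4, ← h5, ← h6]
      _ = _ := by
          linear_combination reflectSign α * reflectSign β * reflectSign μ * reflectSign δ *
            (k.conn β μ ν * k.conn α ν δ - k.conn α μ ν * k.conn β ν δ
              - k.coeff α β ν * k.conn ν μ δ) * h
  have hα : (if α = 0 then k'.conn β μ δ else 0) = reflectSign α * reflectSign β * reflectSign μ *
      reflectSign δ * (if α = 0 then k'.conn β μ δ else 0) := by
    split_ifs with h
    · subst h
      have h0 : reflectSign 0 = 1 := by simp [reflectSign]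
      linear_combination conn_reflect k' β μ δ - reflectSign β * reflectSign μ *
        reflectSign δ * k'.conn β μ δ * h0
    · ring
  have hβ : (if β = 0 then k'.conn α μ δ else 0) = reflectSign α * reflectSign β * reflectSign μ *
      reflectSign δ * (if β = 0 then k'.conn α μ δ else 0) := by
    split_ifs with h
    · subst h
      have h0 : reflectSign 0 = 1 := by simp [reflectSign]
      linear_combination conn_reflect k' α μ δ - reflectSign α * reflectSign μ *
        reflectSign δ * k'.conn α μ δ * h0
    · ring
  have hs := Finset.sum_congr (rfl : (Finset.univ : Finset (Fin 4)) = Finset.univ)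
    fun ν _ => key ν
  rw [← Finset.mul_sum] at hs
  unfold riemann
  linear_combination hα - hβ + hs

/-- Curvature components with an odd number of indices in `{2, 3}` vanish. -/
theorem riemann_eq_zero (k k' : FrameVars) {α β μ δ : Fin 4}
    (h : reflectSign α * reflectSign β * reflectSign μ * reflectSign δ = -1) :
    k.riemann k' α β μ δ = 0 := by
  have := riemann_reflect k k' α β μ δ
  rw [h] at this
  linarith

end FrameVars

namespace FrameVars

theorem riemann_0101 (k k' : FrameVars) : k.riemann k' 0 1 0 1 =
    1/3 * k'.th - 2/3 * k'.sp + 1/9 * k.th ^ 2 - 4/9 * k.sp * k.th + 4/9 * k.sp ^ 2 := by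
  simp [riemann, conn_eq, coeff, Fin.sum_univ_four, timeOne, time, space]
  ring

theorem riemann_0123 (k k' : FrameVars) : k.riemann k' 0 1 2 3 =
    1/3 * k'.np + 1/9 * k.np * k.th - 2/9 * k.np * k.sp := by
  simp [riemann, conn_eq, coeff, Fin.sum_univ_four, timeOne, time, space]
  ring

theorem riemann_0202 (k k' : FrameVars) : k.riemann k' 0 2 0 2 =
    1/3 * k'.th + 1/3 * k'.sp + k'.s1 + 1/9 * k.th ^ 2 + 2/9 * k.sp * k.th + 2/3 * k.s1 *
    k.th + 1/9 * k.sp ^ 2 + 2/3 * k.s1 * k.sp + k.s1 ^ 2 - 2 * k.r * k.s2 + k.s2 ^ 2 := by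
  simp [riemann, conn_eq, coeff, Fin.sum_univ_four, timeOne, time, space]
  ring

theorem riemann_0203 (k k' : FrameVars) : k.riemann k' 0 2 0 3 =
    k'.s2 + 2 * k.r * k.s1 + 2/3 * k.s2 * k.th + 2/3 * k.s2 * k.sp := by
  simp [riemann, conn_eq, coeff, Fin.sum_univ_four, timeOne, time, space]
  ring

theorem riemann_0212 (k k' : FrameVars) : k.riemann k' 0 2 1 2 =
    -(k'.a1) - k'.n2 - 1/3 * k.a1 * k.th - 1/3 * k.n2 * k.th - 1/3 * k.a1 * k.sp - 1/3 *
    k.n2 * k.sp - k.a1 * k.s1 - k.n2 * k.s1 - 2 * k.n1 * k.r + k.n1 * k.s2 := by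
  simp [riemann, conn_eq, coeff, Fin.sum_univ_four, timeOne, time, space]
  ring

theorem riemann_0213 (k k' : FrameVars) : k.riemann k' 0 2 1 3 =
    k'.n1 - 2 * k.n2 * k.r + 1/3 * k.n1 * k.th + 1/3 * k.n1 * k.sp + k.n1 * k.s1 - k.a1 *
    k.s2 + k.n2 * k.s2 := by
  simp [riemann, conn_eq, coeff, Fin.sum_univ_four, timeOne, time, space]
  ring

theorem riemann_0302 (k k' : FrameVars) : k.riemann k' 0 3 0 2 =
    k'.s2 + 2/3 * k.s2 * k.th + 2/3 * k.s2 * k.sp + 2 * k.r * k.s1 := by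
  simp [riemann, conn_eq, coeff, Fin.sum_univ_four, timeOne, time, space]
  ring

theorem riemann_0303 (k k' : FrameVars) : k.riemann k' 0 3 0 3 =
    1/3 * k'.th + 1/3 * k'.sp - k'.s1 + 2 * k.r * k.s2 + k.s2 ^ 2 + 1/9 * k.th ^ 2 + 2/9 *
    k.sp * k.th - 2/3 * k.s1 * k.th + 1/9 * k.sp ^ 2 - 2/3 * k.s1 * k.sp + k.s1 ^ 2 := by
  simp [riemann, conn_eq, coeff, Fin.sum_univ_four, timeOne, time, space]
  ring

theorem riemann_0312 (k k' : FrameVars) : k.riemann k' 0 3 1 2 =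
    k'.n1 - k.a1 * k.s2 - k.n2 * k.s2 - 2 * k.n2 * k.r + 1/3 * k.n1 * k.th + 1/3 * k.n1 *
    k.sp - k.n1 * k.s1 := by
  simp [riemann, conn_eq, coeff, Fin.sum_univ_four, timeOne, time, space]
  ring

theorem riemann_0313 (k k' : FrameVars) : k.riemann k' 0 3 1 3 =
    -(k'.a1) + k'.n2 + 2 * k.n1 * k.r + k.n1 * k.s2 - 1/3 * k.a1 * k.th + 1/3 * k.n2 * k.th
    - 1/3 * k.a1 * k.sp + 1/3 * k.n2 * k.sp + k.a1 * k.s1 - k.n2 * k.s1 := by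
  simp [riemann, conn_eq, coeff, Fin.sum_univ_four, timeOne, time, space]
  ring

theorem riemann_1202 (k k' : FrameVars) : k.riemann k' 1 2 0 2 =
    -(k.a1 * k.sp) - k.n2 * k.sp - k.a1 * k.s1 - k.n2 * k.s1 - 2/3 * k.np * k.s2 + k.n1 *
    k.s2 := by
  simp [riemann, conn_eq, coeff, Fin.sum_univ_four, timeOne, time, space]
  ring

theorem riemann_1203 (k k' : FrameVars) : k.riemann k' 1 2 0 3 =
    k.n1 * k.sp + 2/3 * k.np * k.s1 - k.a1 * k.s2 - k.n2 * k.s2 - k.n1 * k.s1 := by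
  simp [riemann, conn_eq, coeff, Fin.sum_univ_four, timeOne, time, space]
  ring

theorem riemann_1212 (k k' : FrameVars) : k.riemann k' 1 2 1 2 =
    -(1/9 * k.th ^ 2) + 1/9 * k.sp * k.th - 1/3 * k.s1 * k.th + 2/9 * k.sp ^ 2 + 2/3 * k.s1
    * k.sp + k.a1 ^ 2 + 2 * k.a1 * k.n2 + k.n2 ^ 2 - 2/3 * k.n1 * k.np + k.n1 ^ 2 := by
  simp [riemann, conn_eq, coeff, Fin.sum_univ_four, timeOne, time, space]
  ring

theorem riemann_1213 (k k' : FrameVars) : k.riemann k' 1 2 1 3 =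
    -(1/3 * k.s2 * k.th) + 2/3 * k.s2 * k.sp - 2/3 * k.n2 * k.np - 2 * k.a1 * k.n1 := by
  simp [riemann, conn_eq, coeff, Fin.sum_univ_four, timeOne, time, space]
  ring

theorem riemann_1302 (k k' : FrameVars) : k.riemann k' 1 3 0 2 =
    k.n1 * k.sp + k.n1 * k.s1 + 2/3 * k.np * k.s1 - k.a1 * k.s2 + k.n2 * k.s2 := by
  simp [riemann, conn_eq, coeff, Fin.sum_univ_four, timeOne, time, space]
  ring

theorem riemann_1303 (k k' : FrameVars) : k.riemann k' 1 3 0 3 =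
    -(k.a1 * k.sp) + k.n2 * k.sp + 2/3 * k.np * k.s2 + k.n1 * k.s2 + k.a1 * k.s1 - k.n2 *
    k.s1 := by
  simp [riemann, conn_eq, coeff, Fin.sum_univ_four, timeOne, time, space]
  ring

theorem riemann_1312 (k k' : FrameVars) : k.riemann k' 1 3 1 2 =
    -(1/3 * k.s2 * k.th) + 2/3 * k.s2 * k.sp - 2 * k.a1 * k.n1 - 2/3 * k.n2 * k.np := by
  simp [riemann, conn_eq, coeff, Fin.sum_univ_four, timeOne, time, space]
  ring

theorem riemann_1313 (k k' : FrameVars) : k.riemann k' 1 3 1 3 =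
    -(1/9 * k.th ^ 2) + 1/9 * k.sp * k.th + 1/3 * k.s1 * k.th + 2/9 * k.sp ^ 2 - 2/3 * k.s1
    * k.sp + 2/3 * k.n1 * k.np + k.n1 ^ 2 + k.a1 ^ 2 - 2 * k.a1 * k.n2 + k.n2 ^ 2 := by
  simp [riemann, conn_eq, coeff, Fin.sum_univ_four, timeOne, time, space]
  ring

theorem riemann_2301 (k k' : FrameVars) : k.riemann k' 2 3 0 1 =
    2 * k.n2 * k.s2 + 2 * k.n1 * k.s1 := by
  simp [riemann, conn_eq, coeff, Fin.sum_univ_four, timeOne, time, space]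
  ring

theorem riemann_2323 (k k' : FrameVars) : k.riemann k' 2 3 2 3 =
    k.s2 ^ 2 - 1/9 * k.th ^ 2 - 2/9 * k.sp * k.th - 1/9 * k.sp ^ 2 + k.s1 ^ 2 - k.n1 ^ 2 +
    k.a1 ^ 2 - k.n2 ^ 2 := by
  simp [riemann, conn_eq, coeff, Fin.sum_univ_four, timeOne, time, space]
  ring

end FrameVars

namespace FrameVars

/-- The Ricci curvature of the frame. -/
noncomputable def ricci (k k' : FrameVars) (β μ : Fin 4) : ℝ := ∑ α, k.riemann k' α β μ α

/-- The Kretschmann scalar of the frame. -/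
noncomputable def kretschmann (k k' : FrameVars) : ℝ :=
  ∑ α : Fin 4, ∑ β : Fin 4, ∑ μ : Fin 4, ∑ δ : Fin 4,
    minkowskiSign α * minkowskiSign β * minkowskiSign μ * minkowskiSign δ *
      k.riemann k' α β μ δ ^ 2

/-- The Jacobi identity: the evolution of the spatial structure functions. -/
structure Jacobi (k k' : FrameVars) : Prop where
  n1 : k'.n1 = k.timeOne * k.n1 + 2 / 3 * k.np * k.s1 + 2 * k.r * k.n2
  n2 : k'.n2 = k.timeOne * k.n2 + 2 / 3 * k.np * k.s2 - 2 * k.r * k.n1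
  np : k'.np = k.timeOne * k.np + 6 * (k.s1 * k.n1 + k.s2 * k.n2)
  a1 : k'.a1 = k.timeOne * k.a1

/-- The vacuum Einstein equations. -/
structure Einstein (k k' : FrameVars) : Prop where
  th : k'.th = -(k.th ^ 2 / 3) - 2 / 3 * k.sp ^ 2 - 2 * (k.s1 ^ 2 + k.s2 ^ 2)
  sp : k'.sp = -(k.sp * k.th) - 2 * (k.n1 ^ 2 + k.n2 ^ 2)
  s1 : k'.s1 = -(k.s1 * k.th) + 2 * k.r * k.s2 + 2 * k.a1 * k.n2 - 2 / 3 * k.n1 * k.np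
  s2 : k'.s2 = -(k.s2 * k.th) - 2 * k.r * k.s1 - 2 * k.a1 * k.n1 - 2 / 3 * k.n2 * k.np
  momentum : k.a1 * k.sp + k.n2 * k.s1 - k.n1 * k.s2 = 0
  hamiltonian : k.th ^ 2 = k.sp ^ 2 + 3 * (k.s1 ^ 2 + k.s2 ^ 2) + 3 * (k.n1 ^ 2 + k.n2 ^ 2)
    + 9 * k.a1 ^ 2

theorem riemann_self_left (k k' : FrameVars) (α μ δ : Fin 4) : k.riemann k' α α μ δ = 0 := by
  linarith [riemann_swap_left k k' α α μ δ]

theorem ricci_zero_zero (k k' : FrameVars) : k.ricci k' 0 0 =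
    -k'.th - k.th ^ 2 / 3 - 2 / 3 * k.sp ^ 2 - 2 * (k.s1 ^ 2 + k.s2 ^ 2) := by
  simp only [ricci, Fin.sum_univ_four, riemann_self_left, riemann_swap_left k k' 0 _, 
    riemann_0101, riemann_0202, riemann_0303]
  ring

theorem ricci_zero_one (k k' : FrameVars) (h : k.Jacobi k') : k.ricci k' 0 1 =
    2 * (k.a1 * k.sp + k.n2 * k.s1 - k.n1 * k.s2) := by
  have h1 : k.riemann k' 0 1 1 1 = 0 := by
    have := riemann_swap_right k k' 0 1 1 1
    simp [minkowskiSign] at this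
    linarith
  simp only [ricci, Fin.sum_univ_four, riemann_self_left, riemann_swap_left k k' 0 _, h1,
    riemann_0212, riemann_0313, h.n2, h.a1, timeOne]
  ring

theorem ricci_one_zero (k k' : FrameVars) : k.ricci k' 1 0 =
    2 * (k.a1 * k.sp + k.n2 * k.s1 - k.n1 * k.s2) := by
  have h1 : k.riemann k' 0 1 0 0 = 0 := by
    have := riemann_swap_right k k' 0 1 0 0
    simp [minkowskiSign] at this
    linarith
  simp only [ricci, Fin.sum_univ_four, riemann_self_left, riemann_swap_left k k' 1 2,
    riemann_swap_left k k' 1 3, h1, riemann_1202, riemann_1303]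
  ring

theorem ricci_one_one (k k' : FrameVars) : k.ricci k' 1 1 =
    k'.th / 3 - 2 / 3 * k'.sp + k.th ^ 2 / 3 - 2 / 3 * k.sp * k.th - 2 * k.a1 ^ 2
      - 2 * (k.n1 ^ 2 + k.n2 ^ 2) := by
  have h0 := riemann_swap_right k k' 0 1 0 1
  simp [minkowskiSign] at h0
  simp only [ricci, Fin.sum_univ_four, riemann_self_left, riemann_swap_left k k' 1 2,
    riemann_swap_left k k' 1 3, h0, riemann_0101, riemann_1212, riemann_1313]
  ring

theorem ricci_two_two (k k' : FrameVars) : k.ricci k' 2 2 =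
    k'.th / 3 + k'.sp / 3 + k'.s1 + k.th ^ 2 / 3 + k.sp * k.th / 3 + k.s1 * k.th
      - 2 * k.r * k.s2 - 2 * k.a1 ^ 2 - 2 * k.a1 * k.n2 + 2 / 3 * k.n1 * k.np := by
  have h0 := riemann_swap_right k k' 0 2 0 2
  have h1 := riemann_swap_right k k' 1 2 1 2
  simp [minkowskiSign] at h0 h1
  simp only [ricci, Fin.sum_univ_four, riemann_self_left, riemann_swap_left k k' 2 3,
    h0, h1, riemann_0202, riemann_1212, riemann_2323]
  ring

theorem ricci_three_three (k k' : FrameVars) : k.ricci k' 3 3 =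
    k'.th / 3 + k'.sp / 3 - k'.s1 + k.th ^ 2 / 3 + k.sp * k.th / 3 - k.s1 * k.th
      + 2 * k.r * k.s2 - 2 * k.a1 ^ 2 + 2 * k.a1 * k.n2 - 2 / 3 * k.n1 * k.np := by
  have h0 := riemann_swap_right k k' 0 3 0 3
  have h1 := riemann_swap_right k k' 1 3 1 3
  have h2 := riemann_swap_right k k' 2 3 2 3
  simp [minkowskiSign] at h0 h1 h2
  simp only [ricci, Fin.sum_univ_four, riemann_self_left,
    h0, h1, h2, riemann_0303, riemann_1313, riemann_2323]
  ring

theorem ricci_two_three (k k' : FrameVars) : k.ricci k' 2 3 =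
    k'.s2 + 2 * k.r * k.s1 + k.s2 * k.th + 2 / 3 * k.n2 * k.np + 2 * k.a1 * k.n1 := by
  have h0 := riemann_swap_right k k' 0 2 0 3
  have h1 := riemann_swap_right k k' 1 2 1 3
  have h2 := riemann_swap_right k k' 3 2 3 3
  simp [minkowskiSign] at h0 h1 h2
  have h2' : k.riemann k' 3 2 3 3 = 0 := by linarith
  simp only [ricci, Fin.sum_univ_four, riemann_self_left,
    h0, h1, h2', riemann_0203, riemann_1213]
  ring

theorem ricci_three_two (k k' : FrameVars) : k.ricci k' 3 2 =
    k'.s2 + 2 * k.r * k.s1 + k.s2 * k.th + 2 / 3 * k.n2 * k.np + 2 * k.a1 * k.n1 := by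
  have h0 := riemann_swap_right k k' 0 3 0 2
  have h1 := riemann_swap_right k k' 1 3 1 2
  have h2 := riemann_swap_right k k' 2 3 2 2
  simp [minkowskiSign] at h0 h1 h2
  have h2' : k.riemann k' 2 3 2 2 = 0 := by linarith
  simp only [ricci, Fin.sum_univ_four, riemann_self_left,
    h0, h1, h2', riemann_0302, riemann_1312]
  ring

theorem ricci_eq_zero_of_reflectSign (k k' : FrameVars) {β μ : Fin 4}
    (h : reflectSign β * reflectSign μ = -1) : k.ricci k' β μ = 0 :=
  Finset.sum_eq_zero fun α _ => riemann_eq_zero k k' <| by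
    linear_combination reflectSign α ^ 2 * h - reflectSign_mul_self α

/-- The vacuum Einstein equations imply the vanishing of the Ricci curvature. -/
theorem Einstein.ricci_eq_zero {k k' : FrameVars} (h : k.Einstein k') (hJ : k.Jacobi k')
    (β μ : Fin 4) : k.ricci k' β μ = 0 := by
  fin_cases β <;> fin_cases μ <;>
    first
    | (refine ricci_eq_zero_of_reflectSign k k' ?_; simp [reflectSign]; done)
    | skip
  · refine (ricci_zero_zero k k').trans ?_
    linear_combination -h.th
  · refine (ricci_zero_one k k' hJ).trans ?_
    linear_combination 2 * h.momentum
  · refine (ricci_one_zero k k').trans ?_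
    linear_combination 2 * h.momentum
  · refine (ricci_one_one k k').trans ?_
    linear_combination h.th / 3 - 2 / 3 * h.sp + 2 / 9 * h.hamiltonian
  · refine (ricci_two_two k k').trans ?_
    linear_combination h.th / 3 + h.sp / 3 + h.s1 + 2 / 9 * h.hamiltonian
  · refine (ricci_two_three k k').trans ?_
    linear_combination h.s2
  · refine (ricci_three_two k k').trans ?_
    linear_combination h.s2
  · refine (ricci_three_three k k').trans ?_
    linear_combination h.th / 3 + h.sp / 3 - h.s1 + 2 / 9 * h.hamiltonian

/-- The vanishing of the Ricci curvature implies the vacuum Einstein equations. -/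
theorem einstein_of_ricci_eq_zero {k k' : FrameVars} (hJ : k.Jacobi k')
    (h : ∀ β μ, k.ricci k' β μ = 0) : k.Einstein k' := by
  have h00 := (ricci_zero_zero k k').symm.trans (h 0 0)
  have h01 := (ricci_zero_one k k' hJ).symm.trans (h 0 1)
  have h11 := (ricci_one_one k k').symm.trans (h 1 1)
  have h22 := (ricci_two_two k k').symm.trans (h 2 2)
  have h33 := (ricci_three_three k k').symm.trans (h 3 3)
  have h23 := (ricci_two_three k k').symm.trans (h 2 3)
  refine ⟨?_, ?_, ?_, ?_, ?_, ?_⟩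
  · linear_combination -h00
  · linear_combination (h22 + h33) / 2 - h11
  · linear_combination (h22 - h33) / 2
  · linear_combination h23
  · linear_combination h01 / 2
  · linear_combination 3 / 2 * (h00 + h11 + h22 + h33)

theorem sum_sum_sign_of_symmetric {f : Fin 4 → Fin 4 → ℝ} (h : ∀ α β, f β α = f α β)
    (h0 : ∀ α, f α α = 0) :
    ∑ α, ∑ β, minkowskiSign α * minkowskiSign β * f α β =
      2 * (f 1 2 + f 1 3 + f 2 3 - f 0 1 - f 0 2 - f 0 3) := by
  simp only [Fin.sum_univ_four, h0, h 0 1, h 0 2, h 0 3, h 1 2, h 1 3, h 2 3]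
  simp [minkowskiSign]
  ring

theorem riemann_sq_swap_right (k k' : FrameVars) (α β μ δ : Fin 4) :
    k.riemann k' α β δ μ ^ 2 = k.riemann k' α β μ δ ^ 2 := by
  rw [riemann_swap_right k k' α β μ δ]
  linear_combination (minkowskiSign μ ^ 2 * k.riemann k' α β μ δ ^ 2) * minkowskiSign_mul_self δ
    + k.riemann k' α β μ δ ^ 2 * minkowskiSign_mul_self μ

theorem riemann_self_right (k k' : FrameVars) (α β μ : Fin 4) : k.riemann k' α β μ μ = 0 := by
  have := riemann_swap_right k k' α β μ μ
  rw [minkowskiSign_mul_self] at this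
  linarith

/-- The Kretschmann scalar as a sum over pairs of indices. -/
theorem kretschmann_eq_pairs (k k' : FrameVars) : k.kretschmann k' =
    4 * (k.riemann k' 0 1 0 1 ^ 2 + k.riemann k' 0 2 0 2 ^ 2 + k.riemann k' 0 3 0 3 ^ 2
      + k.riemann k' 0 2 0 3 ^ 2 + k.riemann k' 0 3 0 2 ^ 2
      + k.riemann k' 1 2 1 2 ^ 2 + k.riemann k' 1 3 1 3 ^ 2 + k.riemann k' 2 3 2 3 ^ 2
      + k.riemann k' 1 2 1 3 ^ 2 + k.riemann k' 1 3 1 2 ^ 2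
      - k.riemann k' 0 1 2 3 ^ 2 - k.riemann k' 0 2 1 2 ^ 2 - k.riemann k' 0 2 1 3 ^ 2
      - k.riemann k' 0 3 1 2 ^ 2 - k.riemann k' 0 3 1 3 ^ 2
      - k.riemann k' 2 3 0 1 ^ 2 - k.riemann k' 1 2 0 2 ^ 2 - k.riemann k' 1 3 0 2 ^ 2
      - k.riemann k' 1 2 0 3 ^ 2 - k.riemann k' 1 3 0 3 ^ 2) := by
  have hz : ∀ α β μ δ : Fin 4,
      reflectSign α * reflectSign β * reflectSign μ * reflectSign δ = -1 →
      k.riemann k' α β μ δ = 0 := fun _ _ _ _ h => riemann_eq_zero k k' h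
  have h1 : ∀ α β, ∑ μ, ∑ δ, minkowskiSign μ * minkowskiSign δ * k.riemann k' α β μ δ ^ 2 =
      2 * (k.riemann k' α β 1 2 ^ 2 + k.riemann k' α β 1 3 ^ 2 + k.riemann k' α β 2 3 ^ 2
        - k.riemann k' α β 0 1 ^ 2 - k.riemann k' α β 0 2 ^ 2 - k.riemann k' α β 0 3 ^ 2) :=
    fun α β => sum_sum_sign_of_symmetric (f := fun μ δ => k.riemann k' α β μ δ ^ 2)
      (fun μ δ => riemann_sq_swap_right k k' α β μ δ)
      (fun μ => by simp [riemann_self_right])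
  have h2 : k.kretschmann k' = ∑ α, ∑ β, minkowskiSign α * minkowskiSign β *
      ∑ μ, ∑ δ, minkowskiSign μ * minkowskiSign δ * k.riemann k' α β μ δ ^ 2 := by
    unfold kretschmann
    refine Finset.sum_congr rfl fun α _ => Finset.sum_congr rfl fun β _ => ?_
    simp only [Finset.mul_sum]
    refine Finset.sum_congr rfl fun μ _ => Finset.sum_congr rfl fun δ _ => ?_
    ring
  rw [h2, sum_sum_sign_of_symmetric
    (f := fun α β => ∑ μ, ∑ δ, minkowskiSign μ * minkowskiSign δ * k.riemann k' α β μ δ ^ 2)]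
  · simp only [h1]
    rw [hz 1 2 2 3, hz 1 2 0 1, hz 1 3 2 3, hz 1 3 0 1, hz 2 3 1 2, hz 2 3 1 3, hz 2 3 0 2,
      hz 2 3 0 3, hz 0 1 1 2, hz 0 1 1 3, hz 0 1 0 2, hz 0 1 0 3, hz 0 2 2 3, hz 0 2 0 1,
      hz 0 3 2 3, hz 0 3 0 1]
    · ring
    all_goals simp [reflectSign]
  · intro α β
    simp only [riemann_swap_left k k' α β, neg_sq]
  · intro α
    simp [riemann_self_left]

/-- The Kretschmann scalar of a vacuum spacetime. -/
theorem Einstein.kretschmann_eq {k k' : FrameVars} (h : k.Einstein k') (hJ : k.Jacobi k') :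
    k.kretschmann k' =
      12 * (k.s1 ^ 2 + k.s2 ^ 2 - (k.th + k.sp) ^ 2 / 9 - (k.n1 ^ 2 + k.n2 ^ 2) + k.a1 ^ 2) ^ 2
      + 16 * ((k.th - 2 * k.sp) ^ 2 / 9 * (k.s1 ^ 2 + k.s2 ^ 2)
        + 4 / 9 * k.np ^ 2 * (k.n1 ^ 2 + k.n2 ^ 2) + 4 * k.a1 ^ 2 * (k.n1 ^ 2 + k.n2 ^ 2)
        + 4 / 9 * (k.th - 2 * k.sp) * k.np * (k.s1 * k.n1 + k.s2 * k.n2)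
        + 4 / 3 * (k.th - 2 * k.sp) * k.a1 ^ 2 * k.sp)
      - 48 * (k.s1 * k.n1 + k.s2 * k.n2) ^ 2
      - 16 * (k.sp ^ 2 * (k.n1 ^ 2 + k.n2 ^ 2) + 4 / 9 * k.np ^ 2 * (k.s1 ^ 2 + k.s2 ^ 2)
        + k.a1 ^ 2 * (k.s1 ^ 2 + k.s2 ^ 2)
        + 4 / 3 * k.sp * k.np * (k.s1 * k.n1 + k.s2 * k.n2) - 2 * k.sp ^ 2 * k.a1 ^ 2) := by
  have e1 : k.riemann k' 0 1 0 1 = -k.riemann k' 2 3 2 3 := by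
    rw [riemann_0101, riemann_2323]
    linear_combination h.th / 3 - 2 / 3 * h.sp - h.hamiltonian / 9
  have e2 : k.riemann k' 0 2 0 2 = -k.riemann k' 1 3 1 3 := by
    rw [riemann_0202, riemann_1313]
    linear_combination h.th / 3 + h.sp / 3 + h.s1 - h.hamiltonian / 9
  have e3 : k.riemann k' 0 3 0 3 = -k.riemann k' 1 2 1 2 := by
    rw [riemann_0303, riemann_1212]
    linear_combination h.th / 3 + h.sp / 3 - h.s1 - h.hamiltonian / 9
  have e4 : k.riemann k' 0 2 0 3 = k.riemann k' 1 2 1 3 := by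
    rw [riemann_0203, riemann_1213]
    linear_combination h.s2
  have e5 : k.riemann k' 0 3 0 2 = k.riemann k' 1 2 1 3 := by
    rw [riemann_0302, riemann_1213]
    linear_combination h.s2
  have e6 : k.riemann k' 1 3 1 2 = k.riemann k' 1 2 1 3 := by
    rw [riemann_1312, riemann_1213]
    ring
  have h1 : k.riemann k' 0 1 2 3 = 2 * (k.s1 * k.n1 + k.s2 * k.n2) := by
    rw [riemann_0123, hJ.np, timeOne]
    ring
  have h2 : k.riemann k' 0 2 1 2 = -(k.n2 * k.sp) - 2 / 3 * k.np * k.s2 - k.a1 * k.s1 := by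
    rw [riemann_0212, hJ.n2, hJ.a1, timeOne]
    linear_combination -h.momentum
  have h3 : k.riemann k' 0 3 1 3 = k.n2 * k.sp + 2 / 3 * k.np * k.s2 + k.a1 * k.s1 := by
    rw [riemann_0313, hJ.n2, hJ.a1, timeOne]
    linear_combination -h.momentum
  have h4 : k.riemann k' 0 2 1 3 = k.n1 * k.sp + 2 / 3 * k.np * k.s1 - k.a1 * k.s2
      + (k.s1 * k.n1 + k.s2 * k.n2) := by
    rw [riemann_0213, hJ.n1, timeOne]
    ring
  have h5 : k.riemann k' 0 3 1 2 = k.n1 * k.sp + 2 / 3 * k.np * k.s1 - k.a1 * k.s2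
      - (k.s1 * k.n1 + k.s2 * k.n2) := by
    rw [riemann_0312, hJ.n1, timeOne]
    ring
  have h1' : k.riemann k' 2 3 0 1 = k.riemann k' 0 1 2 3 := by
    rw [riemann_2301, h1]
    ring
  have h2' : k.riemann k' 1 2 0 2 = k.riemann k' 0 2 1 2 := by
    rw [riemann_1202, h2]
    linear_combination -h.momentum
  have h3' : k.riemann k' 1 3 0 3 = k.riemann k' 0 3 1 3 := by
    rw [riemann_1303, h3]
    linear_combination -h.momentum
  have h4' : k.riemann k' 1 3 0 2 = k.riemann k' 0 2 1 3 := by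
    rw [riemann_1302, h4]
    ring
  have h5' : k.riemann k' 1 2 0 3 = k.riemann k' 0 3 1 2 := by
    rw [riemann_1203, h5]
    ring
  have f1 : k.riemann k' 2 3 2 3 =
      k.s1 ^ 2 + k.s2 ^ 2 - (k.th + k.sp) ^ 2 / 9 - (k.n1 ^ 2 + k.n2 ^ 2) + k.a1 ^ 2 := by
    rw [riemann_2323]
    ring
  have f2 : k.riemann k' 1 3 1 3 = -(1 / 2) *
      (k.s1 ^ 2 + k.s2 ^ 2 - (k.th + k.sp) ^ 2 / 9 - (k.n1 ^ 2 + k.n2 ^ 2) + k.a1 ^ 2)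
      + ((k.th - 2 * k.sp) / 3 * k.s1 + 2 / 3 * k.n1 * k.np - 2 * k.a1 * k.n2) := by
    rw [riemann_1313]
    linear_combination -(1 / 6) * h.hamiltonian
  have f3 : k.riemann k' 1 2 1 2 = -(1 / 2) *
      (k.s1 ^ 2 + k.s2 ^ 2 - (k.th + k.sp) ^ 2 / 9 - (k.n1 ^ 2 + k.n2 ^ 2) + k.a1 ^ 2)
      - ((k.th - 2 * k.sp) / 3 * k.s1 + 2 / 3 * k.n1 * k.np - 2 * k.a1 * k.n2) := by
    rw [riemann_1212]
    linear_combination -(1 / 6) * h.hamiltonian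
  have f4 : k.riemann k' 1 2 1 3 =
      -((k.th - 2 * k.sp) / 3 * k.s2 + 2 / 3 * k.n2 * k.np + 2 * k.a1 * k.n1) := by
    rw [riemann_1213]
    ring
  rw [kretschmann_eq_pairs, e1, e2, e3, e4, e5, e6, h1', h2', h3', h4', h5', h1, h2, h3, h4, h5,
    f1, f2, f3, f4]
  linear_combination (-(64 / 3) * (k.th - 2 * k.sp) * k.a1 - 32 * k.sp * k.a1) * h.momentum
end FrameVars

namespace FrameVars

/-- `N * k'` is the derivative of `k` at `τ`. -/
structure HasDeriv (N : ℝ) (k : ℝ → FrameVars) (k' : FrameVars) (τ : ℝ) : Prop where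
  th : HasDerivAt (fun s => (k s).th) (N * k'.th) τ
  sp : HasDerivAt (fun s => (k s).sp) (N * k'.sp) τ
  s1 : HasDerivAt (fun s => (k s).s1) (N * k'.s1) τ
  s2 : HasDerivAt (fun s => (k s).s2) (N * k'.s2) τ
  r : HasDerivAt (fun s => (k s).r) (N * k'.r) τ
  n1 : HasDerivAt (fun s => (k s).n1) (N * k'.n1) τ
  n2 : HasDerivAt (fun s => (k s).n2) (N * k'.n2) τ
  np : HasDerivAt (fun s => (k s).np) (N * k'.np) τ
  a1 : HasDerivAt (fun s => (k s).a1) (N * k'.a1) τ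

namespace HasDeriv

variable {N τ : ℝ} {k : ℝ → FrameVars} {k' : FrameVars}

theorem timeOne (h : HasDeriv N k k' τ) :
    HasDerivAt (fun s => (k s).timeOne) (N * k'.timeOne) τ :=
  ((h.th.div_const 3).neg.add ((h.sp.const_mul 2).div_const 3)).congr_deriv
    (by unfold FrameVars.timeOne; ring)

theorem time (h : HasDeriv N k k' τ) (A B : Fin 2) :
    HasDerivAt (fun s => (k s).time A B) (N * k'.time A B) τ := by
  fin_cases A <;> fin_cases B
  · exact ((((h.th.add h.sp).div_const 3).neg).sub h.s1).congr_deriv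
      (by simp [FrameVars.time]; ring)
  · exact (h.s2.neg.add h.r).congr_deriv (by simp [FrameVars.time]; ring)
  · exact (h.s2.neg.sub h.r).congr_deriv (by simp [FrameVars.time]; ring)
  · exact ((((h.th.add h.sp).div_const 3).neg).add h.s1).congr_deriv
      (by simp [FrameVars.time]; ring)

theorem space (h : HasDeriv N k k' τ) (A B : Fin 2) :
    HasDerivAt (fun s => (k s).space A B) (N * k'.space A B) τ := by
  fin_cases A <;> fin_cases B
  · exact (h.a1.add h.n2).congr_deriv (by simp [FrameVars.space]; ring)
  · exact (h.n1.neg.add (h.np.div_const 3)).congr_deriv (by simp [FrameVars.space]; ring)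
  · exact (h.n1.neg.sub (h.np.div_const 3)).congr_deriv (by simp [FrameVars.space]; ring)
  · exact (h.a1.sub h.n2).congr_deriv (by simp [FrameVars.space]; ring)

theorem coeff (h : HasDeriv N k k' τ) (α β δ : Fin 4) :
    HasDerivAt (fun s => (k s).coeff α β δ) (N * k'.coeff α β δ) τ := by
  have hn : ∀ {g : ℝ → ℝ} {g' : ℝ}, HasDerivAt g (N * g') τ →
      HasDerivAt (fun s => -g s) (N * -g') τ := fun hg => hg.neg.congr_deriv (by ring)
  have h0 : HasDerivAt (fun _ : ℝ => (0 : ℝ)) (N * 0) τ := by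
    rw [mul_zero]
    exact hasDerivAt_const τ 0
  fin_cases α <;> fin_cases β <;> fin_cases δ <;>
    first
    | exact h0
    | exact h.timeOne
    | exact hn h.timeOne
    | exact h.time _ _
    | exact hn (h.time _ _)
    | exact h.space _ _
    | exact hn (h.space _ _)

theorem conn (h : HasDeriv N k k' τ) (α β δ : Fin 4) :
    HasDerivAt (fun s => (k s).conn α β δ) (N * k'.conn α β δ) τ :=
  ((((h.coeff α β δ).const_mul (minkowskiSign δ)).sub
    ((h.coeff β δ α).const_mul (minkowskiSign α))).add
      ((h.coeff δ α β).const_mul (minkowskiSign β))).const_mul (minkowskiSign δ / 2)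
    |>.congr_deriv (by unfold FrameVars.conn; ring)

end HasDeriv

variable {N : ℝ → ℝ} {c : ℝ → Fin 4 → Fin 4 → Fin 4 → ℝ} {k : ℝ → FrameVars} {k' : FrameVars}
  {τ : ℝ}

theorem frameConn_eq_conn (hc : ∀ s, c s = (k s).coeff) (s : ℝ) (α β δ : Fin 4) :
    frameConn c s α β δ = (k s).conn α β δ := by
  simp only [frameConn, FrameVars.conn, hc]

theorem frameRiemann_eq_riemann (hc : ∀ s, c s = (k s).coeff) (hN : N τ ≠ 0)
    (h : HasDeriv (N τ) k k' τ) (α β μ δ : Fin 4) :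
    frameRiemann N c τ α β μ δ = (k τ).riemann k' α β μ δ := by
  have hd : ∀ α β μ, (N τ)⁻¹ * deriv (fun s => frameConn c s α β μ) τ = k'.conn α β μ := by
    intro α β μ
    simp only [frameConn_eq_conn hc]
    rw [(h.conn α β μ).deriv, inv_mul_cancel_left₀ hN]
  simp only [frameRiemann, FrameVars.riemann, frameDeriv, hd]
  simp only [frameConn_eq_conn hc, hc]

theorem frameRicci_eq_ricci (hc : ∀ s, c s = (k s).coeff) (hN : N τ ≠ 0)
    (h : HasDeriv (N τ) k k' τ) (β μ : Fin 4) :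
    frameRicci N c τ β μ = (k τ).ricci k' β μ := by
  simp only [frameRicci, FrameVars.ricci, frameRiemann_eq_riemann hc hN h]

theorem frameKretschmann_eq_kretschmann (hc : ∀ s, c s = (k s).coeff) (hN : N τ ≠ 0)
    (h : HasDeriv (N τ) k k' τ) : frameKretschmann N c τ = (k τ).kretschmann k' := by
  simp only [frameKretschmann, FrameVars.kretschmann, frameRiemann_eq_riemann hc hN h]

end FrameVars

namespace BianchiSpacetime

variable (S : BianchiSpacetime)

/-- The kinematic quantities of the frame of a Bianchi spacetime. -/
noncomputable def vars (τ : ℝ) : FrameVars where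
  th := S.theta τ
  sp := S.sigmaPlus τ
  s1 := S.shearFree τ 0 0
  s2 := S.shearFree τ 0 1
  r := (S.timeCoeff τ 0 1 - S.timeCoeff τ 1 0) / 2
  n1 := S.nFree τ 0 0
  n2 := S.nFree τ 0 1
  np := S.nPlus τ
  a1 := S.aOne τ

theorem vars_timeOne (τ : ℝ) : (S.vars τ).timeOne = S.timeCoeffOne τ := by
  simp [FrameVars.timeOne, vars, sigmaPlus, shear, theta, Matrix.trace_fin_two]
  ring

theorem vars_time (τ : ℝ) : (S.vars τ).time = S.timeCoeff τ := by
  ext A B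
  fin_cases A <;> fin_cases B <;>
    simp [FrameVars.time, vars, shearFree, sigmaPlus, shear, theta, Matrix.trace_fin_two] <;> ring

theorem vars_space (τ : ℝ) : (S.vars τ).space = S.spaceCoeff τ := by
  ext A B
  fin_cases A <;> fin_cases B <;>
    simp [FrameVars.space, vars, nFree, nPlus, nMat, aOne, Matrix.trace_fin_two] <;> ring

theorem structureFun_eq (τ : ℝ) : S.structureFun τ = (S.vars τ).coeff := by
  funext α β δ
  fin_cases α <;> fin_cases β <;> fin_cases δ <;>
    simp [structureFun, FrameVars.coeff, vars_timeOne, vars_time, vars_space]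

theorem differentiable_F (A B : Fin 2) : Differentiable ℝ fun s => S.F s A B :=
  (S.contDiff_F A B).differentiable (by norm_num)

theorem differentiable_deriv_F (A B : Fin 2) :
    Differentiable ℝ fun s => deriv (fun s => S.F s A B) s :=
  ((contDiff_succ_iff_deriv (n := 1)).1 (by simpa using! S.contDiff_F A B)).2.2.differentiable
    (by norm_num)

theorem differentiable_f : Differentiable ℝ S.f := S.contDiff_f.differentiable (by norm_num)

theorem differentiable_deriv_f : Differentiable ℝ (deriv S.f) :=
  ((contDiff_succ_iff_deriv (n := 1)).1 (by simpa using! S.contDiff_f)).2.2.differentiable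
    (by norm_num)

theorem differentiable_inv_lapse : Differentiable ℝ fun s => (S.lapse s)⁻¹ :=
  (S.contDiff_lapse.differentiable (by norm_num)).inv fun s => (S.lapse_pos s).ne'

theorem differentiable_inv_F (A B : Fin 2) : Differentiable ℝ fun s => (S.F s)⁻¹ A B := by
  have hdet : Differentiable ℝ fun s => ((S.F s).det)⁻¹ := by
    have : Differentiable ℝ fun s => (S.F s).det := by
      simp only [Matrix.det_fin_two]
      exact ((S.differentiable_F 0 0).mul (S.differentiable_F 1 1)).sub
        ((S.differentiable_F 0 1).mul (S.differentiable_F 1 0))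
    exact this.inv S.det_F_ne_zero
  simp only [Matrix.inv_def, Ring.inverse_eq_inv', Matrix.smul_apply, smul_eq_mul,
    Matrix.adjugate_fin_two]
  refine hdet.mul ?_
  fin_cases A <;> fin_cases B <;> simp
  · exact S.differentiable_F 1 1
  · exact S.differentiable_F 0 1
  · exact S.differentiable_F 1 0
  · exact S.differentiable_F 0 0

theorem differentiable_timeCoeffOne : Differentiable ℝ S.timeCoeffOne :=
  S.differentiable_inv_lapse.mul (S.differentiable_deriv_f.div S.differentiable_f S.f_ne_zero)

theorem differentiable_timeCoeff (A B : Fin 2) : Differentiable ℝ fun s => S.timeCoeff s A B := by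
  simp only [timeCoeff, Matrix.smul_apply, smul_eq_mul, Matrix.mul_apply, Fin.sum_univ_two,
    Matrix.of_apply]
  exact S.differentiable_inv_lapse.mul
    (((S.differentiable_deriv_F A 0).mul (S.differentiable_inv_F 0 B)).add
      ((S.differentiable_deriv_F A 1).mul (S.differentiable_inv_F 1 B)))

theorem differentiable_spaceCoeff (A B : Fin 2) :
    Differentiable ℝ fun s => S.spaceCoeff s A B := by
  simp only [spaceCoeff, Matrix.smul_apply, smul_eq_mul, Matrix.mul_apply, Fin.sum_univ_two]
  have h0 := S.differentiable_F A 0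
  have h1 := S.differentiable_F A 1
  exact S.differentiable_f.mul
    ((((h0.mul_const _).add (h1.mul_const _)).mul (S.differentiable_inv_F 0 B)).add
      (((h0.mul_const _).add (h1.mul_const _)).mul (S.differentiable_inv_F 1 B)))

theorem deriv_F_eq (τ : ℝ) : Matrix.of (fun A B => deriv (fun s => S.F s A B) τ) =
    S.lapse τ • (S.timeCoeff τ * S.F τ) := by
  have h : IsUnit (S.F τ).det := isUnit_iff_ne_zero.2 (S.det_F_ne_zero τ)
  rw [timeCoeff, Matrix.smul_mul, Matrix.mul_assoc, Matrix.nonsing_inv_mul _ h, Matrix.mul_one,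
    smul_smul, mul_inv_cancel₀ (S.lapse_pos τ).ne', one_smul]

theorem spaceCoeff_mul_F (τ : ℝ) : S.spaceCoeff τ * S.F τ = S.f τ • (S.F τ * S.M) := by
  have h : IsUnit (S.F τ).det := isUnit_iff_ne_zero.2 (S.det_F_ne_zero τ)
  rw [spaceCoeff, Matrix.smul_mul, Matrix.mul_assoc, Matrix.nonsing_inv_mul _ h, Matrix.mul_one]

/-- The Jacobi identity for the structure functions. -/
theorem deriv_spaceCoeff (τ : ℝ) :
    Matrix.of (fun A B => deriv (fun s => S.spaceCoeff s A B) τ) =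
      S.lapse τ • (S.timeCoeffOne τ • S.spaceCoeff τ
        + (S.timeCoeff τ * S.spaceCoeff τ - S.spaceCoeff τ * S.timeCoeff τ)) := by
  have h : IsUnit (S.F τ).det := isUnit_iff_ne_zero.2 (S.det_F_ne_zero τ)
  have hf : deriv S.f τ = S.lapse τ * S.timeCoeffOne τ * S.f τ := by
    have h1 := (S.lapse_pos τ).ne'
    have h2 := S.f_ne_zero τ
    rw [timeCoeffOne]
    field_simp
  have hF : ∀ A B, deriv (fun s => S.F s A B) τ = (S.lapse τ • (S.timeCoeff τ * S.F τ)) A B :=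
    fun A B => congrFun (congrFun (S.deriv_F_eq τ) A) B
  have key : Matrix.of (fun A B => deriv (fun s => S.spaceCoeff s A B) τ) * S.F τ
      + S.spaceCoeff τ * (S.lapse τ • (S.timeCoeff τ * S.F τ)) =
      (S.lapse τ * S.timeCoeffOne τ * S.f τ) • (S.F τ * S.M)
      + S.f τ • ((S.lapse τ • (S.timeCoeff τ * S.F τ)) * S.M) := by
    ext A B
    have h1 : ∀ s, S.spaceCoeff s A 0 * S.F s 0 B + S.spaceCoeff s A 1 * S.F s 1 B =
        S.f s * (S.F s A 0 * S.M 0 B + S.F s A 1 * S.M 1 B) := by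
      intro s
      simpa [Matrix.mul_apply] using congrFun (congrFun (S.spaceCoeff_mul_F s) A) B
    have h2 := ((S.differentiable_spaceCoeff A 0 τ).hasDerivAt.mul
      (S.differentiable_F 0 B τ).hasDerivAt).add
      ((S.differentiable_spaceCoeff A 1 τ).hasDerivAt.mul (S.differentiable_F 1 B τ).hasDerivAt)
    have h3 := (S.differentiable_f τ).hasDerivAt.mul
      (((S.differentiable_F A 0 τ).hasDerivAt.mul_const (S.M 0 B)).add
      ((S.differentiable_F A 1 τ).hasDerivAt.mul_const (S.M 1 B)))
    have h4 := h2.unique (h3.congr_of_eventuallyEq (Filter.Eventually.of_forall h1))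
    simp only [hF, hf] at h4
    simp only [Matrix.add_apply, Matrix.mul_apply, Fin.sum_univ_two, Matrix.of_apply,
      Matrix.smul_apply, smul_eq_mul] at h4 ⊢
    simp only [Pi.add_apply] at h4
    linear_combination h4
  have h2 : Matrix.of (fun A B => deriv (fun s => S.spaceCoeff s A B) τ) * S.F τ =
      (S.lapse τ • (S.timeCoeffOne τ • S.spaceCoeff τ
        + (S.timeCoeff τ * S.spaceCoeff τ - S.spaceCoeff τ * S.timeCoeff τ))) * S.F τ := by
    rw [eq_sub_of_add_eq key, ← smul_smul, ← S.spaceCoeff_mul_F, Matrix.smul_mul,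
      smul_comm (S.f τ) (S.lapse τ), Matrix.mul_assoc (S.timeCoeff τ), ← Matrix.mul_smul (S.timeCoeff τ),
      ← S.spaceCoeff_mul_F]
    simp only [Matrix.smul_mul, Matrix.mul_smul, Matrix.add_mul, Matrix.sub_mul, smul_add, smul_sub,
      smul_smul, Matrix.mul_assoc]
    abel
  have h3 := congrArg (· * (S.F τ)⁻¹) h2
  simpa only [Matrix.mul_nonsing_inv_cancel_right _ _ h] using h3

theorem deriv_spaceCoeff_apply (τ : ℝ) (A B : Fin 2) :
    deriv (fun s => S.spaceCoeff s A B) τ = S.lapse τ * (S.timeCoeffOne τ * S.spaceCoeff τ A B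
      + (S.timeCoeff τ A 0 * S.spaceCoeff τ 0 B + S.timeCoeff τ A 1 * S.spaceCoeff τ 1 B
        - (S.spaceCoeff τ A 0 * S.timeCoeff τ 0 B + S.spaceCoeff τ A 1 * S.timeCoeff τ 1 B))) := by
  simpa [Matrix.mul_apply] using congrFun (congrFun (S.deriv_spaceCoeff τ) A) B

/-- The derivatives of the kinematic quantities in the direction of `e₀`. -/
noncomputable def vars' (τ : ℝ) : FrameVars where
  th := (S.lapse τ)⁻¹ * deriv (fun s => (S.vars s).th) τ
  sp := (S.lapse τ)⁻¹ * deriv (fun s => (S.vars s).sp) τ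
  s1 := (S.lapse τ)⁻¹ * deriv (fun s => (S.vars s).s1) τ
  s2 := (S.lapse τ)⁻¹ * deriv (fun s => (S.vars s).s2) τ
  r := (S.lapse τ)⁻¹ * deriv (fun s => (S.vars s).r) τ
  n1 := (S.lapse τ)⁻¹ * deriv (fun s => (S.vars s).n1) τ
  n2 := (S.lapse τ)⁻¹ * deriv (fun s => (S.vars s).n2) τ
  np := (S.lapse τ)⁻¹ * deriv (fun s => (S.vars s).np) τ
  a1 := (S.lapse τ)⁻¹ * deriv (fun s => (S.vars s).a1) τ

theorem hasDeriv_vars (τ : ℝ) : FrameVars.HasDeriv (S.lapse τ) S.vars (S.vars' τ) τ := by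
  have hN := (S.lapse_pos τ).ne'
  have hd : ∀ {g : ℝ → ℝ}, Differentiable ℝ g →
      HasDerivAt g (S.lapse τ * ((S.lapse τ)⁻¹ * deriv g τ)) τ := fun hg => by
    rw [mul_inv_cancel_left₀ hN]
    exact (hg τ).hasDerivAt
  have h1 := S.differentiable_timeCoeffOne
  have h00 := S.differentiable_timeCoeff 0 0
  have h01 := S.differentiable_timeCoeff 0 1
  have h10 := S.differentiable_timeCoeff 1 0
  have h11 := S.differentiable_timeCoeff 1 1
  have m00 := S.differentiable_spaceCoeff 0 0
  have m01 := S.differentiable_spaceCoeff 0 1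
  have m10 := S.differentiable_spaceCoeff 1 0
  have m11 := S.differentiable_spaceCoeff 1 1
  refine ⟨hd ?_, hd ?_, hd ?_, hd ?_, hd ?_, hd ?_, hd ?_, hd ?_, hd ?_⟩ <;>
    simp only [vars, theta, sigmaPlus, shearFree, shear, nFree, nPlus, nMat, aOne,
      Matrix.trace_fin_two, Matrix.of_apply, Matrix.sub_apply, Matrix.smul_apply, Matrix.one_apply,
      Matrix.cons_val', Matrix.cons_val_zero, Matrix.cons_val_one, Matrix.cons_val_fin_one,
      smul_eq_mul, zero_ne_one, ↓reduceIte] <;>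
    fun_prop

theorem jacobi_vars (τ : ℝ) : (S.vars τ).Jacobi (S.vars' τ) := by
  have hN := (S.lapse_pos τ).ne'
  have h := S.hasDeriv_vars τ
  have key : ∀ A B, (S.vars' τ).space A B = (S.vars τ).timeOne * (S.vars τ).space A B
      + ((S.vars τ).time A 0 * (S.vars τ).space 0 B + (S.vars τ).time A 1 * (S.vars τ).space 1 B
        - ((S.vars τ).space A 0 * (S.vars τ).time 0 B
          + (S.vars τ).space A 1 * (S.vars τ).time 1 B)) := by
    intro A B
    have h1 := (h.space A B).deriv
    simp only [vars_space] at h1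
    rw [S.deriv_spaceCoeff_apply τ A B] at h1
    rw [vars_space, vars_time, vars_timeOne]
    exact (mul_left_cancel₀ hN h1).symm
  have h00 := key 0 0
  have h01 := key 0 1
  have h10 := key 1 0
  have h11 := key 1 1
  simp only [FrameVars.space, FrameVars.time, Matrix.of_apply, Matrix.cons_val', Matrix.cons_val_zero,
    Matrix.cons_val_one, Matrix.cons_val_fin_one] at h00 h01 h10 h11
  refine ⟨?_, ?_, ?_, ?_⟩
  · linear_combination -(h01 + h10) / 2
  · linear_combination (h00 - h11) / 2
  · linear_combination 3 / 2 * (h01 - h10)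
  · linear_combination (h00 + h11) / 2

theorem ricci_eq (τ : ℝ) (α β : Fin 4) : S.ricci τ α β = (S.vars τ).ricci (S.vars' τ) α β :=
  FrameVars.frameRicci_eq_ricci S.structureFun_eq (S.lapse_pos τ).ne' (S.hasDeriv_vars τ) α β

theorem kretschmann_eq (τ : ℝ) : S.kretschmann τ = (S.vars τ).kretschmann (S.vars' τ) :=
  FrameVars.frameKretschmann_eq_kretschmann S.structureFun_eq (S.lapse_pos τ).ne'
    (S.hasDeriv_vars τ)

theorem vars_s1_sq (τ : ℝ) : S.sigmaTilde τ = 3 * ((S.vars τ).s1 ^ 2 + (S.vars τ).s2 ^ 2) := by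
  simp [sigmaTilde, vars, shearFree, sigmaPlus, shear, Matrix.trace_fin_two, Fin.sum_univ_two]
  ring

theorem vars_n1_sq (τ : ℝ) : S.nTilde τ = 3 * ((S.vars τ).n1 ^ 2 + (S.vars τ).n2 ^ 2) := by
  simp [nTilde, vars, nFree, nPlus, nMat, Matrix.trace_fin_two, Fin.sum_univ_two]
  ring

theorem vars_delta (τ : ℝ) : S.delta τ =
    3 * ((S.vars τ).s1 * (S.vars τ).n1 + (S.vars τ).s2 * (S.vars τ).n2) := by
  simp [delta, vars, shearFree, sigmaPlus, shear, nFree, nPlus, nMat, Matrix.trace_fin_two,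
    Fin.sum_univ_two]
  ring

namespace Realises

variable {S} {κ : ℝ} {Γ : ℝ → HWState}

theorem einstein (h : S.Realises κ Γ) (τ : ℝ) : (S.vars τ).Einstein (S.vars' τ) :=
  FrameVars.einstein_of_ricci_eq_zero (S.jacobi_vars τ) fun β μ => by
    rw [← S.ricci_eq]
    exact h.vacuum τ β μ

/-- The Kretschmann scalar in terms of the expansion-normalised variables. -/
theorem kretschmann_eq (h : S.Realises κ Γ) (τ : ℝ) : S.kretschmann τ = S.theta τ ^ 4 *
    (12 * ((Γ τ).sigmaTilde / 3 - (1 + (Γ τ).sigmaPlus) ^ 2 / 9 - (Γ τ).nTilde κ / 3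
        + (Γ τ).aTilde / 9) ^ 2
      + 16 * ((1 - 2 * (Γ τ).sigmaPlus) ^ 2 * (Γ τ).sigmaTilde
        + 4 * (Γ τ).nPlus ^ 2 * (Γ τ).nTilde κ + 4 * (Γ τ).aTilde * (Γ τ).nTilde κ
        + 4 * (1 - 2 * (Γ τ).sigmaPlus) * (Γ τ).nPlus * (Γ τ).delta
        + 4 * (1 - 2 * (Γ τ).sigmaPlus) * (Γ τ).aTilde * (Γ τ).sigmaPlus) / 27
      - 16 / 3 * (Γ τ).delta ^ 2
      - 16 * (9 * (Γ τ).sigmaPlus ^ 2 * (Γ τ).nTilde κ + 4 * (Γ τ).nPlus ^ 2 * (Γ τ).sigmaTilde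
        + (Γ τ).aTilde * (Γ τ).sigmaTilde + 12 * (Γ τ).sigmaPlus * (Γ τ).nPlus * (Γ τ).delta
        - 6 * (Γ τ).sigmaPlus ^ 2 * (Γ τ).aTilde) / 27) := by
  have hθ := (h.theta_pos τ).ne'
  rw [S.kretschmann_eq, (h.einstein τ).kretschmann_eq (S.jacobi_vars τ), h.sigmaTilde_eq,
    h.sigmaPlus_eq, h.nTilde_eq, h.nPlus_eq, h.aTilde_eq, h.delta_eq, S.vars_s1_sq, S.vars_n1_sq,
    S.vars_delta]
  simp only [vars, aTilde]
  field_simp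
  ring

theorem hasDerivAt_theta (h : S.Realises κ Γ) (τ : ℝ) : HasDerivAt S.theta
    (-(1 + 2 * ((Γ τ).sigmaPlus ^ 2 + (Γ τ).sigmaTilde)) * S.theta τ) τ := by
  have hθ := (h.theta_pos τ).ne'
  have h1 : HasDerivAt S.theta (S.lapse τ * (S.vars' τ).th) τ := (S.hasDeriv_vars τ).th
  refine h1.congr_deriv ?_
  rw [(h.einstein τ).th, h.lapse_eq, h.sigmaPlus_eq, h.sigmaTilde_eq, S.vars_s1_sq]
  simp only [vars]
  field_simp
  ring

/-- The mean curvature grows at least exponentially towards the past. -/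
theorem exp_le_theta (h : S.Realises κ Γ) {τ : ℝ} (hτ : τ ≤ 0) :
    S.theta 0 * Real.exp (-τ) ≤ S.theta τ := by
  have hd : ∀ s, HasDerivAt (fun s => S.theta s * Real.exp s)
      (-(2 * ((Γ s).sigmaPlus ^ 2 + (Γ s).sigmaTilde)) * (S.theta s * Real.exp s)) s := fun s =>
    ((h.hasDerivAt_theta s).mul (Real.hasDerivAt_exp s)).congr_deriv (by ring)
  have hanti : Antitone fun s => S.theta s * Real.exp s := by
    refine antitone_of_deriv_nonpos (fun s => (hd s).differentiableAt) fun s => ?_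
    rw [(hd s).deriv]
    have h1 : 0 ≤ (Γ s).sigmaTilde := by
      rw [h.sigmaTilde_eq, S.vars_s1_sq]
      positivity
    have h2 := mul_pos (h.theta_pos s) (Real.exp_pos s)
    have h3 : 0 ≤ 2 * ((Γ s).sigmaPlus ^ 2 + (Γ s).sigmaTilde) := by positivity
    nlinarith [mul_nonneg h3 h2.le]
  have h4 := hanti hτ
  simp only [Real.exp_zero, mul_one] at h4
  rw [Real.exp_neg, mul_inv_le_iff₀ (Real.exp_pos τ)]
  exact h4

end Realises

end BianchiSpacetime

section Vacuum

open Filter Topology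

/-! ### Asymptotics towards the past -/

/-- The Hewitt–Wainwright system in vacuum, for the components of a solution and `n = Ñ`. -/
structure VacuumFlow (κ : ℝ) (S T D A N n : ℝ → ℝ) : Prop where
  hn : ∀ τ, N τ ^ 2 = 3 * n τ + κ * A τ
  dS : ∀ τ, HasDerivAt S (-2 * (A τ + n τ) * S τ - 2 * n τ) τ
  dT : ∀ τ, HasDerivAt T (-4 * (A τ + n τ) * T τ - 4 * S τ * A τ - 4 * D τ * N τ) τ
  dD : ∀ τ, HasDerivAt D (2 * (1 - 2 * (A τ + n τ) + S τ) * D τ + 2 * (T τ - n τ) * N τ) τ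
  dA : ∀ τ, HasDerivAt A (4 * (1 - (A τ + n τ) + S τ) * A τ) τ
  dN : ∀ τ, HasDerivAt N (2 * (1 - (A τ + n τ) + S τ) * N τ + 6 * D τ) τ
  dn : ∀ τ, HasDerivAt n (4 * (1 - (A τ + n τ) + S τ) * n τ + 4 * D τ * N τ) τ
  momentum : ∀ τ, T τ * n τ = D τ ^ 2 + S τ ^ 2 * A τ
  T_nonneg : ∀ τ, 0 ≤ T τ
  A_nonneg : ∀ τ, 0 ≤ A τ
  n_nonneg : ∀ τ, 0 ≤ n τ
  hamiltonian : ∀ τ, S τ ^ 2 + T τ + A τ + n τ = 1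

theorem IsHWSolution.vacuumFlow {γ κ : ℝ} {Γ : ℝ → HWState} (hΓ : IsHWSolution γ κ Γ)
    (hv : ∀ τ, (Γ τ).density κ = 0) :
    VacuumFlow κ (fun τ => (Γ τ).sigmaPlus) (fun τ => (Γ τ).sigmaTilde) (fun τ => (Γ τ).delta)
      (fun τ => (Γ τ).aTilde) (fun τ => (Γ τ).nPlus) (fun τ => (Γ τ).nTilde κ) := by
  have hq : ∀ τ, (Γ τ).decel γ κ = 2 - 2 * ((Γ τ).aTilde + (Γ τ).nTilde κ) := by
    intro τ
    have h := hv τ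
    unfold HWState.density at h
    unfold HWState.decel
    linear_combination -(3 / 2 * (2 - γ)) * h
  refine ⟨fun τ => ?_, fun τ => ?_, fun τ => ?_, fun τ => ?_, fun τ => ?_, fun τ => ?_, fun τ => ?_,
    fun τ => ?_, fun τ => (hΓ.constraints τ).sigmaTilde_nonneg,
    fun τ => (hΓ.constraints τ).aTilde_nonneg, fun τ => (hΓ.constraints τ).nTilde_nonneg,
    fun τ => ?_⟩
  · unfold HWState.nTilde; ring
  · exact (hΓ.sigmaPlus τ).congr_deriv (by rw [hq]; ring)
  · exact (hΓ.sigmaTilde τ).congr_deriv (by rw [hq]; ring)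
  · exact (hΓ.delta τ).congr_deriv (by rw [hq]; ring)
  · exact (hΓ.aTilde τ).congr_deriv (by rw [hq]; ring)
  · exact (hΓ.nPlus τ).congr_deriv (by rw [hq]; ring)
  · have h := ((((hΓ.nPlus τ).pow 2).sub ((hΓ.aTilde τ).const_mul κ)).div_const 3)
    refine h.congr_deriv ?_
    rw [hq]
    simp only [HWState.nTilde]
    ring
  · linarith [(hΓ.constraints τ).momentum]
  · have h := hv τ
    unfold HWState.density at h
    linarith

/-- Barbalat's lemma towards the past. -/
theorem tendsto_deriv_atBot_zero {L E E' : ℝ → ℝ} {B c : ℝ} (hL : ∀ τ, HasDerivAt L (E τ) τ)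
    (hE : ∀ τ, HasDerivAt E (E' τ) τ) (hB : ∀ τ, E' τ ≤ B) (h0 : ∀ τ, 0 ≤ E τ)
    (hc : ∀ τ, c ≤ L τ) : Tendsto E atBot (𝓝 0) := by
  have hmono : Monotone L := monotone_of_deriv_nonneg (fun τ => (hL τ).differentiableAt)
    fun τ => by rw [(hL τ).deriv]; exact h0 τ
  have hlim : Tendsto L atBot (𝓝 (⨅ τ, L τ)) :=
    tendsto_atBot_ciInf hmono ⟨c, by rintro _ ⟨τ, rfl⟩; exact hc τ⟩
  set b := max B 1 with hb
  have hb1 : 1 ≤ b := le_max_right _ _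
  have hlow : ∀ τ s, s ≤ τ → E τ - b * (τ - s) ≤ E s := by
    intro τ s hs
    have hd : ∀ x, HasDerivAt (fun x => E x - b * x) (E' x - b) x := fun x =>
      ((hE x).sub ((hasDerivAt_id x).const_mul b)).congr_deriv (by simp)
    have := antitone_of_deriv_nonpos (fun x => (hd x).differentiableAt)
      (fun x => by rw [(hd x).deriv]; linarith [hB x, le_max_left B 1]) hs
    simp only at this
    linarith
  have hint : ∀ τ s, s ≤ τ → E τ * (τ - s) - b * (τ - s) ^ 2 / 2 ≤ L τ - L s := by
    intro τ s hs
    have hd : ∀ x, HasDerivAt (fun x => L x - (E τ * x + b * (x - τ) ^ 2 / 2))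
        (E x - (E τ + b * (x - τ))) x := fun x =>
      ((hL x).sub (((hasDerivAt_id x).const_mul (E τ)).add
        (((((hasDerivAt_id x).sub_const τ).pow 2).const_mul b).div_const 2))).congr_deriv
          (by simp; ring)
    have := (monotoneOn_of_deriv_nonneg (convex_Iic τ)
      (fun x _ => (hd x).continuousAt.continuousWithinAt)
      (fun x _ => (hd x).differentiableAt.differentiableWithinAt)
      (fun x hx => by
        rw [(hd x).deriv]
        have hx' : x ∈ Set.Iic τ := interior_subset hx
        linarith [hlow τ x hx'])) hs (Set.mem_Iic.2 le_rfl) hs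
    simp only at this
    linarith
  rw [Metric.tendsto_nhds]
  intro ε hε
  have hpos : 0 < ε ^ 2 / (2 * b) := by positivity
  have hshift : Tendsto (fun τ => L τ - L (τ - ε / b)) atBot (𝓝 0) := by
    have h2 : Tendsto (fun τ => τ - ε / b) atBot atBot := tendsto_atBot_add_const_right _ _ tendsto_id
    simpa using hlim.sub (hlim.comp h2)
  filter_upwards [hshift.eventually (gt_mem_nhds hpos)] with τ hτ
  rw [Real.dist_eq, sub_zero, abs_of_nonneg (h0 τ)]
  by_contra! hcon
  have h1 := hint τ (τ - ε / b) (by linarith [show 0 ≤ ε / b by positivity])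
  have h2 : E τ * (ε / b) - b * (ε / b) ^ 2 / 2 < ε ^ 2 / (2 * b) := by
    refine lt_of_le_of_lt ?_ hτ
    simpa using h1
  have h3 : ε * (ε / b) ≤ E τ * (ε / b) := mul_le_mul_of_nonneg_right hcon (by positivity)
  have h4 : ε * (ε / b) - b * (ε / b) ^ 2 / 2 = ε ^ 2 / (2 * b) := by
    field_simp
    ring
  linarith

/-- A differential inequality with vanishing data at `-∞`. -/
theorem le_sq_of_deriv_le_mul_sqrt {Y Y' a a' : ℝ → ℝ} {t : ℝ} (hY : ∀ τ, HasDerivAt Y (Y' τ) τ)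
    (ha : ∀ τ, HasDerivAt a (a' τ) τ) (hY0 : ∀ τ, 0 ≤ Y τ) (ha' : ∀ τ ≤ t, 0 ≤ a' τ)
    (hle : ∀ τ ≤ t, Y' τ ≤ 2 * a' τ * √(Y τ)) (hlim : Tendsto Y atBot (𝓝 0))
    (hlima : Tendsto a atBot (𝓝 0)) : ∀ τ ≤ t, √(Y τ) ≤ a τ := by
  have key : ∀ δ > 0, ∀ τ ≤ t, √(Y τ + δ) - a τ ≤ √δ := by
    intro δ hδ
    have hpos : ∀ τ, 0 < Y τ + δ := fun τ => by linarith [hY0 τ]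
    have hd : ∀ τ, HasDerivAt (fun τ => √(Y τ + δ) - a τ)
        (Y' τ / (2 * √(Y τ + δ)) - a' τ) τ := fun τ =>
      (((hY τ).add_const δ).sqrt (hpos τ).ne').sub (ha τ)
    have hanti : AntitoneOn (fun τ => √(Y τ + δ) - a τ) (Set.Iic t) :=
      antitoneOn_of_deriv_nonpos (convex_Iic t)
        (fun x _ => (hd x).continuousAt.continuousWithinAt)
        (fun x _ => (hd x).differentiableAt.differentiableWithinAt)
        (fun x hx => by
          have hx' : x ∈ Set.Iic t := interior_subset hx
          have hs : 0 < √(Y x + δ) := Real.sqrt_pos.2 (hpos x)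
          rw [(hd x).deriv, sub_nonpos, div_le_iff₀ (by positivity)]
          have h1 : √(Y x) ≤ √(Y x + δ) := Real.sqrt_le_sqrt (by linarith)
          have h2 := mul_le_mul_of_nonneg_left h1 (ha' x hx')
          linarith [hle x hx'])
    intro τ hτ
    have hl : Tendsto (fun τ => √(Y τ + δ) - a τ) atBot (𝓝 √δ) := by
      simpa using ((hlim.add_const δ).sqrt).sub hlima
    refine ge_of_tendsto hl ?_
    filter_upwards [eventually_le_atBot τ] with s hs
    exact hanti (hs.trans hτ) hτ hs
  intro τ hτ
  have hl : Tendsto (fun δ => √δ + a τ) (𝓝[>] 0) (𝓝 (a τ)) := by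
    have h : Tendsto (fun δ => √δ + a τ) (𝓝 0) (𝓝 (√0 + a τ)) :=
      (Real.continuous_sqrt.tendsto 0).add_const _
    rw [Real.sqrt_zero, zero_add] at h
    exact h.mono_left nhdsWithin_le_nhds
  refine ge_of_tendsto hl ?_
  filter_upwards [self_mem_nhdsWithin] with δ hδ
  have h1 : √(Y τ) ≤ √(Y τ + δ) := Real.sqrt_le_sqrt (by linarith [Set.mem_Ioi.1 hδ])
  linarith [key δ hδ τ hτ]

namespace VacuumFlow

variable {κ : ℝ} {S T D A N n : ℝ → ℝ}

theorem add_le_one (h : VacuumFlow κ S T D A N n) (τ : ℝ) : A τ + n τ ≤ 1 := by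
  nlinarith [h.hamiltonian τ, h.T_nonneg τ, sq_nonneg (S τ)]

theorem S_sq_le_one (h : VacuumFlow κ S T D A N n) (τ : ℝ) : S τ ^ 2 ≤ 1 := by
  linarith [h.hamiltonian τ, h.T_nonneg τ, h.A_nonneg τ, h.n_nonneg τ]

theorem abs_S_le_one (h : VacuumFlow κ S T D A N n) (τ : ℝ) : |S τ| ≤ 1 := by
  rw [← sq_le_one_iff_abs_le_one]
  exact h.S_sq_le_one τ

theorem T_le_one (h : VacuumFlow κ S T D A N n) (τ : ℝ) : T τ ≤ 1 := by
  nlinarith [h.hamiltonian τ, h.A_nonneg τ, h.n_nonneg τ, sq_nonneg (S τ)]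

theorem N_sq_le (h : VacuumFlow κ S T D A N n) (τ : ℝ) : N τ ^ 2 ≤ (3 + |κ|) * (A τ + n τ) := by
  rw [h.hn τ]
  have h1 := h.A_nonneg τ
  have h2 := h.n_nonneg τ
  nlinarith [mul_le_mul_of_nonneg_right (le_abs_self κ) h1, abs_nonneg κ,
    mul_nonneg (abs_nonneg κ) h2]

theorem D_sq_le (h : VacuumFlow κ S T D A N n) (τ : ℝ) : D τ ^ 2 ≤ n τ := by
  have h1 := h.momentum τ
  have h2 := mul_nonneg (sq_nonneg (S τ)) (h.A_nonneg τ)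
  have h3 := mul_le_mul_of_nonneg_right (h.T_le_one τ) (h.n_nonneg τ)
  linarith

theorem abs_D_mul_N_le (h : VacuumFlow κ S T D A N n) (τ : ℝ) : |D τ * N τ| ≤ 4 + |κ| := by
  have h1 := h.D_sq_le τ
  have h2 := h.N_sq_le τ
  have h3 := h.add_le_one τ
  have h4 := h.A_nonneg τ
  have h5 := h.n_nonneg τ
  have h6 : (3 + |κ|) * (A τ + n τ) ≤ (3 + |κ|) * 1 :=
    mul_le_mul_of_nonneg_left h3 (by positivity)
  rw [abs_le]
  constructor <;> nlinarith [sq_nonneg (D τ + N τ), sq_nonneg (D τ - N τ), abs_nonneg κ]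

theorem hasDerivAt_Z (h : VacuumFlow κ S T D A N n) (τ : ℝ) :
    HasDerivAt (fun τ => (1 + S τ) ^ 2 - A τ) (-4 * (A τ + n τ) * ((1 + S τ) ^ 2 - A τ)) τ :=
  ((((h.dS τ).const_add 1).pow 2).sub (h.dA τ)).congr_deriv (by simp; ring)

/-- If `(1 + Σ₊)² - Ã` vanishes identically, then the solution is constant, either in Taub 1 or in a
plane wave equilibrium point. -/
theorem eq_of_Z_eq_zero (h : VacuumFlow κ S T D A N n) (hZ : ∀ τ, (1 + S τ) ^ 2 - A τ = 0)
    (τ : ℝ) : -1 ≤ S 0 ∧ S τ = S 0 ∧ T τ = -S 0 * (1 + S 0) ∧ D τ = 0 ∧ A τ = (1 + S 0) ^ 2 ∧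
      n τ = -S 0 * (1 + S 0) ∧ N τ = N 0 := by
  have hpt : ∀ τ, T τ = -S τ * (1 + S τ) ∧ D τ = 0 ∧ A τ = (1 + S τ) ^ 2 ∧
      n τ = -S τ * (1 + S τ) := by
    intro τ
    have hA : A τ = (1 + S τ) ^ 2 := by linarith [hZ τ]
    have h1 := h.hamiltonian τ
    have h2 := h.momentum τ
    rw [hA] at h1 h2
    have hT : T τ = -2 * S τ * (1 + S τ) - n τ := by linear_combination h1
    have hsq : D τ ^ 2 + (n τ + S τ * (1 + S τ)) ^ 2 = 0 := by
      rw [hT] at h2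
      linear_combination -h2
    have hD : D τ = 0 := by nlinarith [sq_nonneg (D τ), sq_nonneg (n τ + S τ * (1 + S τ))]
    have hn : n τ + S τ * (1 + S τ) = 0 := by
      nlinarith [sq_nonneg (D τ), sq_nonneg (n τ + S τ * (1 + S τ))]
    exact ⟨by linarith, hD, hA, by linarith⟩
  have hS : ∀ τ, S τ = S 0 := fun τ => by
    refine is_const_of_deriv_eq_zero (fun τ => (h.dS τ).differentiableAt) (fun τ => ?_) τ 0
    rw [(h.dS τ).deriv, (hpt τ).2.2.1, (hpt τ).2.2.2]
    ring
  have hN : N τ = N 0 := by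
    refine is_const_of_deriv_eq_zero (fun τ => (h.dN τ).differentiableAt) (fun τ => ?_) τ 0
    rw [(h.dN τ).deriv, (hpt τ).2.1, (hpt τ).2.2.1, (hpt τ).2.2.2]
    ring
  have h1 := hpt τ
  rw [hS τ] at h1
  exact ⟨by linarith [(abs_le.1 (h.abs_S_le_one 0)).1], hS τ, h1.1, h1.2.1, h1.2.2.1, h1.2.2.2, hN⟩

/-- If `(1 + Σ₊)² - Ã` does not vanish at some time, it never does. -/
theorem Z_sq_pos (h : VacuumFlow κ S T D A N n) {t : ℝ} (ht : (1 + S t) ^ 2 - A t ≠ 0) (τ : ℝ) :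
    0 < ((1 + S τ) ^ 2 - A τ) ^ 2 := by
  have hd : ∀ τ, HasDerivAt (fun τ => ((1 + S τ) ^ 2 - A τ) ^ 2)
      (-8 * (A τ + n τ) * ((1 + S τ) ^ 2 - A τ) ^ 2) τ := fun τ =>
    ((h.hasDerivAt_Z τ).pow 2).congr_deriv (by simp; ring)
  have hd' : ∀ τ, HasDerivAt (fun τ => ((1 + S τ) ^ 2 - A τ) ^ 2 * Real.exp (8 * τ))
      (8 * (1 - (A τ + n τ)) * (((1 + S τ) ^ 2 - A τ) ^ 2 * Real.exp (8 * τ))) τ := fun τ =>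
    ((hd τ).mul (((hasDerivAt_id τ).const_mul 8).exp)).congr_deriv (by simp; ring)
  have ht' : 0 < ((1 + S t) ^ 2 - A t) ^ 2 := by positivity
  rcases le_total τ t with hτ | hτ
  · have hanti := antitone_of_deriv_nonpos (fun τ => (hd τ).differentiableAt) (fun τ => by
      rw [(hd τ).deriv]
      nlinarith [mul_nonneg (add_nonneg (h.A_nonneg τ) (h.n_nonneg τ))
        (sq_nonneg ((1 + S τ) ^ 2 - A τ))]) hτ
    exact ht'.trans_le hanti
  · have hmono := monotone_of_deriv_nonneg (fun τ => (hd' τ).differentiableAt) (fun τ => by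
      rw [(hd' τ).deriv]
      have := h.add_le_one τ
      exact mul_nonneg (by linarith) (by positivity)) hτ
    simp only at hmono
    have h1 := (mul_pos ht' (Real.exp_pos (8 * t))).trans_le hmono
    exact (mul_pos_iff_of_pos_right (Real.exp_pos _)).1 h1

/-- A function with derivative `Ã + Ñ` that converges towards the past. -/
theorem exists_primitive (h : VacuumFlow κ S T D A N n) {t : ℝ} (ht : (1 + S t) ^ 2 - A t ≠ 0) :
    ∃ (L : ℝ → ℝ) (l : ℝ), (∀ τ, HasDerivAt L (A τ + n τ) τ) ∧ (∀ τ, l ≤ L τ) ∧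
      Tendsto L atBot (𝓝 l) := by
  have hd : ∀ τ, HasDerivAt (fun τ => -(Real.log (((1 + S τ) ^ 2 - A τ) ^ 2) / 8))
      (A τ + n τ) τ := fun τ => by
    have hpos := (h.Z_sq_pos ht τ).ne'
    have hz : (1 + S τ) ^ 2 - A τ ≠ 0 := by
      intro h0
      simp [h0] at hpos
    refine ((((h.hasDerivAt_Z τ).pow 2).log hpos).div_const 8).neg.congr_deriv ?_
    simp only [Nat.cast_ofNat, Pi.pow_apply]
    field_simp
    ring
  have hmono := monotone_of_deriv_nonneg (fun τ => (hd τ).differentiableAt) fun τ => by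
    rw [(hd τ).deriv]; exact add_nonneg (h.A_nonneg τ) (h.n_nonneg τ)
  have hbdd : BddBelow (Set.range fun τ => -(Real.log (((1 + S τ) ^ 2 - A τ) ^ 2) / 8)) := by
    refine ⟨-(Real.log 16 / 8), ?_⟩
    rintro _ ⟨τ, rfl⟩
    have h1 := h.S_sq_le_one τ
    have h2 := h.A_nonneg τ
    have h3 := h.add_le_one τ
    have h4 := h.n_nonneg τ
    have h5 := abs_le.1 (h.abs_S_le_one τ)
    have h6 : ((1 + S τ) ^ 2 - A τ) ^ 2 ≤ 16 := by
      have h7 : |(1 + S τ) ^ 2 - A τ| ≤ 4 := by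
        rw [abs_le]; constructor <;> nlinarith
      calc ((1 + S τ) ^ 2 - A τ) ^ 2 = |(1 + S τ) ^ 2 - A τ| ^ 2 := (sq_abs _).symm
        _ ≤ 4 ^ 2 := pow_le_pow_left₀ (abs_nonneg _) h7 2
        _ = 16 := by norm_num
    have h7 := Real.log_le_log (h.Z_sq_pos ht τ) h6
    simp only
    linarith
  exact ⟨_, _, hd, fun τ => ciInf_le hbdd τ, tendsto_atBot_ciInf hmono hbdd⟩

/-- The limits of a solution towards the past. -/
structure PastLimit (S T D A N n : ℝ → ℝ) (s : ℝ) : Prop where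
  s_gt : -1 < s
  s_le : s ≤ 1
  S : Tendsto S atBot (𝓝 s)
  T : Tendsto T atBot (𝓝 (1 - s ^ 2))
  D : Tendsto D atBot (𝓝 0)
  A : Tendsto A atBot (𝓝 0)
  N : Tendsto N atBot (𝓝 0)
  n : Tendsto n atBot (𝓝 0)

theorem exists_pastLimit (h : VacuumFlow κ S T D A N n) {t : ℝ} (ht : (1 + S t) ^ 2 - A t ≠ 0) :
    ∃ s, PastLimit S T D A N n s := by
  obtain ⟨L, l, hL, hl, hLl⟩ := h.exists_primitive ht
  have hE : Tendsto (fun τ => A τ + n τ) atBot (𝓝 0) := by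
    refine tendsto_deriv_atBot_zero (B := 24 + 4 * |κ|) hL (fun τ => (h.dA τ).add (h.dn τ))
      (fun τ => ?_) (fun τ => add_nonneg (h.A_nonneg τ) (h.n_nonneg τ)) hl
    have h1 := (abs_le.1 (h.abs_D_mul_N_le τ)).2
    have h2 := (abs_le.1 (h.abs_S_le_one τ)).2
    have h3 := h.A_nonneg τ
    have h4 := h.n_nonneg τ
    have h5 := h.add_le_one τ
    have h6 : (1 - (A τ + n τ) + S τ) * (A τ + n τ) ≤ 2 := by nlinarith
    linarith
  have hA : Tendsto A atBot (𝓝 0) := squeeze_zero h.A_nonneg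
    (fun τ => by linarith [h.n_nonneg τ]) hE
  have hn : Tendsto n atBot (𝓝 0) := squeeze_zero h.n_nonneg
    (fun τ => by linarith [h.A_nonneg τ]) hE
  have hsq : ∀ {f : ℝ → ℝ}, Tendsto (fun τ => f τ ^ 2) atBot (𝓝 0) → Tendsto f atBot (𝓝 0) := by
    intro f hf
    rw [tendsto_zero_iff_abs_tendsto_zero]
    simpa [Real.sqrt_sq_eq_abs] using! hf.sqrt
  have hN : Tendsto N atBot (𝓝 0) := hsq <| by
    simp only [h.hn]
    simpa using (hn.const_mul 3).add (hA.const_mul κ)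
  have hD : Tendsto D atBot (𝓝 0) := hsq <|
    squeeze_zero (fun τ => sq_nonneg _) h.D_sq_le hn
  have hd : ∀ τ, HasDerivAt (fun τ => S τ + 4 * L τ)
      (-2 * (A τ + n τ) * S τ - 2 * n τ + 4 * (A τ + n τ)) τ := fun τ =>
    (h.dS τ).add ((hL τ).const_mul 4)
  have hmono := monotone_of_deriv_nonneg (fun τ => (hd τ).differentiableAt) fun τ => by
    rw [(hd τ).deriv]
    have h2 := (abs_le.1 (h.abs_S_le_one τ)).2
    have h3 := h.A_nonneg τ
    have h4 := h.n_nonneg τ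
    nlinarith [mul_nonneg (add_nonneg h3 h4) (sub_nonneg.2 h2)]
  have hbdd : BddBelow (Set.range fun τ => S τ + 4 * L τ) := by
    refine ⟨-1 + 4 * l, ?_⟩
    rintro _ ⟨τ, rfl⟩
    have h2 := (abs_le.1 (h.abs_S_le_one τ)).1
    have h3 := hl τ
    simp only
    linarith
  have hS : Tendsto S atBot (𝓝 ((⨅ τ, S τ + 4 * L τ) - 4 * l)) :=
    ((tendsto_atBot_ciInf hmono hbdd).sub (hLl.const_mul 4)).congr fun τ => by ring
  refine ⟨(⨅ τ, S τ + 4 * L τ) - 4 * l, ?_, ?_, hS, ?_, hD, hA, hN, hn⟩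
  · set s := (⨅ τ, S τ + 4 * L τ) - 4 * l
    have h1 : -1 ≤ s := ge_of_tendsto hS
      (Eventually.of_forall fun τ => (abs_le.1 (h.abs_S_le_one τ)).1)
    refine lt_of_le_of_ne h1 fun hs => ?_
    have h2 : Tendsto (fun τ => ((1 + S τ) ^ 2 - A τ) ^ 2) atBot (𝓝 (((1 + s) ^ 2 - 0) ^ 2)) :=
      (((hS.const_add 1).pow 2).sub hA).pow 2
    rw [← hs] at h2
    have hd : ∀ τ, HasDerivAt (fun τ => ((1 + S τ) ^ 2 - A τ) ^ 2)
        (-8 * (A τ + n τ) * ((1 + S τ) ^ 2 - A τ) ^ 2) τ := fun τ =>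
      ((h.hasDerivAt_Z τ).pow 2).congr_deriv (by simp; ring)
    have hanti := antitone_of_deriv_nonpos (fun τ => (hd τ).differentiableAt) (fun τ => by
      rw [(hd τ).deriv]
      nlinarith [mul_nonneg (add_nonneg (h.A_nonneg τ) (h.n_nonneg τ))
        (sq_nonneg ((1 + S τ) ^ 2 - A τ))])
    have h3 := ge_of_tendsto h2 ((eventually_le_atBot t).mono fun τ hτ => hanti hτ)
    have h4 := h.Z_sq_pos ht t
    norm_num at h3
    exact ht (by nlinarith)
  · exact le_of_tendsto hS (Eventually.of_forall fun τ => (abs_le.1 (h.abs_S_le_one τ)).2)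
  · have := ((tendsto_const_nhds (x := (1 : ℝ))).sub (hS.pow 2)).sub hE
    rw [sub_zero] at this
    exact this.congr fun τ => by linarith [h.hamiltonian τ]

end VacuumFlow

namespace VacuumFlow

variable {κ : ℝ} {S T D A N n : ℝ → ℝ}

theorem hasDerivAt_P (h : VacuumFlow κ S T D A N n) (τ : ℝ) :
    HasDerivAt (fun τ => D τ - S τ * N τ) ((2 - 4 * (A τ + n τ) - 4 * S τ) * (D τ - S τ * N τ)
      + 2 * N τ * (T τ - 3 * S τ ^ 2)) τ :=
  ((h.dD τ).sub ((h.dS τ).mul (h.dN τ))).congr_deriv (by ring)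

theorem hasDerivAt_Q (h : VacuumFlow κ S T D A N n) (τ : ℝ) :
    HasDerivAt (fun τ => T τ - 3 * S τ ^ 2) (-4 * (A τ + n τ) * (T τ - 3 * S τ ^ 2)
      - 4 * S τ * ((κ + 1) * A τ) - 4 * (D τ - S τ * N τ) * N τ) τ :=
  ((h.dT τ).sub (((h.dS τ).pow 2).const_mul 3)).congr_deriv (by
    simp only [Nat.cast_ofNat]
    linear_combination -4 * S τ * h.hn τ)

/-- The momentum constraint in terms of the deviation from local rotational symmetry. -/
theorem momentum_PQ (h : VacuumFlow κ S T D A N n) (τ : ℝ) :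
    S τ ^ 2 * ((κ + 1) * A τ) = (T τ - 3 * S τ ^ 2) * n τ
      - (D τ - S τ * N τ) * (D τ - S τ * N τ + 2 * S τ * N τ) := by
  linear_combination -S τ ^ 2 * h.hn τ - h.momentum τ

theorem hasDerivAt_PN (h : VacuumFlow κ S T D A N n) (τ : ℝ) :
    HasDerivAt (fun τ => (D τ - S τ * N τ) * N τ) (6 * (D τ - S τ * N τ) ^ 2
      + (4 - 6 * (A τ + n τ) + 4 * S τ) * ((D τ - S τ * N τ) * N τ)
      + 2 * N τ ^ 2 * (T τ - 3 * S τ ^ 2)) τ :=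
  ((h.hasDerivAt_P τ).mul (h.dN τ)).congr_deriv (by ring)

set_option maxHeartbeats 400000 in
/-- A pointwise estimate for the evolution of the deviation from local rotational symmetry. -/
theorem deviation_estimate {S A n E P Q N R : ℝ} (hS : 1 / 4 ≤ S) (hS1 : S ≤ 1) (hE : E = A + n)
    (hA : 0 ≤ A) (hn : 0 ≤ n) (hE1 : E ≤ 1) (hN : |N| ≤ 1) (hQ : Q = 1 - 4 * S ^ 2 - E)
    (hc : S ^ 2 * R = Q * n - P * (P + 2 * S * N)) :
    -8 * E * Q ^ 2 - 8 * S * R * Q + 8 * (2 - 4 * E - 4 * S) * P ^ 2 + 8 * N * P * Q ≤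
      (10 * P ^ 2 + 3 * N ^ 2 + 4 * E) * (Q ^ 2 + 4 * P ^ 2) + 16 * |R| * |Q| := by
  have hE0 : 0 ≤ E := by linarith
  obtain ⟨u, hu⟩ : ∃ u, u = 1 / 2 - S := ⟨_, rfl⟩
  have hident : -8 * E * Q ^ 2 - 8 * S * R * Q + 8 * (2 - 4 * E - 4 * S) * P ^ 2 + 8 * N * P * Q =
      -8 * A * Q ^ 2 + 32 * u ^ 2 * P ^ 2 - 24 * E * P ^ 2 + 16 * u * (P * N) * Q
        - 8 * S * (1 + S) * (R * Q) := by
    rw [hu]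
    linear_combination 8 * Q * hc - 8 * P ^ 2 * hQ - 8 * Q ^ 2 * hE
  have hu1 : |u| ≤ (|Q| + E) / 3 := by
    have h1 : 4 * u * (1 / 2 + S) = Q + E := by rw [hQ, hu]; ring
    have h2 : |4 * u * (1 / 2 + S)| = 4 * |u| * (1 / 2 + S) := by
      rw [abs_mul, abs_mul, abs_of_nonneg (show (0:ℝ) ≤ 4 by norm_num),
        abs_of_nonneg (show 0 ≤ 1 / 2 + S by linarith)]
    have h3 : |Q + E| ≤ |Q| + E := by
      simpa [abs_of_nonneg hE0] using abs_add_le Q E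
    rw [← h1, h2] at h3
    linarith [mul_nonneg (abs_nonneg u) (sub_nonneg.2 hS)]
  have hW : 0 ≤ Q ^ 2 + 4 * P ^ 2 := by positivity
  have hQ2 : |Q| ^ 2 = Q ^ 2 := sq_abs Q
  have hP2 : |P| ^ 2 = P ^ 2 := sq_abs P
  have hN2 : |N| ^ 2 = N ^ 2 := sq_abs N
  have h1 : u ^ 2 * P ^ 2 ≤ 2 / 9 * P ^ 2 * (Q ^ 2 + 4 * P ^ 2) + E / 18 * (Q ^ 2 + 4 * P ^ 2) := by
    have h2 : u ^ 2 ≤ 2 / 9 * (Q ^ 2 + E) := by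
      have h3 : |u| ^ 2 ≤ ((|Q| + E) / 3) ^ 2 := pow_le_pow_left₀ (abs_nonneg _) hu1 2
      rw [sq_abs] at h3
      linarith [sq_nonneg (|Q| - E), mul_le_mul_of_nonneg_left hE1 hE0]
    have h4 := mul_le_mul_of_nonneg_right h2 (sq_nonneg P)
    linarith [sq_nonneg (P ^ 2), mul_nonneg hE0 (sq_nonneg Q)]
  have h2 : u * (P * N) * Q ≤ (P ^ 2 + N ^ 2) / 6 * (Q ^ 2 + 4 * P ^ 2)
      + E / 12 * (Q ^ 2 + 4 * P ^ 2) := by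
    have hPN : |P| * |N| ≤ (P ^ 2 + N ^ 2) / 2 := by linarith [sq_nonneg (|P| - |N|)]
    have hPQ : |P| * |Q| ≤ (Q ^ 2 + 4 * P ^ 2) / 4 := by linarith [sq_nonneg (2 * |P| - |Q|)]
    have h0 : u * (P * N) * Q ≤ |u| * (|P| * |N|) * |Q| := by
      rw [← abs_mul, ← abs_mul, ← abs_mul]
      exact le_abs_self _
    have h3 : |u| * (|P| * |N|) * |Q| ≤ (|Q| + E) / 3 * (|P| * |N|) * |Q| :=
      mul_le_mul_of_nonneg_right (mul_le_mul_of_nonneg_right hu1 (by positivity)) (abs_nonneg _)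
    have h4 : |Q| ^ 2 * (|P| * |N|) ≤ (Q ^ 2 + 4 * P ^ 2) * ((P ^ 2 + N ^ 2) / 2) :=
      mul_le_mul (by linarith [sq_nonneg P]) hPN (by positivity) hW
    have h5 : E * |N| * (|P| * |Q|) ≤ E * 1 * ((Q ^ 2 + 4 * P ^ 2) / 4) :=
      mul_le_mul (mul_le_mul_of_nonneg_left hN hE0) hPQ (by positivity) (by linarith)
    have h6 : (|Q| + E) / 3 * (|P| * |N|) * |Q| =
        (|Q| ^ 2 * (|P| * |N|) + E * |N| * (|P| * |Q|)) / 3 := by ring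
    linarith
  have h3 : -8 * S * (1 + S) * (R * Q) ≤ 16 * |R| * |Q| := by
    have h4 : -(R * Q) ≤ |R| * |Q| := by
      rw [← abs_mul]
      exact neg_le_abs _
    have h5 : 0 ≤ S * (1 + S) := mul_nonneg (by linarith) (by linarith)
    have h6 : S * (1 + S) ≤ 2 := by
      linarith [mul_nonneg (sub_nonneg.2 hS1) (show 0 ≤ S + 2 by linarith)]
    have h7 : 0 ≤ |R| * |Q| := by positivity
    linarith [mul_le_mul_of_nonneg_left h4 h5, mul_le_mul_of_nonneg_right h6 h7]
  rw [hident]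
  have h4 : 0 ≤ A * Q ^ 2 := by positivity
  have h5 : 0 ≤ E * P ^ 2 := by positivity
  have h6 : 0 ≤ P ^ 2 * (Q ^ 2 + 4 * P ^ 2) := by positivity
  have h7 : 0 ≤ N ^ 2 * (Q ^ 2 + 4 * P ^ 2) := by positivity
  have h8 : 0 ≤ E * (Q ^ 2 + 4 * P ^ 2) := by positivity
  linarith

/-- Local rotational symmetry propagates to the future. -/
theorem isLRS_of_le (h : VacuumFlow κ S T D A N n) {t : ℝ}
    (ht : D t - S t * N t = 0 ∧ T t - 3 * S t ^ 2 = 0 ∧ (κ + 1) * A t = 0) {τ : ℝ} (hτ : t ≤ τ) :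
    D τ - S τ * N τ = 0 ∧ T τ - 3 * S τ ^ 2 = 0 ∧ (κ + 1) * A τ = 0 := by
  let V : ℝ → ℝ := fun τ => (T τ - 3 * S τ ^ 2) ^ 2 + 2 * (D τ - S τ * N τ) ^ 2
    + ((κ + 1) * A τ) ^ 2
  have hV : ∀ τ, 0 ≤ V τ := fun τ => by simp only [V]; positivity
  have hd : ∀ τ, HasDerivAt V (-8 * (A τ + n τ) * (T τ - 3 * S τ ^ 2) ^ 2
      + 8 * (1 - 2 * (A τ + n τ) - 2 * S τ) * (D τ - S τ * N τ) ^ 2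
      - 8 * S τ * ((κ + 1) * A τ) * (T τ - 3 * S τ ^ 2)
      + 8 * (1 - (A τ + n τ) + S τ) * ((κ + 1) * A τ) ^ 2) τ := fun τ =>
    ((((h.hasDerivAt_Q τ).pow 2).add (((h.hasDerivAt_P τ).pow 2).const_mul 2)).add
      (((h.dA τ).const_mul (κ + 1)).pow 2)).congr_deriv (by simp only [Nat.cast_ofNat]; ring)
  have hd' : ∀ τ, HasDerivAt (fun τ => V τ * Real.exp (-40 * τ))
      ((-8 * (A τ + n τ) * (T τ - 3 * S τ ^ 2) ^ 2
      + 8 * (1 - 2 * (A τ + n τ) - 2 * S τ) * (D τ - S τ * N τ) ^ 2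
      - 8 * S τ * ((κ + 1) * A τ) * (T τ - 3 * S τ ^ 2)
      + 8 * (1 - (A τ + n τ) + S τ) * ((κ + 1) * A τ) ^ 2 - 40 * V τ) * Real.exp (-40 * τ)) τ :=
    fun τ => ((hd τ).mul (((hasDerivAt_id τ).const_mul (-40)).exp)).congr_deriv (by simp; ring)
  have hanti : Antitone fun τ => V τ * Real.exp (-40 * τ) := by
    refine antitone_of_deriv_nonpos (fun τ => (hd' τ).differentiableAt) fun τ => ?_
    rw [(hd' τ).deriv]
    refine mul_nonpos_of_nonpos_of_nonneg ?_ (Real.exp_pos _).le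
    have h1 := h.A_nonneg τ
    have h2 := h.n_nonneg τ
    obtain ⟨h3, h4⟩ := abs_le.1 (h.abs_S_le_one τ)
    have e1 : 0 ≤ (A τ + n τ) * (T τ - 3 * S τ ^ 2) ^ 2 := by positivity
    have e2 : (1 - 2 * (A τ + n τ) - 2 * S τ) * (D τ - S τ * N τ) ^ 2 ≤
        3 * (D τ - S τ * N τ) ^ 2 :=
      mul_le_mul_of_nonneg_right (by linarith) (sq_nonneg _)
    have e3 : (1 - (A τ + n τ) + S τ) * ((κ + 1) * A τ) ^ 2 ≤ 2 * ((κ + 1) * A τ) ^ 2 :=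
      mul_le_mul_of_nonneg_right (by linarith) (sq_nonneg _)
    have e4 : -(S τ * ((κ + 1) * A τ) * (T τ - 3 * S τ ^ 2)) ≤
        (((κ + 1) * A τ) ^ 2 + (T τ - 3 * S τ ^ 2) ^ 2) / 2 := by
      have hS2 := h.S_sq_le_one τ
      linarith [sq_nonneg (S τ * ((κ + 1) * A τ) + (T τ - 3 * S τ ^ 2)),
        mul_le_mul_of_nonneg_right hS2 (sq_nonneg ((κ + 1) * A τ))]
    simp only [V]
    linarith [sq_nonneg (T τ - 3 * S τ ^ 2), sq_nonneg (D τ - S τ * N τ),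
      sq_nonneg ((κ + 1) * A τ)]
  have h0 : V t = 0 := by simp only [V, ht.1, ht.2.1, ht.2.2]; ring
  have h1 := hanti hτ
  simp only [h0, zero_mul] at h1
  have h2 : V τ ≤ 0 := by
    by_contra! hcon
    exact absurd h1 (not_le.2 (mul_pos hcon (Real.exp_pos _)))
  have h3 : V τ = 0 := le_antisymm h2 (hV τ)
  simp only [V] at h3
  have h4 := sq_nonneg (T τ - 3 * S τ ^ 2)
  have h5 := sq_nonneg (D τ - S τ * N τ)
  have h6 := sq_nonneg ((κ + 1) * A τ)
  exact ⟨pow_eq_zero_iff two_ne_zero |>.1 (by linarith),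
    pow_eq_zero_iff two_ne_zero |>.1 (by linarith), pow_eq_zero_iff two_ne_zero |>.1 (by linarith)⟩

/-- A solution that emanates from the point Taub 2 is locally rotationally symmetric. -/
theorem isLRS_of_pastLimit (h : VacuumFlow κ S T D A N n) {t : ℝ} (ht : (1 + S t) ^ 2 - A t ≠ 0)
    (hl : PastLimit S T D A N n (1 / 2)) (τ : ℝ) :
    D τ - S τ * N τ = 0 ∧ T τ - 3 * S τ ^ 2 = 0 ∧ (κ + 1) * A τ = 0 := by
  obtain ⟨L, l, hL, hlb, hLl⟩ := h.exists_primitive ht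
  set c : ℝ := 50 * (3 + |κ|) + 4 with hc
  set P : ℝ → ℝ := fun τ => D τ - S τ * N τ with hP
  set Q : ℝ → ℝ := fun τ => T τ - 3 * S τ ^ 2 with hQ
  set G : ℝ → ℝ := fun τ => 10 / 3 * (P τ * N τ) + c * L τ with hG
  have hPl : Tendsto P atBot (𝓝 0) := by simpa using hl.D.sub (hl.S.mul hl.N)
  have hQl : Tendsto Q atBot (𝓝 0) := by
    have := hl.T.sub ((hl.S.pow 2).const_mul 3)
    norm_num at this
    exact this
  have hGl : Tendsto G atBot (𝓝 (c * l)) := by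
    simpa using ((hPl.mul hl.N).const_mul (10 / 3)).add (hLl.const_mul c)
  have hNl : ∀ᶠ τ in atBot, |N τ| ≤ 1 := by
    have := hl.N.abs
    rw [abs_zero] at this
    exact (this.eventually (gt_mem_nhds one_pos)).mono fun _ => le_of_lt
  have hSl : ∀ᶠ τ in atBot, 1 / 4 ≤ S τ :=
    (hl.S.eventually (lt_mem_nhds (by norm_num))).mono fun _ => le_of_lt
  have hG1 : ∀ᶠ τ in atBot, c * l - 1 < G τ := hGl.eventually (lt_mem_nhds (by linarith))
  have hG2 : ∀ᶠ τ in atBot, G τ < c * l + 1 := hGl.eventually (gt_mem_nhds (by linarith))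
  obtain ⟨t₀, ht₀⟩ := eventually_atBot.1 (hNl.and (hSl.and (hG1.and hG2)))
  set r : ℝ → ℝ := fun τ => Real.exp (-(G τ / 2)) with hr
  have hrpos : ∀ τ, 0 < r τ := fun τ => Real.exp_pos _
  have hrsq : ∀ τ, r τ ^ 2 = Real.exp (-G τ) := fun τ => by
    rw [hr, ← Real.exp_nat_mul]
    congr 1
    push_cast
    ring
  set W : ℝ → ℝ := fun τ => Q τ ^ 2 + 4 * P τ ^ 2 with hW
  have hW0 : ∀ τ, 0 ≤ W τ := fun τ => by simp only [hW]; positivity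
  have hQW : ∀ τ, |Q τ| ≤ √(W τ) := fun τ => Real.abs_le_sqrt (by simp only [hW]; linarith [sq_nonneg (Q τ), sq_nonneg (P τ)])
  have hPW : ∀ τ, |P τ| ≤ √(W τ) := fun τ => Real.abs_le_sqrt (by simp only [hW]; linarith [sq_nonneg (Q τ), sq_nonneg (P τ)])
  have hY : ∀ τ, √(W τ * Real.exp (-G τ)) = √(W τ) * r τ := fun τ => by
    rw [Real.sqrt_mul (hW0 τ), ← hrsq, Real.sqrt_sq (hrpos τ).le]
  set M : ℝ := Real.exp (-((c * l - 1) / 2)) with hM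
  set m : ℝ := Real.exp (-((c * l + 1) / 2)) with hm
  have hm0 : 0 < m := Real.exp_pos _
  have hM0 : 0 < M := Real.exp_pos _
  have hdW : ∀ τ, HasDerivAt W (-8 * (A τ + n τ) * Q τ ^ 2 - 8 * S τ * ((κ + 1) * A τ) * Q τ
      + 8 * (2 - 4 * (A τ + n τ) - 4 * S τ) * P τ ^ 2 + 8 * N τ * P τ * Q τ) τ := fun τ =>
    (((h.hasDerivAt_Q τ).pow 2).add (((h.hasDerivAt_P τ).pow 2).const_mul 4)).congr_deriv
      (by simp only [hP, hQ, Nat.cast_ofNat]; ring)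
  have hdG : ∀ τ, HasDerivAt G (10 / 3 * (6 * P τ ^ 2
      + (4 - 6 * (A τ + n τ) + 4 * S τ) * (P τ * N τ) + 2 * N τ ^ 2 * Q τ)
      + c * (A τ + n τ)) τ := fun τ =>
    ((h.hasDerivAt_PN τ).const_mul (10 / 3)).add ((hL τ).const_mul c)
  have hgG : ∀ τ ≤ t₀, 10 * P τ ^ 2 + 3 * N τ ^ 2 + 4 * (A τ + n τ) ≤ 10 / 3 * (6 * P τ ^ 2
      + (4 - 6 * (A τ + n τ) + 4 * S τ) * (P τ * N τ) + 2 * N τ ^ 2 * Q τ)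
      + c * (A τ + n τ) := by
    intro τ hτ
    obtain ⟨-, hS, -⟩ := ht₀ τ hτ
    have h1 := h.N_sq_le τ
    have h2 := h.add_le_one τ
    have h3 := h.A_nonneg τ
    have h4 := h.n_nonneg τ
    have h5 := (abs_le.1 (h.abs_S_le_one τ)).2
    have h6 : -3 ≤ Q τ := by
      simp only [hQ]
      linarith [h.T_nonneg τ, h.S_sq_le_one τ]
    have h7 : |(4 - 6 * (A τ + n τ) + 4 * S τ) * (P τ * N τ)| ≤ 8 * |P τ * N τ| := by
      rw [abs_mul]
      refine mul_le_mul_of_nonneg_right ?_ (abs_nonneg _)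
      rw [abs_le]
      constructor <;> linarith
    have h8 : 8 * |P τ * N τ| ≤ 3 * P τ ^ 2 + 16 / 3 * N τ ^ 2 := by
      rw [abs_mul, ← sq_abs (P τ), ← sq_abs (N τ)]
      linarith [sq_nonneg (3 * |P τ| - 4 * |N τ|)]
    have h9 := (abs_le.1 h7).1
    have h10 : N τ ^ 2 * (-3) ≤ N τ ^ 2 * Q τ := mul_le_mul_of_nonneg_left h6 (sq_nonneg _)
    have h11 : c * (A τ + n τ) = 50 * ((3 + |κ|) * (A τ + n τ)) + 4 * (A τ + n τ) := by
      rw [hc]; ring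
    linarith [sq_nonneg (N τ), sq_nonneg (P τ)]
  have hdY : ∀ τ, HasDerivAt (fun τ => W τ * Real.exp (-G τ))
      (((-8 * (A τ + n τ) * Q τ ^ 2 - 8 * S τ * ((κ + 1) * A τ) * Q τ
      + 8 * (2 - 4 * (A τ + n τ) - 4 * S τ) * P τ ^ 2 + 8 * N τ * P τ * Q τ)
      - (10 / 3 * (6 * P τ ^ 2 + (4 - 6 * (A τ + n τ) + 4 * S τ) * (P τ * N τ)
        + 2 * N τ ^ 2 * Q τ) + c * (A τ + n τ)) * W τ) * Real.exp (-G τ)) τ := fun τ =>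
    ((hdW τ).mul (hdG τ).neg.exp).congr_deriv (by simp only [Pi.neg_apply]; ring)
  have hYl : Tendsto (fun τ => W τ * Real.exp (-G τ)) atBot (𝓝 0) := by
    have h1 : Tendsto W atBot (𝓝 0) := by
      simpa using (hQl.pow 2).add ((hPl.pow 2).const_mul 4)
    simpa using h1.mul hGl.neg.rexp
  have hsqrt := le_sq_of_deriv_le_mul_sqrt (t := t₀) hdY
    (fun τ => (h.dA τ).const_mul (8 * |κ + 1| * M))
    (fun τ => mul_nonneg (hW0 τ) (Real.exp_pos _).le)
    (fun τ hτ => by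
      have h1 := h.A_nonneg τ
      have h2 := h.add_le_one τ
      have h3 := (ht₀ τ hτ).2.1
      exact mul_nonneg (by positivity) (mul_nonneg (by linarith) h1))
    (fun τ hτ => by
      obtain ⟨hN1, hS1, hGa, -⟩ := ht₀ τ hτ
      have h1 := h.A_nonneg τ
      have h2 := h.add_le_one τ
      have hest := deviation_estimate (P := P τ) (Q := Q τ) (R := (κ + 1) * A τ) hS1
        (abs_le.1 (h.abs_S_le_one τ)).2 rfl h1 (h.n_nonneg τ) h2 hN1
        (by simp only [hQ]; linarith [h.hamiltonian τ])
        (by simp only [hP, hQ]; exact h.momentum_PQ τ)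
      have h3 := mul_le_mul_of_nonneg_right (hgG τ hτ) (hW0 τ)
      have hrM : r τ ≤ M := Real.exp_le_exp.2 (by linarith)
      rw [hY, ← hrsq]
      have h4 : 16 * |(κ + 1) * A τ| * |Q τ| ≤ 16 * (|κ + 1| * A τ) * √(W τ) := by
        rw [abs_mul, abs_of_nonneg h1]
        exact mul_le_mul_of_nonneg_left (hQW τ) (by positivity)
      have h5 : r τ ^ 2 ≤ M * r τ := by
        rw [sq]
        exact mul_le_mul_of_nonneg_right hrM (hrpos τ).le
      have h6 : A τ ≤ 4 * (1 - (A τ + n τ) + S τ) * A τ := by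
        exact le_mul_of_one_le_left h1 (by linarith)
      have hs : 0 ≤ √(W τ) := Real.sqrt_nonneg _
      calc _ ≤ (16 * (|κ + 1| * A τ) * √(W τ)) * r τ ^ 2 :=
            mul_le_mul_of_nonneg_right (by simp only [hW] at h3 ⊢; linarith) (sq_nonneg _)
        _ ≤ (16 * (|κ + 1| * A τ) * √(W τ)) * (M * r τ) :=
            mul_le_mul_of_nonneg_left h5 (by positivity)
        _ = 16 * |κ + 1| * M * (√(W τ) * r τ) * A τ := by ring
        _ ≤ 16 * |κ + 1| * M * (√(W τ) * r τ) * (4 * (1 - (A τ + n τ) + S τ) * A τ) :=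
            mul_le_mul_of_nonneg_left h6 (by have := hrpos τ; positivity)
        _ = _ := by ring)
    hYl (by simpa using hl.A.const_mul (8 * |κ + 1| * M))
  set K : ℝ := 8 * M / m with hK
  have hK0 : 0 < K := by positivity
  have hWR : ∀ τ ≤ t₀, √(W τ) ≤ K * |(κ + 1) * A τ| := by
    intro τ hτ
    have h1 := hsqrt τ hτ
    simp only [hY] at h1
    have h2 : m ≤ r τ := Real.exp_le_exp.2 (by linarith [(ht₀ τ hτ).2.2.2])
    have h3 := mul_le_mul_of_nonneg_left h2 (Real.sqrt_nonneg (W τ))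
    rw [abs_mul, abs_of_nonneg (h.A_nonneg τ), hK, div_mul_eq_mul_div, le_div_iff₀ hm0]
    linarith
  have hsmall : ∀ᶠ τ in atBot, K * (n τ + |P τ| + 2 * |N τ|) < 1 / 32 := by
    have h1 : Tendsto (fun τ => K * (n τ + |P τ| + 2 * |N τ|)) atBot (𝓝 0) := by
      simpa using ((hl.n.add hPl.abs).add (hl.N.abs.const_mul 2)).const_mul K
    exact h1.eventually (gt_mem_nhds (by norm_num))
  obtain ⟨t₁, ht₁⟩ := eventually_atBot.1 hsmall
  have hpast : ∀ τ ≤ min t₀ t₁, P τ = 0 ∧ Q τ = 0 ∧ (κ + 1) * A τ = 0 := by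
    intro τ hτ
    have hτ₀ : τ ≤ t₀ := hτ.trans (min_le_left _ _)
    have h1 := ht₁ τ (hτ.trans (min_le_right _ _))
    have h2 := hWR τ hτ₀
    have h3 := (ht₀ τ hτ₀).2.1
    have h4 : S τ ^ 2 * |(κ + 1) * A τ| ≤ |Q τ| * n τ + |P τ| * (|P τ| + 2 * |N τ|) := by
      have e1 : S τ ^ 2 * |(κ + 1) * A τ| =
          |Q τ * n τ - P τ * (P τ + 2 * S τ * N τ)| := by
        rw [← h.momentum_PQ τ, abs_mul (S τ ^ 2), abs_of_nonneg (sq_nonneg (S τ))]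
      have e2 : |P τ + 2 * S τ * N τ| ≤ |P τ| + 2 * |N τ| := by
        refine (abs_add_le _ _).trans ?_
        rw [abs_mul, abs_mul, abs_two]
        have := mul_le_mul_of_nonneg_right (h.abs_S_le_one τ) (abs_nonneg (N τ))
        linarith
      rw [e1]
      refine (abs_sub _ _).trans ?_
      rw [abs_mul, abs_mul, abs_of_nonneg (h.n_nonneg τ)]
      have := mul_le_mul_of_nonneg_left e2 (abs_nonneg (P τ))
      linarith
    have h5 := mul_le_mul_of_nonneg_right ((hQW τ).trans h2) (h.n_nonneg τ)
    have h6 := mul_le_mul_of_nonneg_right ((hPW τ).trans h2)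
      (show 0 ≤ |P τ| + 2 * |N τ| by positivity)
    have h7 := mul_le_mul_of_nonneg_right h1.le (abs_nonneg ((κ + 1) * A τ))
    have h8 : 1 / 16 * |(κ + 1) * A τ| ≤ S τ ^ 2 * |(κ + 1) * A τ| :=
      mul_le_mul_of_nonneg_right (by linarith [pow_le_pow_left₀ (by norm_num) h3 2]) (abs_nonneg _)
    have h9 : |(κ + 1) * A τ| = 0 := by
      have := abs_nonneg ((κ + 1) * A τ)
      linarith
    rw [h9, mul_zero] at h2
    exact ⟨abs_nonpos_iff.1 ((hPW τ).trans h2), abs_nonpos_iff.1 ((hQW τ).trans h2),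
      abs_eq_zero.1 h9⟩
  exact h.isLRS_of_le (hpast (min τ (min t₀ t₁)) (min_le_right _ _)) (min_le_left _ _)

end VacuumFlow

/-! ### Reconstruction of the spacetime -/

theorem contDiff_succ_of_hasDerivAt {y v : ℝ → ℝ} {m : ℕ} (hy : ∀ τ, HasDerivAt y (v τ) τ)
    (hv : ContDiff ℝ m v) : ContDiff ℝ (m + 1) y := by
  rw [contDiff_succ_iff_deriv]
  refine ⟨fun τ => (hy τ).differentiableAt, by simp, ?_⟩
  rwa [show deriv y = v from funext fun τ => (hy τ).deriv]

/-- Positive solutions of a scalar linear equation. -/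
theorem exists_pos_hasDerivAt_mul {g : ℝ → ℝ} (hg : Continuous g) :
    ∃ e : ℝ → ℝ, e 0 = 1 ∧ (∀ τ, 0 < e τ) ∧ ∀ τ, HasDerivAt e (g τ * e τ) τ := by
  refine ⟨fun τ => Real.exp (∫ s in (0 : ℝ)..τ, g s), by simp, fun τ => Real.exp_pos _, fun τ => ?_⟩
  have h : HasDerivAt (fun τ => ∫ s in (0 : ℝ)..τ, g s) (g τ) τ :=
    intervalIntegral.integral_hasDerivAt_right (hg.intervalIntegrable 0 τ)
      (hg.stronglyMeasurableAtFilter _ _) hg.continuousAt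
  exact h.exp.congr_deriv (mul_comm _ _)

namespace VacuumFlow

variable {κ : ℝ} {S T D A N n : ℝ → ℝ}

theorem continuous_S (h : VacuumFlow κ S T D A N n) : Continuous S :=
  continuous_iff_continuousAt.2 fun τ => (h.dS τ).continuousAt

theorem continuous_T (h : VacuumFlow κ S T D A N n) : Continuous T :=
  continuous_iff_continuousAt.2 fun τ => (h.dT τ).continuousAt

theorem continuous_D (h : VacuumFlow κ S T D A N n) : Continuous D :=
  continuous_iff_continuousAt.2 fun τ => (h.dD τ).continuousAt

theorem continuous_A (h : VacuumFlow κ S T D A N n) : Continuous A :=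
  continuous_iff_continuousAt.2 fun τ => (h.dA τ).continuousAt

theorem continuous_N (h : VacuumFlow κ S T D A N n) : Continuous N :=
  continuous_iff_continuousAt.2 fun τ => (h.dN τ).continuousAt

theorem continuous_n (h : VacuumFlow κ S T D A N n) : Continuous n :=
  continuous_iff_continuousAt.2 fun τ => (h.dn τ).continuousAt

theorem contDiff_S (h : VacuumFlow κ S T D A N n) : ContDiff ℝ 1 S := by
  have := h.continuous_S; have := h.continuous_A; have := h.continuous_n
  exact contDiff_succ_of_hasDerivAt (m := 0) h.dS (contDiff_zero.2 (by fun_prop))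

theorem contDiff_T (h : VacuumFlow κ S T D A N n) : ContDiff ℝ 1 T := by
  have := h.continuous_S; have := h.continuous_A; have := h.continuous_n
  have := h.continuous_T; have := h.continuous_D; have := h.continuous_N
  exact contDiff_succ_of_hasDerivAt (m := 0) h.dT (contDiff_zero.2 (by fun_prop))

theorem contDiff_A (h : VacuumFlow κ S T D A N n) : ContDiff ℝ 1 A := by
  have := h.continuous_S; have := h.continuous_A; have := h.continuous_n
  exact contDiff_succ_of_hasDerivAt (m := 0) h.dA (contDiff_zero.2 (by fun_prop))

theorem contDiff_N (h : VacuumFlow κ S T D A N n) : ContDiff ℝ 1 N := by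
  have := h.continuous_S; have := h.continuous_A; have := h.continuous_n
  have := h.continuous_D; have := h.continuous_N
  exact contDiff_succ_of_hasDerivAt (m := 0) h.dN (contDiff_zero.2 (by fun_prop))

theorem contDiff_n (h : VacuumFlow κ S T D A N n) : ContDiff ℝ 1 n := by
  have := h.continuous_S; have := h.continuous_A; have := h.continuous_n
  have := h.continuous_D; have := h.continuous_N
  exact contDiff_succ_of_hasDerivAt (m := 0) h.dn (contDiff_zero.2 (by fun_prop))

/-- A differentiable square root of `Ã`. -/
theorem exists_sqrt_A (h : VacuumFlow κ S T D A N n) : ∃ a : ℝ → ℝ,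
    (∀ τ, HasDerivAt a (2 * (1 - (A τ + n τ) + S τ) * a τ) τ) ∧ ∀ τ, a τ ^ 2 = A τ := by
  have := h.continuous_S; have := h.continuous_A; have := h.continuous_n
  obtain ⟨e, he0, hepos, he⟩ := exists_pos_hasDerivAt_mul
    (g := fun τ => 2 * (1 - (A τ + n τ) + S τ)) (by fun_prop)
  have hd : ∀ τ, HasDerivAt (fun τ => A τ / e τ ^ 2) 0 τ := fun τ => by
    refine ((h.dA τ).div ((he τ).pow 2) (pow_pos (hepos τ) 2).ne').congr_deriv ?_
    rw [div_eq_zero_iff]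
    left
    simp only [Nat.cast_ofNat, Pi.pow_apply]
    ring
  refine ⟨fun τ => √(A 0) * e τ, fun τ => ((he τ).const_mul _).congr_deriv (by ring), fun τ => ?_⟩
  have h1 := is_const_of_deriv_eq_zero (fun τ => (hd τ).differentiableAt)
    (fun τ => (hd τ).deriv) τ 0
  rw [he0, one_pow, div_one, div_eq_iff (pow_pos (hepos τ) 2).ne'] at h1
  rw [mul_pow, Real.sq_sqrt (h.A_nonneg 0), h1]

theorem exists_initial_vectors (h : VacuumFlow κ S T D A N n) {a : ℝ → ℝ}
    (ha : ∀ τ, a τ ^ 2 = A τ) (τ : ℝ) : ∃ z₁ z₂ w₁ w₂ : ℝ, z₁ ^ 2 + z₂ ^ 2 = T τ ∧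
      w₁ ^ 2 + w₂ ^ 2 = n τ ∧ z₁ * w₁ + z₂ * w₂ = D τ ∧ z₁ * w₂ - z₂ * w₁ = -(S τ * a τ) := by
  have hm := h.momentum τ
  rw [← ha τ] at hm
  rcases (h.T_nonneg τ).eq_or_lt with hT | hT
  · rw [← hT, zero_mul] at hm
    have h1 : D τ ^ 2 = 0 := by nlinarith [sq_nonneg (D τ), sq_nonneg (S τ * a τ)]
    have h2 : (S τ * a τ) ^ 2 = 0 := by nlinarith [sq_nonneg (D τ), sq_nonneg (S τ * a τ)]
    refine ⟨0, 0, √(n τ), 0, by simp [← hT], by simp [Real.sq_sqrt (h.n_nonneg τ)], ?_, ?_⟩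
    · simp [pow_eq_zero_iff two_ne_zero |>.1 h1]
    · simp [pow_eq_zero_iff two_ne_zero |>.1 h2]
  · have h1 : √(T τ) ^ 2 = T τ := Real.sq_sqrt hT.le
    have h2 : √(T τ) ≠ 0 := (Real.sqrt_pos.2 hT).ne'
    refine ⟨√(T τ), 0, D τ / √(T τ), -(S τ * a τ) / √(T τ), by simp [h1], ?_, ?_, ?_⟩
    · rw [div_pow, div_pow, h1, ← add_div, div_eq_iff hT.ne']
      linarith
    · field_simp
      ring
    · field_simp
      ring

/-- The components of `σ̃` and `ñ` in a frame that is not rotating, normalised with the expansion. -/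
structure Lift (S T D A N n a z₁ z₂ w₁ w₂ : ℝ → ℝ) : Prop where
  da : ∀ τ, HasDerivAt a (2 * (1 - (A τ + n τ) + S τ) * a τ) τ
  dz₁ : ∀ τ, HasDerivAt z₁ (-2 * (A τ + n τ) * z₁ τ - 2 * N τ * w₁ τ + 2 * a τ * w₂ τ) τ
  dz₂ : ∀ τ, HasDerivAt z₂ (-2 * (A τ + n τ) * z₂ τ - 2 * N τ * w₂ τ - 2 * a τ * w₁ τ) τ
  dw₁ : ∀ τ, HasDerivAt w₁ (2 * (1 - (A τ + n τ) + S τ) * w₁ τ + 2 * N τ * z₁ τ) τ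
  dw₂ : ∀ τ, HasDerivAt w₂ (2 * (1 - (A τ + n τ) + S τ) * w₂ τ + 2 * N τ * z₂ τ) τ
  a_sq : ∀ τ, a τ ^ 2 = A τ
  z_sq : ∀ τ, z₁ τ ^ 2 + z₂ τ ^ 2 = T τ
  w_sq : ∀ τ, w₁ τ ^ 2 + w₂ τ ^ 2 = n τ
  inner : ∀ τ, z₁ τ * w₁ τ + z₂ τ * w₂ τ = D τ
  cross : ∀ τ, z₁ τ * w₂ τ - z₂ τ * w₁ τ = -(S τ * a τ)

theorem abs_N_le (h : VacuumFlow κ S T D A N n) (τ : ℝ) : |N τ| ≤ 2 + |κ| := by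
  have h1 := h.N_sq_le τ
  have h2 : (3 + |κ|) * (A τ + n τ) ≤ (3 + |κ|) * 1 :=
    mul_le_mul_of_nonneg_left (h.add_le_one τ) (by positivity)
  have h3 := abs_nonneg κ
  have h4 := sq_abs (N τ)
  nlinarith [sq_nonneg (|N τ| - 1)]

theorem abs_rate_le (h : VacuumFlow κ S T D A N n) (τ : ℝ) :
    |1 - (A τ + n τ) + S τ| ≤ 2 ∧ |1 - 2 * (A τ + n τ) + S τ| ≤ 2 ∧ |A τ + n τ| ≤ 1 := by
  have h1 := h.add_le_one τ
  have h2 := h.A_nonneg τ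
  have h3 := h.n_nonneg τ
  obtain ⟨h4, h5⟩ := abs_le.1 (h.abs_S_le_one τ)
  refine ⟨abs_le.2 ⟨?_, ?_⟩, abs_le.2 ⟨?_, ?_⟩, abs_le.2 ⟨?_, ?_⟩⟩ <;> linarith

theorem abs_a_le (h : VacuumFlow κ S T D A N n) {a : ℝ → ℝ} (ha : ∀ τ, a τ ^ 2 = A τ) (τ : ℝ) :
    |a τ| ≤ 1 := by
  rw [← sq_le_one_iff_abs_le_one, ha]
  linarith [h.add_le_one τ, h.n_nonneg τ]

theorem exists_lift (h : VacuumFlow κ S T D A N n) :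
    ∃ a z₁ z₂ w₁ w₂, Lift S T D A N n a z₁ z₂ w₁ w₂ := by
  obtain ⟨a, da, ha⟩ := h.exists_sqrt_A
  have hac : Continuous a := continuous_iff_continuousAt.2 fun τ => (da τ).continuousAt
  have hS := h.contDiff_S
  have hA := h.contDiff_A
  have hn := h.contDiff_n
  have hN := h.contDiff_N
  have ha1 : ContDiff ℝ 1 a := by
    have := h.continuous_S; have := h.continuous_A; have := h.continuous_n
    exact contDiff_succ_of_hasDerivAt (m := 0) da (contDiff_zero.2 (by fun_prop))
  obtain ⟨z₁0, z₂0, w₁0, w₂0, hz0, hw0, hi0, hc0⟩ := h.exists_initial_vectors ha 0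
  have hκ := abs_nonneg κ
  let B : ℝ → Matrix (Fin 4) (Fin 4) ℝ := fun τ =>
    !![-2 * (A τ + n τ), 0, -2 * N τ, 2 * a τ;
      0, -2 * (A τ + n τ), -2 * a τ, -2 * N τ;
      2 * N τ, 0, 2 * (1 - (A τ + n τ) + S τ), 0;
      0, 2 * N τ, 0, 2 * (1 - (A τ + n τ) + S τ)]
  obtain ⟨y, hy0, hy⟩ := exists_hasDerivAt_matrix (B := B) (K := 4 + 2 * |κ|)
    (by
      intro i j
      fin_cases i <;> fin_cases j <;> simp [B] <;> fun_prop)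
    (by positivity)
    (by
      intro τ i j
      have h1 := h.abs_N_le τ
      obtain ⟨h2, -, h3⟩ := h.abs_rate_le τ
      have h4 := h.abs_a_le ha τ
      fin_cases i <;> fin_cases j <;> simp [B, abs_mul] <;> linarith)
    ![z₁0, z₂0, w₁0, w₂0]
  have dz₁ : ∀ τ, HasDerivAt (fun τ => y τ 0)
      (-2 * (A τ + n τ) * y τ 0 - 2 * N τ * y τ 2 + 2 * a τ * y τ 3) τ := fun τ =>
    (hy τ 0).congr_deriv (by simp [B, Fin.sum_univ_four]; ring)
  have dz₂ : ∀ τ, HasDerivAt (fun τ => y τ 1)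
      (-2 * (A τ + n τ) * y τ 1 - 2 * N τ * y τ 3 - 2 * a τ * y τ 2) τ := fun τ =>
    (hy τ 1).congr_deriv (by simp [B, Fin.sum_univ_four]; ring)
  have dw₁ : ∀ τ, HasDerivAt (fun τ => y τ 2)
      (2 * (1 - (A τ + n τ) + S τ) * y τ 2 + 2 * N τ * y τ 0) τ := fun τ =>
    (hy τ 2).congr_deriv (by simp [B, Fin.sum_univ_four]; ring)
  have dw₂ : ∀ τ, HasDerivAt (fun τ => y τ 3)
      (2 * (1 - (A τ + n τ) + S τ) * y τ 3 + 2 * N τ * y τ 1) τ := fun τ =>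
    (hy τ 3).congr_deriv (by simp [B, Fin.sum_univ_four]; ring)
  let C : ℝ → Matrix (Fin 4) (Fin 4) ℝ := fun τ =>
    !![-4 * (A τ + n τ), 0, -4 * N τ, 4 * a τ;
      0, 4 * (1 - (A τ + n τ) + S τ), 4 * N τ, 0;
      2 * N τ, -2 * N τ, 2 * (1 - 2 * (A τ + n τ) + S τ), 0;
      0, 2 * a τ, 0, 2 * (1 - 2 * (A τ + n τ) + S τ)]
  have hg := eq_zero_of_hasDerivAt_matrix (B := C) (K := 8 + 4 * |κ|) (by positivity)
    (by
      intro τ i j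
      have h1 := h.abs_N_le τ
      obtain ⟨h2, h2', h3⟩ := h.abs_rate_le τ
      have h4 := h.abs_a_le ha τ
      fin_cases i <;> fin_cases j <;> simp [C, abs_mul] <;> linarith)
    (y := fun τ => ![y τ 0 ^ 2 + y τ 1 ^ 2 - T τ, y τ 2 ^ 2 + y τ 3 ^ 2 - n τ,
      y τ 0 * y τ 2 + y τ 1 * y τ 3 - D τ, y τ 0 * y τ 3 - y τ 1 * y τ 2 + S τ * a τ])
    (by
      funext i
      fin_cases i <;> simp [hy0, hz0, hw0, hi0, hc0])
    (by
      intro τ i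
      fin_cases i
      · refine ((((dz₁ τ).pow 2).add ((dz₂ τ).pow 2)).sub (h.dT τ)).congr_deriv ?_
        simp [C, Fin.sum_univ_four]
        linear_combination -4 * S τ * ha τ
      · refine ((((dw₁ τ).pow 2).add ((dw₂ τ).pow 2)).sub (h.dn τ)).congr_deriv ?_
        simp [C, Fin.sum_univ_four]
        ring
      · refine ((((dz₁ τ).mul (dw₁ τ)).add ((dz₂ τ).mul (dw₂ τ))).sub (h.dD τ)).congr_deriv ?_
        simp [C, Fin.sum_univ_four]
        ring
      · refine ((((dz₁ τ).mul (dw₂ τ)).sub ((dz₂ τ).mul (dw₁ τ))).add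
          ((h.dS τ).mul (da τ))).congr_deriv ?_
        simp [C, Fin.sum_univ_four]
        ring)
  refine ⟨a, fun τ => y τ 0, fun τ => y τ 1, fun τ => y τ 2, fun τ => y τ 3, da, dz₁, dz₂, dw₁, dw₂,
    ha, fun τ => ?_, fun τ => ?_, fun τ => ?_, fun τ => ?_⟩
  · have := congrFun (hg τ) 0
    simp at this
    linarith
  · have := congrFun (hg τ) 1
    simp at this
    linarith
  · have := congrFun (hg τ) 2
    simp at this
    linarith
  · have := congrFun (hg τ) 3
    simp at this
    linarith

end VacuumFlow

/-- A fundamental matrix of a linear system in two dimensions. -/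
theorem exists_fundamental_matrix {B : ℝ → Matrix (Fin 2) (Fin 2) ℝ}
    (hB : ∀ i j, ContDiff ℝ 1 fun t => B t i j) {K : ℝ} (hK0 : 0 ≤ K)
    (hK : ∀ t i j, |B t i j| ≤ K) :
    ∃ F : ℝ → Matrix (Fin 2) (Fin 2) ℝ, F 0 = 1 ∧
      (∀ t i j, HasDerivAt (fun s => F s i j) ((B t * F t) i j) t) ∧
      (∀ i j, ContDiff ℝ 2 fun t => F t i j) ∧ ∀ t, (F t).det ≠ 0 := by
  choose y hy0 hy using fun j : Fin 2 => exists_hasDerivAt_matrix hB hK0 hK (Pi.single j 1)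
  have hd : ∀ t i j, HasDerivAt (fun s => Matrix.of (fun i j => y j s i) i j)
      ((B t * Matrix.of (fun i j => y j t i)) i j) t := fun t i j =>
    (hy j t i).congr_deriv (by simp [Matrix.mul_apply])
  have hc : ∀ i j, Continuous fun t => y j t i := fun i j =>
    continuous_iff_continuousAt.2 fun t => (hy j t i).continuousAt
  have hc1 : ∀ i j, ContDiff ℝ 1 fun t => y j t i := fun i j => by
    refine contDiff_succ_of_hasDerivAt (m := 0) (fun t => hy j t i) (contDiff_zero.2 ?_)
    exact continuous_finsetSum _ fun k _ => (hB i k).continuous.mul (hc k j)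
  refine ⟨fun t => Matrix.of (fun i j => y j t i), ?_, hd, fun i j => ?_, fun t => ?_⟩
  · ext i j
    simp [hy0, Matrix.one_apply, Pi.single_apply]
  · refine contDiff_succ_of_hasDerivAt (m := 1) (fun t => hy j t i) ?_
    exact ContDiff.sum fun k _ => (hB i k).mul (hc1 k j)
  · obtain ⟨e, he0, hepos, he⟩ := exists_pos_hasDerivAt_mul (g := fun t => -(B t 0 0 + B t 1 1))
      (((hB 0 0).continuous.add (hB 1 1).continuous).neg)
    have hdet : ∀ t, HasDerivAt (fun t => (Matrix.of (fun i j => y j t i)).det * e t) 0 t := by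
      intro t
      simp only [Matrix.det_fin_two]
      refine ((((hd t 0 0).mul (hd t 1 1)).sub ((hd t 0 1).mul (hd t 1 0))).mul
        (he t)).congr_deriv ?_
      simp only [Matrix.mul_apply, Fin.sum_univ_two, Pi.mul_apply, Pi.sub_apply]
      ring
    have h1 := is_const_of_deriv_eq_zero (fun t => (hdet t).differentiableAt)
      (fun t => (hdet t).deriv) t 0
    have h2 : (Matrix.of fun i j => y j 0 i).det = 1 := by
      simp [Matrix.det_fin_two, hy0, Pi.single_apply]
    rw [h2, he0, mul_one] at h1
    exact left_ne_zero_of_mul_eq_one h1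

namespace VacuumFlow

variable {κ : ℝ} {S T D A N n a z₁ z₂ w₁ w₂ θ : ℝ → ℝ}

/-- The kinematic quantities of the reconstructed spacetime. -/
noncomputable def liftVars (S N a z₁ z₂ w₁ w₂ θ : ℝ → ℝ) (τ : ℝ) : FrameVars where
  th := θ τ
  sp := S τ * θ τ
  s1 := z₁ τ * θ τ / √3
  s2 := z₂ τ * θ τ / √3
  r := 0
  n1 := w₁ τ * θ τ / √3
  n2 := w₂ τ * θ τ / √3
  np := N τ * θ τ
  a1 := a τ * θ τ / 3

/-- Their derivatives in the direction of `e₀`. -/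
noncomputable def liftVars' (S N a z₁ z₂ w₁ w₂ θ : ℝ → ℝ) (τ : ℝ) : FrameVars :=
  let k := liftVars S N a z₁ z₂ w₁ w₂ θ τ
  { th := -(k.th ^ 2 / 3) - 2 / 3 * k.sp ^ 2 - 2 * (k.s1 ^ 2 + k.s2 ^ 2)
    sp := -(k.sp * k.th) - 2 * (k.n1 ^ 2 + k.n2 ^ 2)
    s1 := -(k.s1 * k.th) + 2 * k.r * k.s2 + 2 * k.a1 * k.n2 - 2 / 3 * k.n1 * k.np
    s2 := -(k.s2 * k.th) - 2 * k.r * k.s1 - 2 * k.a1 * k.n1 - 2 / 3 * k.n2 * k.np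
    r := 0
    n1 := k.timeOne * k.n1 + 2 / 3 * k.np * k.s1 + 2 * k.r * k.n2
    n2 := k.timeOne * k.n2 + 2 / 3 * k.np * k.s2 - 2 * k.r * k.n1
    np := k.timeOne * k.np + 6 * (k.s1 * k.n1 + k.s2 * k.n2)
    a1 := k.timeOne * k.a1 }

theorem jacobi_lift (τ : ℝ) : (liftVars S N a z₁ z₂ w₁ w₂ θ τ).Jacobi
    (liftVars' S N a z₁ z₂ w₁ w₂ θ τ) := ⟨rfl, rfl, rfl, rfl⟩

theorem sq_add_sq_div_sqrt_three (x y t : ℝ) :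
    (x * t / √3) ^ 2 + (y * t / √3) ^ 2 = (x ^ 2 + y ^ 2) * t ^ 2 / 3 := by
  have h3 : √3 ^ 2 = (3 : ℝ) := Real.sq_sqrt (by norm_num)
  rw [div_pow, div_pow, h3]
  ring

theorem mul_div_sqrt_three (x y t : ℝ) : (x * t / √3) * (y * t / √3) = x * y * t ^ 2 / 3 := by
  rw [div_mul_div_comm, Real.mul_self_sqrt (by norm_num)]
  ring

theorem einstein_lift (h : VacuumFlow κ S T D A N n) (L : Lift S T D A N n a z₁ z₂ w₁ w₂) (τ : ℝ) :
    (liftVars S N a z₁ z₂ w₁ w₂ θ τ).Einstein (liftVars' S N a z₁ z₂ w₁ w₂ θ τ) := by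
  refine ⟨rfl, rfl, rfl, rfl, ?_, ?_⟩
  · have h1 := L.cross τ
    have h2 := mul_div_sqrt_three (w₂ τ) (z₁ τ) (θ τ)
    have h3 := mul_div_sqrt_three (w₁ τ) (z₂ τ) (θ τ)
    simp only [liftVars]
    linear_combination h2 - h3 + θ τ ^ 2 / 3 * h1
  · have h1 := sq_add_sq_div_sqrt_three (z₁ τ) (z₂ τ) (θ τ)
    have h2 := sq_add_sq_div_sqrt_three (w₁ τ) (w₂ τ) (θ τ)
    rw [L.z_sq] at h1
    rw [L.w_sq] at h2
    simp only [liftVars]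
    linear_combination -3 * h1 - 3 * h2 - θ τ ^ 2 * h.hamiltonian τ - θ τ ^ 2 * L.a_sq τ

theorem hasDeriv_lift (h : VacuumFlow κ S T D A N n) (L : Lift S T D A N n a z₁ z₂ w₁ w₂)
    (hθ : ∀ τ, HasDerivAt θ (-(1 + 2 * (S τ ^ 2 + T τ)) * θ τ) τ) (hpos : ∀ τ, 0 < θ τ) (τ : ℝ) :
    FrameVars.HasDeriv (3 / θ τ) (liftVars S N a z₁ z₂ w₁ w₂ θ)
      (liftVars' S N a z₁ z₂ w₁ w₂ θ τ) τ := by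
  have hne := (hpos τ).ne'
  have h3 : √3 ^ 2 = (3 : ℝ) := Real.sq_sqrt (by norm_num)
  have h30 : √3 ≠ 0 := by positivity
  have hz := sq_add_sq_div_sqrt_three (z₁ τ) (z₂ τ) (θ τ)
  have hw := sq_add_sq_div_sqrt_three (w₁ τ) (w₂ τ) (θ τ)
  have hi₁ := mul_div_sqrt_three (z₁ τ) (w₁ τ) (θ τ)
  have hi₂ := mul_div_sqrt_three (z₂ τ) (w₂ τ) (θ τ)
  rw [L.z_sq] at hz
  rw [L.w_sq] at hw
  have hi : z₁ τ * θ τ / √3 * (w₁ τ * θ τ / √3) + z₂ τ * θ τ / √3 * (w₂ τ * θ τ / √3) =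
      D τ * θ τ ^ 2 / 3 := by
    rw [hi₁, hi₂, ← L.inner]
    ring
  have hH : S τ ^ 2 + T τ = 1 - (A τ + n τ) := by linarith [h.hamiltonian τ]
  refine ⟨?_, ?_, ?_, ?_, ?_, ?_, ?_, ?_, ?_⟩
  · refine (hθ τ).congr_deriv ?_
    simp only [liftVars', liftVars, hz]
    field_simp
    ring
  · refine ((h.dS τ).mul (hθ τ)).congr_deriv ?_
    simp only [liftVars', liftVars, hw, hH]
    field_simp
    ring
  · refine (((L.dz₁ τ).mul (hθ τ)).div_const _).congr_deriv ?_
    simp only [liftVars', liftVars, hH]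
    field_simp
    ring
  · refine (((L.dz₂ τ).mul (hθ τ)).div_const _).congr_deriv ?_
    simp only [liftVars', liftVars, hH]
    field_simp
    ring
  · simpa [liftVars, liftVars'] using hasDerivAt_const τ (0 : ℝ)
  · refine (((L.dw₁ τ).mul (hθ τ)).div_const _).congr_deriv ?_
    simp only [liftVars', liftVars, hH, FrameVars.timeOne]
    field_simp
    ring
  · refine (((L.dw₂ τ).mul (hθ τ)).div_const _).congr_deriv ?_
    simp only [liftVars', liftVars, hH, FrameVars.timeOne]
    field_simp
    ring
  · refine ((h.dN τ).mul (hθ τ)).congr_deriv ?_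
    simp only [liftVars', liftVars, hH, hi, FrameVars.timeOne]
    field_simp
    ring
  · refine (((L.da τ).mul (hθ τ)).div_const _).congr_deriv ?_
    simp only [liftVars', liftVars, hH, FrameVars.timeOne]
    field_simp
    ring

end VacuumFlow

theorem FrameVars.Jacobi.space_apply {k k' : FrameVars} (h : k.Jacobi k') (i j : Fin 2) :
    k'.space i j = k.timeOne * k.space i j
      + (k.time i 0 * k.space 0 j + k.time i 1 * k.space 1 j)
      - (k.space i 0 * k.time 0 j + k.space i 1 * k.time 1 j) := by
  fin_cases i <;> fin_cases j <;>
    simp [FrameVars.space, FrameVars.time, h.n1, h.n2, h.np, h.a1] <;> ring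

/-- The kinematic quantities are determined by the structure functions. -/
theorem FrameVars.eq_of_coeff {k l : FrameVars} (h1 : k.timeOne = l.timeOne) (h2 : k.time = l.time)
    (h3 : k.space = l.space) : k = l := by
  have t00 := congrFun (congrFun h2 0) 0
  have t01 := congrFun (congrFun h2 0) 1
  have t10 := congrFun (congrFun h2 1) 0
  have t11 := congrFun (congrFun h2 1) 1
  have m00 := congrFun (congrFun h3 0) 0
  have m01 := congrFun (congrFun h3 0) 1
  have m10 := congrFun (congrFun h3 1) 0
  have m11 := congrFun (congrFun h3 1) 1
  simp only [FrameVars.time, FrameVars.space, FrameVars.timeOne, Matrix.of_apply, Matrix.cons_val',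
    Matrix.cons_val_zero, Matrix.cons_val_one, Matrix.cons_val_fin_one] at *
  cases k
  cases l
  simp only [FrameVars.mk.injEq] at *
  refine ⟨?_, ?_, ?_, ?_, ?_, ?_, ?_, ?_, ?_⟩ <;> linarith

namespace VacuumFlow

variable {κ : ℝ} {S T D A N n a z₁ z₂ w₁ w₂ θ : ℝ → ℝ}

/-- The logarithmic derivative of the coefficients of the orthonormal frame. -/
noncomputable def frameRate (S z₁ z₂ : ℝ → ℝ) (τ : ℝ) : Matrix (Fin 2) (Fin 2) ℝ :=
  !![-(1 + S τ) - √3 * z₁ τ, -(√3 * z₂ τ); -(√3 * z₂ τ), -(1 + S τ) + √3 * z₁ τ]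

theorem frameRate_apply (τ : ℝ) (hθ : θ τ ≠ 0) (i j : Fin 2) :
    frameRate S z₁ z₂ τ i j = 3 / θ τ * (liftVars S N a z₁ z₂ w₁ w₂ θ τ).time i j := by
  have h30 : √3 ≠ 0 := by positivity
  have h3 : √3 ^ 2 = (3 : ℝ) := Real.sq_sqrt (by norm_num)
  fin_cases i <;> fin_cases j <;>
    simp [frameRate, FrameVars.time, liftVars] <;> field_simp <;> ring_nf <;>
    (try rw [h3]) <;> ring

theorem abs_frameRate_le (h : VacuumFlow κ S T D A N n) (L : Lift S T D A N n a z₁ z₂ w₁ w₂)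
    (τ : ℝ) (i j : Fin 2) : |frameRate S z₁ z₂ τ i j| ≤ 4 := by
  have hs : √3 ≤ 2 := by
    rw [Real.sqrt_le_left (by norm_num)]
    norm_num
  have hs0 : 0 ≤ √3 := Real.sqrt_nonneg _
  have hz := L.z_sq τ
  have hT := h.T_le_one τ
  have hz₁ : |z₁ τ| ≤ 1 := by
    rw [← sq_le_one_iff_abs_le_one]
    linarith [sq_nonneg (z₂ τ)]
  have hz₂ : |z₂ τ| ≤ 1 := by
    rw [← sq_le_one_iff_abs_le_one]
    linarith [sq_nonneg (z₁ τ)]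
  have h1 : |√3 * z₁ τ| ≤ 2 := by
    rw [abs_mul, abs_of_nonneg hs0]
    exact (mul_le_mul hs hz₁ (abs_nonneg _) (by norm_num)).trans (by norm_num)
  have h2 : |√3 * z₂ τ| ≤ 2 := by
    rw [abs_mul, abs_of_nonneg hs0]
    exact (mul_le_mul hs hz₂ (abs_nonneg _) (by norm_num)).trans (by norm_num)
  obtain ⟨h3, h4⟩ := abs_le.1 h1
  obtain ⟨h5, h6⟩ := abs_le.1 h2
  obtain ⟨h7, h8⟩ := abs_le.1 (h.abs_S_le_one τ)
  fin_cases i <;> fin_cases j <;> simp only [frameRate, Fin.zero_eta, Fin.mk_one, Fin.isValue,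
    Matrix.of_apply, Matrix.cons_val', Matrix.cons_val_zero, Matrix.cons_val_one,
    Matrix.cons_val_fin_one] <;> rw [abs_le] <;> constructor <;> linarith

theorem Lift.contDiff_z (h : VacuumFlow κ S T D A N n) (L : Lift S T D A N n a z₁ z₂ w₁ w₂) :
    ContDiff ℝ 1 z₁ ∧ ContDiff ℝ 1 z₂ := by
  have := h.continuous_A; have := h.continuous_n; have := h.continuous_N
  have : Continuous a := continuous_iff_continuousAt.2 fun τ => (L.da τ).continuousAt
  have : Continuous z₁ := continuous_iff_continuousAt.2 fun τ => (L.dz₁ τ).continuousAt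
  have : Continuous z₂ := continuous_iff_continuousAt.2 fun τ => (L.dz₂ τ).continuousAt
  have : Continuous w₁ := continuous_iff_continuousAt.2 fun τ => (L.dw₁ τ).continuousAt
  have : Continuous w₂ := continuous_iff_continuousAt.2 fun τ => (L.dw₂ τ).continuousAt
  exact ⟨contDiff_succ_of_hasDerivAt (m := 0) L.dz₁ (contDiff_zero.2 (by fun_prop)),
    contDiff_succ_of_hasDerivAt (m := 0) L.dz₂ (contDiff_zero.2 (by fun_prop))⟩

/-- Solutions of a scalar linear equation with `C¹` coefficient are `C²`. -/
theorem contDiff_two_of_hasDerivAt_mul {g e : ℝ → ℝ} (hg : ContDiff ℝ 1 g)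
    (he : ∀ τ, HasDerivAt e (g τ * e τ) τ) : ContDiff ℝ 2 e := by
  have hc : Continuous e := continuous_iff_continuousAt.2 fun τ => (he τ).continuousAt
  have h1 : ContDiff ℝ 1 e :=
    contDiff_succ_of_hasDerivAt (m := 0) he (contDiff_zero.2 (hg.continuous.mul hc))
  exact contDiff_succ_of_hasDerivAt (m := 1) he (hg.mul h1)

/-- The spacetime with prescribed kinematic quantities. -/
theorem exists_spacetime (h : VacuumFlow κ S T D A N n) (L : Lift S T D A N n a z₁ z₂ w₁ w₂)
    (hθ : ∀ τ, HasDerivAt θ (-(1 + 2 * (S τ ^ 2 + T τ)) * θ τ) τ) (hpos : ∀ τ, 0 < θ τ) :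
    ∃ B : BianchiSpacetime, (∀ τ, B.lapse τ = 3 / θ τ) ∧
      ∀ τ, B.vars τ = liftVars S N a z₁ z₂ w₁ w₂ θ τ := by
  have hS := h.contDiff_S
  have hT := h.contDiff_T
  obtain ⟨hz₁, hz₂⟩ := L.contDiff_z h
  obtain ⟨f, hf0, hfpos, hf⟩ := exists_pos_hasDerivAt_mul (g := fun τ => -(1 - 2 * S τ))
    (by have := h.continuous_S; fun_prop)
  obtain ⟨F, hF0, hF, hFc, hFdet⟩ := exists_fundamental_matrix (B := frameRate S z₁ z₂) (K := 4)
    (by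
      intro i j
      fin_cases i <;> fin_cases j <;> simp [frameRate] <;> fun_prop)
    (by norm_num) (fun τ => h.abs_frameRate_le L τ)
  let k := liftVars S N a z₁ z₂ w₁ w₂ θ
  have hk := h.hasDeriv_lift L hθ hpos
  have hrate : ∀ τ i j, frameRate S z₁ z₂ τ i j = 3 / θ τ * (k τ).time i j := fun τ i j =>
    frameRate_apply τ (hpos τ).ne' i j
  have hrate₁ : ∀ τ, -(1 - 2 * S τ) = 3 / θ τ * (k τ).timeOne := fun τ => by
    have := (hpos τ).ne'
    simp only [k, liftVars, FrameVars.timeOne]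
    field_simp
    ring
  have hdm : ∀ τ i j, HasDerivAt (fun s => (k s).space i j)
      (-(1 - 2 * S τ) * (k τ).space i j
      + (frameRate S z₁ z₂ τ i 0 * (k τ).space 0 j + frameRate S z₁ z₂ τ i 1 * (k τ).space 1 j)
      - ((k τ).space i 0 * frameRate S z₁ z₂ τ 0 j
        + (k τ).space i 1 * frameRate S z₁ z₂ τ 1 j)) τ := fun τ i j =>
    ((hk τ).space i j).congr_deriv (by
      rw [(jacobi_lift τ).space_apply, hrate₁]
      simp only [hrate]
      simp only [k]
      ring)
  have hzero : ∀ τ i j, (k τ).space i 0 * F τ 0 j + (k τ).space i 1 * F τ 1 j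
      - f τ * (F τ i 0 * (k 0).space 0 j + F τ i 1 * (k 0).space 1 j) = 0 := by
    intro τ i j
    have := eq_zero_of_hasDerivAt_matrix
      (B := fun τ => (-(1 - 2 * S τ)) • (1 : Matrix (Fin 2) (Fin 2) ℝ) + frameRate S z₁ z₂ τ)
      (K := 7) (by norm_num)
      (by
        intro τ i j
        obtain ⟨h1, h2⟩ := abs_le.1 (h.abs_S_le_one τ)
        obtain ⟨h3, h4⟩ := abs_le.1 (h.abs_frameRate_le L τ i j)
        simp only [Matrix.add_apply, Matrix.smul_apply, Matrix.one_apply, smul_eq_mul]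
        rw [abs_le]
        split_ifs <;> constructor <;> linarith)
      (y := fun τ i => (k τ).space i 0 * F τ 0 j + (k τ).space i 1 * F τ 1 j
        - f τ * (F τ i 0 * (k 0).space 0 j + F τ i 1 * (k 0).space 1 j))
      (by
        funext i
        rw [hF0, hf0]
        fin_cases i <;> fin_cases j <;> simp [Matrix.one_apply])
      (by
        intro τ i
        refine ((((hdm τ i 0).mul (hF τ 0 j)).add ((hdm τ i 1).mul (hF τ 1 j))).sub
          ((hf τ).mul (((hF τ i 0).mul_const _).add ((hF τ i 1).mul_const _)))).congr_deriv ?_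
        simp only [Matrix.mul_apply, Fin.sum_univ_two, Matrix.add_apply, Matrix.smul_apply,
          Matrix.one_apply, smul_eq_mul, Pi.add_apply]
        fin_cases i <;> simp <;> ring) τ
    exact congrFun this i
  have hθ2 : ContDiff ℝ 2 θ := contDiff_two_of_hasDerivAt_mul (by fun_prop) hθ
  let B : BianchiSpacetime :=
    { M := (k 0).space
      lapse := fun τ => 3 / θ τ
      f := f
      F := F
      lapse_pos := fun τ => div_pos (by norm_num) (hpos τ)
      f_ne_zero := fun τ => (hfpos τ).ne'
      det_F_ne_zero := hFdet
      contDiff_lapse := contDiff_const.div hθ2 fun τ => (hpos τ).ne'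
      contDiff_f := contDiff_two_of_hasDerivAt_mul (by fun_prop) hf
      contDiff_F := hFc }
  have htime₁ : ∀ τ, B.timeCoeffOne τ = (k τ).timeOne := fun τ => by
    have h1 := (hpos τ).ne'
    have h2 := (hfpos τ).ne'
    change (3 / θ τ)⁻¹ * (deriv f τ / f τ) = _
    rw [(hf τ).deriv, hrate₁]
    field_simp
  have htime : ∀ τ, B.timeCoeff τ = (k τ).time := fun τ => by
    have h1 := (hpos τ).ne'
    have h2 : Matrix.of (fun i j => deriv (fun s => F s i j) τ) = frameRate S z₁ z₂ τ * F τ := by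
      ext i j
      exact (hF τ i j).deriv
    change (3 / θ τ)⁻¹ • (Matrix.of (fun i j => deriv (fun s => F s i j) τ) * (F τ)⁻¹) = _
    rw [h2, Matrix.mul_nonsing_inv_cancel_right _ _ (isUnit_iff_ne_zero.2 (hFdet τ))]
    ext i j
    rw [Matrix.smul_apply, hrate, smul_eq_mul, inv_mul_cancel_left₀ (by positivity)]
  have hspace : ∀ τ, B.spaceCoeff τ = (k τ).space := fun τ => by
    have h1 : (k τ).space * F τ = f τ • (F τ * (k 0).space) := by
      ext i j
      simp only [Matrix.mul_apply, Fin.sum_univ_two, Matrix.smul_apply, smul_eq_mul]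
      linarith [hzero τ i j]
    change f τ • (F τ * (k 0).space * (F τ)⁻¹) = _
    rw [← Matrix.smul_mul, ← h1,
      Matrix.mul_nonsing_inv_cancel_right _ _ (isUnit_iff_ne_zero.2 (hFdet τ))]
  refine ⟨B, fun τ => rfl, fun τ => ?_⟩
  have e1 : (B.vars τ).timeOne = (k τ).timeOne := by rw [B.vars_timeOne, htime₁]
  have e2 : (B.vars τ).time = (k τ).time := by rw [B.vars_time, htime]
  have e3 : (B.vars τ).space = (k τ).space := by rw [B.vars_space, hspace]
  exact FrameVars.eq_of_coeff e1 e2 e3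

end VacuumFlow

namespace IsHWSolution

variable {γ κ : ℝ} {Γ : ℝ → HWState}

/-- A solution in vacuum describes a spacetime with any prescribed initial mean curvature. -/
theorem exists_realises (hΓ : IsHWSolution γ κ Γ) (hv : ∀ τ, (Γ τ).density κ = 0) {θ₀ : ℝ}
    (hθ₀ : 0 < θ₀) : ∃ B : BianchiSpacetime, B.Realises κ Γ ∧ B.theta 0 = θ₀ := by
  have h := hΓ.vacuumFlow hv
  obtain ⟨a, z₁, z₂, w₁, w₂, L⟩ := h.exists_lift
  obtain ⟨e, he0, hepos, he⟩ := exists_pos_hasDerivAt_mul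
    (g := fun τ => -(1 + 2 * ((Γ τ).sigmaPlus ^ 2 + (Γ τ).sigmaTilde)))
    (by have := h.continuous_S; have := h.continuous_T; fun_prop)
  let θ : ℝ → ℝ := fun τ => θ₀ * e τ
  have hpos : ∀ τ, 0 < θ τ := fun τ => mul_pos hθ₀ (hepos τ)
  have hθ : ∀ τ, HasDerivAt θ
      (-(1 + 2 * ((Γ τ).sigmaPlus ^ 2 + (Γ τ).sigmaTilde)) * θ τ) τ := fun τ =>
    ((he τ).const_mul θ₀).congr_deriv (by simp only [θ]; ring)
  obtain ⟨B, hlapse, hvars⟩ := h.exists_spacetime L hθ hpos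
  have hth : ∀ τ, B.theta τ = θ τ := fun τ => congrArg FrameVars.th (hvars τ)
  have hsp : ∀ τ, B.sigmaPlus τ = (Γ τ).sigmaPlus * θ τ := fun τ =>
    congrArg FrameVars.sp (hvars τ)
  have hnp : ∀ τ, B.nPlus τ = (Γ τ).nPlus * θ τ := fun τ => congrArg FrameVars.np (hvars τ)
  have ha : ∀ τ, B.aOne τ = a τ * θ τ / 3 := fun τ => congrArg FrameVars.a1 (hvars τ)
  refine ⟨B, ⟨fun τ α β => ?_, fun τ => ?_, fun τ => ?_, fun τ => ?_, fun τ => ?_, fun τ => ?_,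
    fun τ => ?_, fun τ => ?_, fun τ => ?_⟩, ?_⟩
  · have hd := h.hasDeriv_lift L hθ hpos τ
    rw [← hlapse] at hd
    rw [BianchiSpacetime.ricci, FrameVars.frameRicci_eq_ricci
      (fun s => (B.structureFun_eq s).trans (congrArg FrameVars.coeff (hvars s)))
      (B.lapse_pos τ).ne' hd]
    exact (h.einstein_lift L τ).ricci_eq_zero (VacuumFlow.jacobi_lift τ) α β
  · rw [hth]
    exact hpos τ
  · rw [hlapse, hth]
  · rw [hsp, hth, mul_div_cancel_right₀ _ (hpos τ).ne']
  · rw [hth, eq_div_iff (pow_ne_zero 2 (hpos τ).ne'), B.vars_s1_sq, hvars]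
    simp only [VacuumFlow.liftVars, VacuumFlow.sq_add_sq_div_sqrt_three, L.z_sq]
    ring
  · rw [hth, eq_div_iff (pow_ne_zero 2 (hpos τ).ne'), B.vars_delta, hvars]
    simp only [VacuumFlow.liftVars, VacuumFlow.mul_div_sqrt_three, ← L.inner]
    ring
  · rw [hth, eq_div_iff (pow_ne_zero 2 (hpos τ).ne'), BianchiSpacetime.aTilde, ha]
    linear_combination -(θ τ ^ 2) * L.a_sq τ
  · rw [hnp, hth, mul_div_cancel_right₀ _ (hpos τ).ne']
  · rw [hth, eq_div_iff (pow_ne_zero 2 (hpos τ).ne'), B.vars_n1_sq, hvars]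
    simp only [VacuumFlow.liftVars, VacuumFlow.sq_add_sq_div_sqrt_three, L.w_sq]
    ring
  · rw [hth]
    simp only [θ, he0, mul_one]

/-- A vacuum solution other than the exceptional ones converges towards the past to a Kasner point
different from Taub 1 and from the locally rotationally symmetric one with `Σ₊ = 1/2`. -/
theorem exists_pastLimit (hΓ : IsHWSolution γ κ Γ) (hv : ∀ τ, (Γ τ).density κ = 0)
    (hTaub : ¬ ∀ τ, Γ τ = HWState.taubOne) (hLRS : ¬ ∀ τ, (Γ τ).IsLRS κ)
    (hplane : ¬ ∃ p ∈ HWState.planeWave κ, ∀ τ, Γ τ = p) :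
    ∃ s, s ≠ 1 / 2 ∧ VacuumFlow.PastLimit (fun τ => (Γ τ).sigmaPlus) (fun τ => (Γ τ).sigmaTilde)
      (fun τ => (Γ τ).delta) (fun τ => (Γ τ).aTilde) (fun τ => (Γ τ).nPlus)
      (fun τ => (Γ τ).nTilde κ) s := by
  have h := hΓ.vacuumFlow hv
  have hZ : ∃ t, (1 + (Γ t).sigmaPlus) ^ 2 - (Γ t).aTilde ≠ 0 := by
    by_contra! hZ
    have hc := h.eq_of_Z_eq_zero hZ
    have hN0 := h.hn 0
    obtain ⟨hge, -, hT0, hD0, hA0, hn0, -⟩ := hc 0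
    have hconst : ∀ τ, Γ τ = Γ 0 := by
      intro τ
      obtain ⟨-, hS, hT, hD, hA, -, hN⟩ := hc τ
      exact HWState.ext hS (hT.trans hT0.symm) (hD.trans hD0.symm) (hA.trans hA0.symm) hN
    rw [hn0, hA0] at hN0
    rcases hge.eq_or_lt with h1 | h1
    · rw [← h1] at hT0 hA0 hN0
      refine hTaub fun τ => (hconst τ).trans (HWState.ext h1.symm ?_ hD0 ?_ ?_)
      · simpa [HWState.taubOne] using hT0
      · simpa [HWState.taubOne] using hA0
      · exact pow_eq_zero_iff two_ne_zero |>.1 (by simpa using hN0)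
    · exact hplane ⟨Γ 0, ⟨h1, hT0, hD0, hA0, by linear_combination hN0⟩, hconst⟩
  obtain ⟨t, ht⟩ := hZ
  obtain ⟨s, hs⟩ := h.exists_pastLimit ht
  refine ⟨s, ?_, hs⟩
  rintro rfl
  refine hLRS fun τ => ?_
  obtain ⟨h1, h2, h3⟩ := h.isLRS_of_pastLimit ht hs τ
  exact ⟨by linarith, by linarith, h3⟩

end IsHWSolution

/-- The Kretschmann scalar is unbounded towards a Kasner point different from Taub 1 and from the
locally rotationally symmetric one with `Σ₊ = 1/2`. -/
theorem BianchiSpacetime.Realises.exists_lt_abs_kretschmann {B : BianchiSpacetime} {κ s : ℝ}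
    {Γ : ℝ → HWState} (hB : B.Realises κ Γ) (hs : s ≠ 1 / 2)
    (hl : VacuumFlow.PastLimit (fun τ => (Γ τ).sigmaPlus) (fun τ => (Γ τ).sigmaTilde)
      (fun τ => (Γ τ).delta) (fun τ => (Γ τ).aTilde) (fun τ => (Γ τ).nPlus)
      (fun τ => (Γ τ).nTilde κ) s) (C T : ℝ) : ∃ τ ≤ T, C < |B.kretschmann τ| := by
  have hθ : Tendsto B.theta atBot atTop := by
    refine tendsto_atTop_mono' _
      ((eventually_le_atBot 0).mono fun τ hτ => hB.exp_le_theta hτ) ?_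
    exact (Real.tendsto_exp_atTop.comp tendsto_neg_atBot_atTop).const_mul_atTop (hB.theta_pos 0)
  have hs1 := hl.s_gt
  have hc : (0 : ℝ) < 12 * ((1 - s ^ 2) / 3 - (1 + s) ^ 2 / 9 - 0 / 3 + 0 / 9) ^ 2
      + 16 * ((1 - 2 * s) ^ 2 * (1 - s ^ 2) + 4 * 0 ^ 2 * 0 + 4 * 0 * 0
        + 4 * (1 - 2 * s) * 0 * 0 + 4 * (1 - 2 * s) * 0 * s) / 27
      - 16 / 3 * 0 ^ 2
      - 16 * (9 * s ^ 2 * 0 + 4 * 0 ^ 2 * (1 - s ^ 2) + 0 * (1 - s ^ 2) + 12 * s * 0 * 0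
        - 6 * s ^ 2 * 0) / 27 := by
    have h1 : (0 : ℝ) < (1 + s) ^ 2 * (1 - 2 * s) ^ 2 := by
      have h2 : 1 - 2 * s ≠ 0 := fun h => hs (by linarith)
      have h3 : 1 + s ≠ 0 := by linarith
      positivity
    have h4 : 0 ≤ (1 - 2 * s) ^ 2 * (1 - s ^ 2) :=
      mul_nonneg (sq_nonneg _) (by nlinarith [hl.s_le])
    nlinarith
  have hK : Tendsto (fun τ => |B.kretschmann τ|) atBot atTop := by
    refine tendsto_abs_atTop_atTop.comp ?_
    refine Tendsto.congr (fun τ => (hB.kretschmann_eq τ).symm) ?_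
    refine ((tendsto_pow_atTop four_ne_zero).comp hθ).atTop_mul_pos hc ?_
    have hS := hl.S
    have hT := hl.T
    have hD := hl.D
    have hA := hl.A
    have hN := hl.N
    have hn := hl.n
    exact ((((((hT.div_const 3).sub (((hS.const_add 1).pow 2).div_const 9)).sub
      (hn.div_const 3)).add (hA.div_const 9)).pow 2).const_mul 12 |>.add
      ((((((((((hS.const_mul 2).const_sub 1).pow 2).mul hT).add
        (((hN.pow 2).const_mul 4).mul hn)).add ((hA.const_mul 4).mul hn)).add
        (((((hS.const_mul 2).const_sub 1).const_mul 4).mul hN).mul hD)).add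
        (((((hS.const_mul 2).const_sub 1).const_mul 4).mul hA).mul hS)).const_mul 16).div_const
          27) |>.sub ((hD.pow 2).const_mul (16 / 3)) |>.sub
      ((((((((((hS.pow 2).const_mul 9).mul hn).add (((hN.pow 2).const_mul 4).mul hT)).add
        (hA.mul hT)).add (((hS.const_mul 12).mul hN).mul hD)).sub
        (((hS.pow 2).const_mul 6).mul hA)).const_mul 16).div_const 27)))
  obtain ⟨τ, h1, h2⟩ := ((hK.eventually_gt_atTop C).and (eventually_le_atBot T)).exists
  exact ⟨τ, h2, h1⟩

end Vacuum

theorem mainTheorem4 (γ κ : ℝ) (hγ₀ : 0 ≤ γ) (hγ₂ : γ ≤ 2) (Γ : ℝ → HWState)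
    (hΓ : IsHWSolution γ κ Γ)
    (hvacuum : ∀ τ, (Γ τ).density κ = 0)
    (hTaub : ¬ ∀ τ, Γ τ = HWState.taubOne)
    (hLRS : ¬ ∀ τ, (Γ τ).IsLRS κ)
    (hplane : ¬ ∃ p ∈ HWState.planeWave κ, ∀ τ, Γ τ = p) :
    (∀ θ₀ : ℝ, 0 < θ₀ → ∃ S : BianchiSpacetime, S.Realises κ Γ ∧ S.theta 0 = θ₀) ∧
      ∀ S : BianchiSpacetime, S.Realises κ Γ →
        ∀ C T : ℝ, ∃ τ ≤ T, C < |S.kretschmann τ| :=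
  ⟨fun _ hθ₀ => hΓ.exists_realises hvacuum hθ₀, fun _ hS =>
    have ⟨_, hs, hl⟩ := hΓ.exists_pastLimit hvacuum hTaub hLRS hplane
    hS.exists_lt_abs_kretschmann hs hl⟩
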